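/- **Setting.** Let $\Omega$ be a Polish space, $B_0$ a probability measure on $\Omega$ without atoms, and $\rho(s|\omega)\ge 0$ ($s>0$, $\omega\in\Omega$) a jointly measurable function with $\int_0^\infty \min(s,1)\rho(s|\omega)\,ds<\infty$ for all $\omega$. Let $G_A(da|s)$ be a probability kernel from $\mathbb R$ to a finite-dimensional real vector space $E$ (e.g. $E=\mathbb R$), put $\pi_A(s)=G_A(\{a\neq 0\}|s)$, and suppose that $\pi_A(s)<1$ for almost every $(s,\omega)$ with respect to $\nu(ds,d\omega)=\rho(s|\omega)\,ds\,B_0(d\omega)$ on $(0,\infty)\times\Omega$, and that $\int_\Omega\int_0^\infty \pi_A(s)\rho(s|\omega)\,ds\,B_0(d\omega)<\infty$. For a measure $\nu'$ of the form $\rho'(s|\omega)\,ds\,B_0(d\omega)$ on $(0,\infty)\times\Omega$ let $N=\sum_k\delta_{(\tau_k,\tilde\omega_k)}$ be a Poisson random measure with mean intensity $\nu'$, so that $\mu=\sum_k\tau_k\delta_{\tilde\omega_k}$ is the completely random measure $\mathrm{CRM}(\nu')$. We say that $Z_1,Z_2,\dots|\mu$ are iid $\mathrm{IBP}(G_A|\mu)$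 if $Z_i=\sum_k A_{i,k}\delta_{\tilde\omega_k}$, where, conditionally on the points $(\tau_k,\tilde\omega_k)_k$, the $A_{i,k}$ are independent and $A_{i,k}$ has distribution $G_A(\cdot|\tau_k)$. The marginal law of each $Z_i$ is called $\mathrm{IBP}(A,\nu')$. Put $\rho_M(s|\omega)=[1-\pi_A(s)]^M\rho(s|\omega)$. **Proposition.** Let $M\ge 0$ and let $Z_1,\dots,Z_M,Z_{M+1}|\mu$ be iid $\mathrm{IBP}(G_A|\mu)$, where $\mu$ is $\mathrm{CRM}(\rho B_0)$, i.e. $\mathrm{CRM}(\nu)$. Then almost surely every $Z_i$ is a finite sum. Let $\omega_1,\dots,\omega_K$ be the finitely many distinct features already chosen, that is, the locations of the atoms of $Z_1,\dots,Z_M$, and let $a_{i,\ell}=Z_i(\{\omega_\ell\})$. The (regular) conditional distribution of $Z_{M+1}$ given $Z_1,\dots,Z_M$ is almost surely the distribution of $$\tilde Z_{M+1}+\sum_{\ell=1}^K A_\ell\,\delta_{\omega_\ell},$$ where $\tilde Z_{M+1}$ has law $\mathrm{IBP}(A,\rho_M B_0)$, the pairs $(J_\ell,A_\ell)$, $\ell\le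 K$, are independent of each other and of $\tilde Z_{M+1}$, $A_\ell|J_\ell=s$ has distribution $G_A(da|s)$, and $J_\ell$ has the law $$\mathbb P_{\ell,M}(J_\ell\in ds)\ \propto\ [1-\pi_A(s)]^M\rho(s|\omega_\ell)\prod_{i=1}^M h_{i,\ell}(s)\,ds,\qquad h_{i,\ell}(s)=\Big[\frac{G_A(da_{i,\ell}|s)}{1-\pi_A(s)}\Big]^{\mathbb I\{a_{i,\ell}\ne 0\}} .$$ Thus $A_\ell$ has distribution $\int_0^\infty G_A(da|y)\,\mathbb P_{\ell,M}(dy)$. In general, the displayed formula for the law of $J_\ell$ is understood as a disintegration: $\mathbb P_{\ell,M}(ds)=P(ds\,|\,\omega_\ell,(a_{i,\ell})_{i\le M})$, where $P$ is any Markov kernel such that the measure $\mathbb I\{a\ne0\}\prod_{i\le M}G_A(da_i|s)\,\rho(s|\omega)\,ds\,B_0(d\omega)$ of $(\omega,a,s)$ equals the product of its $(\omega,a)$-marginal with $P(ds|\omega,a)$; such a $P$ exists. If $G_A(da|s)=g(a,s)\,\lambda(da)$ on $\{a\neq 0\}$ for $\nu$-almost every $(s,\omega)$, with $\lambda$ a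 $\sigma$-finite measure and $g\ge 0$ jointly measurable, then almost surely, for all $\ell\le K$, the law of $J_\ell$ has exactly the normalized density proportional to the one displayed, with $G_A(da_{i,\ell}|s)$ replaced by $g(a_{i,\ell},s)$. -/

import Mathlib

open MeasureTheory ProbabilityTheory Set
open scoped ENNReal NNReal

namespace IBP

noncomputable section

/-- The `σ`-algebra on `E`-valued measures generated by the evaluations `v ↦ v B`: the usual
`σ`-algebra for which "a random measure" is a measurable map. -/
instance vectorMeasureMeasurableSpace {Ω E : Type*} [MeasurableSpace Ω]
    [NormedAddCommGroup E] [MeasurableSpace E] :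
    MeasurableSpace (VectorMeasure Ω E) :=
  ⨆ B : Set Ω, MeasurableSpace.comap (fun v : VectorMeasure Ω E => v B) inferInstance

/-- `N` is a Poisson random measure with mean intensity `ν` on the probability space `(Θ, P)`:
`N B` is Poisson distributed with mean `ν B` (almost surely infinite if `ν B = ∞`), and `N` takes
independent values on disjoint sets. -/
structure IsPRM {Θ S : Type*} [MeasurableSpace Θ] [MeasurableSpace S]
    (ν : Measure S) (N : Θ → Measure S) (P : Measure Θ) : Prop where
  measurable : Measurable N
  poisson : ∀ B : Set S, MeasurableSet B → ν B ≠ ∞ →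
    P.map (fun θ => N θ B) = (poissonMeasure (ν B).toNNReal).map (fun n : ℕ => (n : ℝ≥0∞))
  infinite : ∀ B : Set S, MeasurableSet B → ν B = ∞ → ∀ᵐ θ ∂P, N θ B = ∞
  indep : ∀ (n : ℕ) (B : Fin n → Set S), (∀ i, MeasurableSet (B i)) →
    Pairwise (Function.onFun Disjoint B) → iIndepFun (fun i θ => N θ (B i)) P

/-- The mean intensity `ν(ds, dω) = ρ(s|ω) ds B₀(dω)` on `(0,∞) × Ω`, viewed as a measure on
`ℝ × Ω`. -/
def intensity {Ω : Type*} [MeasurableSpace Ω] (ρ : ℝ → Ω → ℝ≥0∞) (B₀ : Measure Ω) :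
    Measure (ℝ × Ω) :=
  (((volume : Measure ℝ).restrict (Ioi 0)).prod B₀).withDensity (fun x => ρ x.1 x.2)

/-- `N = ∑ₖ δ_(τₖ, ωₖ)`. A sequence with only finitely many genuine points is padded with
entries with jump size `τₖ = 0`, which contribute nothing. -/
def pointMeasure {Ω : Type*} [MeasurableSpace Ω] (t : ℕ → ℝ) (w : ℕ → Ω) : Measure (ℝ × Ω) :=
  Measure.sum (fun k => (Measure.dirac (t k, w k)).restrict (Ioi 0 ×ˢ univ))

/-- `Z = ∑ₖ Aₖ δ_(ωₖ)`, the sum being over the genuine points (`τₖ > 0`). (The sum is meant when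
only finitely many of these have `Aₖ ≠ 0`; otherwise `∑ᶠ` has the value `0`.) -/
def latentSum {Ω E : Type*} [MeasurableSpace Ω] [NormedAddCommGroup E]
    (t : ℕ → ℝ) (w : ℕ → Ω) (a : ℕ → E) : VectorMeasure Ω E :=
  ∑ᶠ k : ℕ, if 0 < t k then VectorMeasure.dirac (w k) (a k) else 0

/-- The generative model on a probability space `(Θ, P)`: the points `(τₖ, ωₖ)` form a Poisson
random measure with mean intensity `ν` (so that `μ = ∑ₖ τₖ δ_(ωₖ)` is a completely random measure
`CRM(ν)`), and, conditionally on all the points, the variables `A i k` (`i` ranging over the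
customers, `k` over the points) are independent, `A i k` having the distribution `G(· | τₖ)`.
Then `Zᵢ = ∑ₖ A i k δ_(ωₖ)` are, given `μ`, iid `IBP(G | μ)`. -/
structure IsIBPModel {Θ Ω E ι : Type*} [MeasurableSpace Θ] [MeasurableSpace Ω]
    [MeasurableSpace E] [Fintype ι] (G : Kernel ℝ E) (ν : Measure (ℝ × Ω))
    (τ : ℕ → Θ → ℝ) (w : ℕ → Θ → Ω) (A : ι → ℕ → Θ → E) (P : Measure Θ) : Prop where
  measurable_jump : ∀ k, Measurable (τ k)
  measurable_loc : ∀ k, Measurable (w k)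
  measurable_mark : ∀ i k, Measurable (A i k)
  jump_nonneg : ∀ᵐ θ ∂P, ∀ k, 0 ≤ τ k θ
  prm : IsPRM ν (fun θ => pointMeasure (fun k => τ k θ) (fun k => w k θ)) P
  marks : ∀ (C : Set (ℕ → ℝ × Ω)) (n : ℕ) (B : ι → ℕ → Set E),
    MeasurableSet C → (∀ i k, MeasurableSet (B i k)) →
    P {θ | (fun k => (τ k θ, w k θ)) ∈ C ∧ ∀ i, ∀ k < n, A i k θ ∈ B i k} =
      ∫⁻ θ in {θ | (fun k => (τ k θ, w k θ)) ∈ C},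
        ∏ i, ∏ k ∈ Finset.range n, G (τ k θ) (B i k) ∂P

/-- The random measure `Zᵢ = ∑ₖ A i k δ_(ωₖ)` of customer `i`. -/
def customer {Θ Ω E ι : Type*} [MeasurableSpace Ω] [NormedAddCommGroup E]
    (τ : ℕ → Θ → ℝ) (w : ℕ → Θ → Ω) (A : ι → ℕ → Θ → E) (i : ι) (θ : Θ) : VectorMeasure Ω E :=
  latentSum (fun k => τ k θ) (fun k => w k θ) (fun k => A i k θ)

/-- `(Z₁, …, Z_M)`, the first `M` of the `M + 1` customers. -/
def firstCustomers {Θ Ω E : Type*} [MeasurableSpace Ω] [NormedAddCommGroup E] {M : ℕ}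
    (τ : ℕ → Θ → ℝ) (w : ℕ → Θ → Ω) (A : Fin (M + 1) → ℕ → Θ → E) (θ : Θ) :
    Fin M → VectorMeasure Ω E :=
  fun i => customer τ w A i.castSucc θ

/-- `m` is the law `IBP(A, ν)`, i.e. the marginal law of a single `Z = ∑ₖ Aₖ δ_(ωₖ)` in the
generative model with mean intensity `ν`. (The model is realised on the space of sequences of
points and marks, which loses no generality for laws.) -/
def IsIBPLaw {Ω E : Type*} [MeasurableSpace Ω] [NormedAddCommGroup E] [MeasurableSpace E]
    (G : Kernel ℝ E) (ν : Measure (ℝ × Ω)) (m : Measure (VectorMeasure Ω E)) : Prop :=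
  ∃ Q : Measure ((ℕ → ℝ × Ω) × (ℕ → E)), IsProbabilityMeasure Q ∧
    IsIBPModel (ι := Unit) G ν (fun k x => (x.1 k).1) (fun k x => (x.1 k).2)
      (fun _ k x => x.2 k) Q ∧
    m = Q.map (fun x => latentSum (fun k => (x.1 k).1) (fun k => (x.1 k).2) x.2)

/-- `π_A(s) = P(A ≠ 0 | s)`. -/
def piA {E : Type*} [Zero E] [MeasurableSpace E] (G : Kernel ℝ E) (s : ℝ) : ℝ≥0∞ :=
  G s {0}ᶜ

/-- `ρ_M(s|ω) = (1 - π_A(s))^M ρ(s|ω)`. -/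
def rhoM {Ω E : Type*} [Zero E] [MeasurableSpace E] (G : Kernel ℝ E) (ρ : ℝ → Ω → ℝ≥0∞)
    (M : ℕ) (s : ℝ) (ω : Ω) : ℝ≥0∞ :=
  (1 - piA G s) ^ M * ρ s ω

/-- `P(ds | ω, a)` is a version of the conditional law of the jump `J` of a feature, given its
location `ω` and the scores `a = (a₁, …, a_M) ≠ 0` it received from `M` customers: the law
proportional to `∏ᵢ G(daᵢ|s) ρ(s|ω) ds`. As `G(da|s)` need not have a density, the
proportionality is a disintegration (Bayes' rule): the measure
`1{a ≠ 0} ∏ᵢ G(daᵢ|s) ρ(s|ω) ds B₀(dω)` of `(ω, a, s)` equals its `(ω, a)`-marginal times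
`P(ds | ω, a)`. -/
def IsPosteriorJumpLaw {Ω E : Type*} [MeasurableSpace Ω] [Zero E] [MeasurableSpace E] {M : ℕ}
    (G : Kernel ℝ E) (ν : Measure (ℝ × Ω)) (P : Kernel (Ω × (Fin M → E)) ℝ) : Prop :=
  IsMarkovKernel P ∧
  ∀ (D : Set (Ω × (Fin M → E))) (T : Set ℝ), MeasurableSet D → MeasurableSet T →
    ∫⁻ x, T.indicator (fun _ => Measure.pi (fun _ : Fin M => G x.1)
        {a | a ≠ 0 ∧ (x.2, a) ∈ D}) x.1 ∂ν =
      ∫⁻ x, ∫⁻ a in {a | a ≠ 0 ∧ (x.2, a) ∈ D}, P (x.2, a) T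
        ∂(Measure.pi (fun _ : Fin M => G x.1)) ∂ν

/-- `h(s) = [G(da|s) / (1 - π_A(s))]^{1{a ≠ 0}}`, where `g(a, s)` is a density of `G(·|s)` on
`{a ≠ 0}`. -/
def hFun {E : Type*} [Zero E] [MeasurableSpace E] (G : Kernel ℝ E) (g : E → ℝ → ℝ≥0∞)
    (a : E) (s : ℝ) : ℝ≥0∞ :=
  open Classical in if a = 0 then 1 else g a s / (1 - piA G s)

/-- The unnormalised density `s ↦ (1 - π_A(s))^M ρ(s|ω) ∏ᵢ hᵢ(s)`. -/
def jumpDensity {Ω E : Type*} [Zero E] [MeasurableSpace E] {M : ℕ} (G : Kernel ℝ E)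
    (ρ : ℝ → Ω → ℝ≥0∞) (g : E → ℝ → ℝ≥0∞) (ω : Ω) (a : Fin M → E) (s : ℝ) : ℝ≥0∞ :=
  (1 - piA G s) ^ M * ρ s ω * ∏ i, hFun G g (a i) s

/-- The law on `(0,∞)` with density proportional to `jumpDensity`. -/
def jumpDensityLaw {Ω E : Type*} [Zero E] [MeasurableSpace E] {M : ℕ} (G : Kernel ℝ E)
    (ρ : ℝ → Ω → ℝ≥0∞) (g : E → ℝ → ℝ≥0∞) (ω : Ω) (a : Fin M → E) : Measure ℝ :=
  (∫⁻ s in Ioi (0 : ℝ), jumpDensity G ρ g ω a s)⁻¹ •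
    ((volume : Measure ℝ).restrict (Ioi 0)).withDensity (jumpDensity G ρ g ω a)

/-- The features already chosen: the locations of the atoms of `z₁, …, z_M`. -/
def featureSet {Ω E : Type*} [MeasurableSpace Ω] [NormedAddCommGroup E] {M : ℕ}
    (z : Fin M → VectorMeasure Ω E) : Set Ω :=
  {ω | ∃ i, z i {ω} ≠ 0}

/-- The scores `(z₁{ω}, …, z_M{ω})` of the feature `ω`. -/
def scores {Ω E : Type*} [MeasurableSpace Ω] [NormedAddCommGroup E] {M : ℕ}
    (z : Fin M → VectorMeasure Ω E) (ω : Ω) : Fin M → E :=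
  fun i => z i {ω}

/-- The law of `Z' + ∑_{ω ∈ S} A_ω δ_ω`, where `Z'` has law `m`, the pairs `(J_ω, A_ω)`, `ω ∈ S`,
are independent of each other and of `Z'`, `J_ω` has law `P(· | ω, scores of ω)`, and
`A_ω | J_ω = s` has law `G(· | s)`. -/
def predictiveLaw {Ω E : Type*} [MeasurableSpace Ω] [NormedAddCommGroup E] [MeasurableSpace E]
    {M : ℕ} (m : Measure (VectorMeasure Ω E)) (G : Kernel ℝ E)
    (P : Kernel (Ω × (Fin M → E)) ℝ) (z : Fin M → VectorMeasure Ω E) (S : Finset Ω) :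
    Measure (VectorMeasure Ω E) :=
  (m.prod (Measure.pi (fun ω : S => (P (ω.1, scores z ω.1)) ⊗ₘ G))).map
    (fun x => x.1 + ∑ ω : S, VectorMeasure.dirac ω.1 (x.2 ω).2)

end

end IBP

namespace IBP

open Filter Topology

noncomputable section

/-! ### Product kernels and the law of the marks at a point -/

section Kernels

variable {X I : Type*} [MeasurableSpace X] {F : I → Type*} [∀ i, MeasurableSpace (F i)]

/-! The proof computes with characteristic functionals. When the points of a Poisson random measure
of intensity `ν` carry independent marks drawn from `G`, the marked points have the Poisson
functional E ∏ₖ ψ(point k) = exp ∫ (ψ - 1), the integral being over `ν` times the law of the marks.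
It holds, as a limit over finite products, for measurable ψ bounded by 1 with ψ - 1 integrable
(`IsIBPModel.tendsto_integral_prod`). If T and U are additive functionals of (Z₁, …, Z_M) and of
Z_{M+1}, then exp i(T + U) is such a product, with factor t(ω, a₁, …, a_M) u(ω, a_{M+1}) at each
point.

The exponent is split according to whether a point is chosen by the first M customers
(`integral_sub_one_split`). Where it is not, t = 1 and the intensity is thinned by (1 - π)^M; this
part is exactly the functional of the fresh term with law IBP(A, ρ_M B₀). Where it is, location,
scores and jump are distributed by `featureMeasure`, which is finite because ∫ π dν < ∞.
Disintegrating it along P(ds | ω, a) replaces u by Φ(ω, a) = ∫∫ u(ω, b) G(db | s) P(ds | ω, a). Read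
backwards, the same functional turns this part into E[exp(iT) ∏ Φ(ω_ℓ, a_ℓ)], the product being over
the chosen features. Hence the joint functional is E[exp(iT) ∫ exp(iU) dκ] with κ the predictive law
(`IsIBPModel.integral_exp_pair`), and uniqueness of characteristic functionals
(`measure_ext_of_charFun`) identifies κ as the conditional law.

Three further points are needed. Points must have distinct locations, so that scores can be read off
from atoms; this comes from the absence of atoms in B₀ (`ae_injective_loc`). The predictive law must
be measurable in (Z₁, …, Z_M): these measures are encoded by the list of features sorted through a
Borel embedding into ℝ, an injective measurable encoding, hence an embedding by Lusin–Souslin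
(`exists_kernel_predictiveLaw`). Finally IBP(A, ρ_M B₀) must exist: thin the given points, give them
new marks, and recover the Poisson property from the functional (`HasPoissonFunctional.isPRM`). The
density formula is uniqueness of disintegrations (`ae_eq_normalized_withDensity`). -/

theorem measurable_infinitePi_kernel (κ : ∀ i, Kernel X (F i)) [∀ i, IsMarkovKernel (κ i)] :
    Measurable fun x => Measure.infinitePi fun i => κ i x := by
  refine Measurable.measure_of_isPiSystem_of_isProbabilityMeasure
    generateFrom_squareCylinders.symm
    (isPiSystem_squareCylinders (fun _ => MeasurableSpace.isPiSystem_measurableSet)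
      (fun _ => MeasurableSet.univ)) ?_
  rintro _ ⟨s, t, ht, rfl⟩
  have ht' : ∀ i, MeasurableSet (t i) := fun i => ht i (mem_univ i)
  simp_rw [Measure.infinitePi_pi _ (fun i _ => ht' i)]
  exact Finset.measurable_prod _ fun i _ => (κ i).measurable_coe (ht' i)

/-- The product of a family of Markov kernels. -/
def kernelInfinitePi (κ : ∀ i, Kernel X (F i)) [∀ i, IsMarkovKernel (κ i)] :
    Kernel X (∀ i, F i) where
  toFun x := Measure.infinitePi fun i => κ i x
  measurable' := measurable_infinitePi_kernel κ

instance (κ : ∀ i, Kernel X (F i)) [∀ i, IsMarkovKernel (κ i)] :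
    IsMarkovKernel (kernelInfinitePi κ) :=
  ⟨fun x => inferInstanceAs (IsProbabilityMeasure (Measure.infinitePi fun i => κ i x))⟩

/-- The product of a finite family of Markov kernels. -/
def kernelPi [Fintype I] (κ : ∀ i, Kernel X (F i)) [∀ i, IsMarkovKernel (κ i)] :
    Kernel X (∀ i, F i) where
  toFun x := Measure.pi fun i => κ i x
  measurable' := by
    simpa only [Measure.infinitePi_eq_pi] using measurable_infinitePi_kernel κ

theorem kernelPi_apply [Fintype I] (κ : ∀ i, Kernel X (F i)) [∀ i, IsMarkovKernel (κ i)] (x : X) :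
    kernelPi κ x = Measure.pi fun i => κ i x := rfl

instance [Fintype I] (κ : ∀ i, Kernel X (F i)) [∀ i, IsMarkovKernel (κ i)] :
    IsMarkovKernel (kernelPi κ) :=
  ⟨fun x => inferInstanceAs (IsProbabilityMeasure (Measure.pi fun i => κ i x))⟩

end Kernels

/-- The law of the marks of all customers at a point `(s, ω)`. -/
def markKernel (Ω ι : Type*) {E : Type*} [MeasurableSpace Ω] [MeasurableSpace E] [Fintype ι]
    (G : Kernel ℝ E) [IsMarkovKernel G] : Kernel (ℝ × Ω) (ι → E) :=
  kernelPi fun _ => G.comap Prod.fst measurable_fst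

section

variable {Ω E ι : Type*} [MeasurableSpace Ω] [MeasurableSpace E] [Fintype ι]
    (G : Kernel ℝ E) [IsMarkovKernel G]

theorem markKernel_apply (x : ℝ × Ω) :
    markKernel Ω ι G x = Measure.pi fun _ => G x.1 := rfl

instance : IsMarkovKernel (markKernel Ω ι G) := by unfold markKernel; infer_instance

end

/-! ### Integrals and counts for the point measure -/

section PointMeasure

variable {Ω : Type*} [MeasurableSpace Ω]

theorem lintegral_pointMeasure (t : ℕ → ℝ) (w : ℕ → Ω) {f : ℝ × Ω → ℝ≥0∞} (hf : Measurable f) :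
    ∫⁻ x, f x ∂(pointMeasure t w) = ∑' k, if 0 < t k then f (t k, w k) else 0 := by
  rw [pointMeasure, lintegral_sum_measure]
  refine tsum_congr fun k => ?_
  have hU : MeasurableSet (Ioi (0 : ℝ) ×ˢ (univ : Set Ω)) := measurableSet_Ioi.prod .univ
  rw [← lintegral_indicator hU, lintegral_dirac' _ (hf.indicator hU)]
  simp [indicator]

/-- Counting indices rather than atoms turns finiteness of `N B` into finiteness of a set of `k`,
which is what the sums and products over `k` need. -/
theorem pointMeasure_apply (t : ℕ → ℝ) (w : ℕ → Ω) {B : Set (ℝ × Ω)} (hB : MeasurableSet B) :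
    pointMeasure t w B = ENat.toENNReal {k | 0 < t k ∧ (t k, w k) ∈ B}.encard := by
  rw [← lintegral_indicator_one hB, lintegral_pointMeasure _ _ (measurable_one.indicator hB)]
  rw [← Measure.count_apply .of_discrete, ← lintegral_indicator_one .of_discrete, lintegral_count]
  refine tsum_congr fun k => ?_
  by_cases h1 : 0 < t k <;> by_cases h2 : (t k, w k) ∈ B <;> simp [h1, h2]

end PointMeasure

/-! ### A telescoping bound, and generating function and mean of the Poisson law -/

theorem norm_prod_sub_prod_le' (s : Finset ℕ) (a b : ℕ → ℂ) (ha : ∀ k, ‖a k‖ ≤ 1)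
    (hb : ∀ k, ‖b k‖ ≤ 1) : ‖∏ k ∈ s, a k - ∏ k ∈ s, b k‖ ≤ ∑ k ∈ s, ‖a k - b k‖ := by
  classical
  induction s using Finset.induction_on with
  | empty => simp
  | insert i s hi ih =>
    rw [Finset.prod_insert hi, Finset.prod_insert hi, Finset.sum_insert hi]
    have hp : ‖∏ k ∈ s, a k‖ ≤ 1 := by
      rw [norm_prod]; exact Finset.prod_le_one (fun _ _ => norm_nonneg _) (fun k _ => ha k)
    calc _ = ‖(a i - b i) * ∏ k ∈ s, a k + b i * (∏ k ∈ s, a k - ∏ k ∈ s, b k)‖ := by ring_nf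
      _ ≤ ‖a i - b i‖ * 1 + 1 * ∑ k ∈ s, ‖a k - b k‖ := by
        refine (norm_add_le _ _).trans ?_
        rw [norm_mul, norm_mul]
        gcongr
        exact hb i
      _ = _ := by ring

/-- The exponential series converges everywhere, so no bound on `z` is needed. It is used with `z`
in the unit disc for the functional, and with `z = 1/2` to treat sets of infinite mean. -/
theorem integral_pow_poissonMeasure (r : ℝ≥0) (z : ℂ) :
    ∫ n, z ^ n ∂(poissonMeasure r) = Complex.exp (r * (z - 1)) := by
  rw [integral_poissonMeasure r]
  calc ∑' n : ℕ, (Real.exp (-r) * r ^ n / (n.factorial : ℝ)) • z ^ n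
    _ = ∑' n : ℕ, (Real.exp (-r) : ℂ) * ((r * z) ^ n / n.factorial) := by
        congr with a
        rw [Complex.real_smul]
        push_cast
        rw [mul_pow]
        ring
    _ = (Real.exp (-r) : ℂ) * ∑' n : ℕ, ((r * z) ^ n / n.factorial) := tsum_mul_left
    _ = (Real.exp (-r) : ℂ) * Complex.exp (r * z) := by
        rw [(NormedSpace.expSeries_div_hasSum_exp (r * z)).tsum_eq, Complex.exp_eq_exp_ℂ]
    _ = Complex.exp (r * (z - 1)) := by
        rw [Complex.ofReal_exp, ← Complex.exp_add]
        push_cast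
        ring_nf

theorem lintegral_poissonMeasure_cast (r : ℝ≥0) :
    ∫⁻ n, (n : ℝ≥0∞) ∂(poissonMeasure r) = r := by
  have h : HasSum (fun n : ℕ => Real.exp (-r) * (r : ℝ) ^ n / n.factorial * n) r := by
    rw [← hasSum_nat_add_iff' 1]
    have := (hasSum_one_poissonMeasure r).mul_left (r : ℝ)
    simp only [Finset.range_one, Finset.sum_singleton, Nat.cast_zero, mul_zero, sub_zero]
    rw [mul_one] at this
    convert! this using 2 with n
    push_cast [Nat.factorial_succ, pow_succ]
    field_simp
  rw [poissonMeasure, lintegral_sum_measure]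
  simp only [lintegral_smul_measure, lintegral_dirac, smul_eq_mul]
  have h2 := ENNReal.ofReal_tsum_of_nonneg (fun n => by positivity) h.summable
  rw [h.tsum_eq] at h2
  rw [← ENNReal.ofReal_coe_nnreal, h2]
  refine tsum_congr fun n => ?_
  rw [ENNReal.ofReal_mul (by positivity), ENNReal.ofReal_natCast]

/-! ### Campbell's formula for the mean -/

section Campbell

variable {Θ S : Type*} [MeasurableSpace Θ] [MeasurableSpace S] {P : Measure Θ}
  {ν : Measure S} {N : Θ → Measure S}

theorem IsPRM.lintegral_apply [IsProbabilityMeasure P] (h : IsPRM ν N P) {B : Set S}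
    (hB : MeasurableSet B) : ∫⁻ θ, N θ B ∂P = ν B := by
  by_cases hν : ν B = ∞
  · rw [hν, lintegral_congr_ae (h.infinite B hB hν)]
    simp
  · have hm : Measurable fun θ => N θ B := (Measure.measurable_coe hB).comp h.measurable
    have h1 : ∫⁻ θ, N θ B ∂P = ∫⁻ y, y ∂(P.map fun θ => N θ B) :=
      (lintegral_map (f := fun y : ℝ≥0∞ => y) measurable_id hm).symm
    rw [h1, h.poisson B hB hν, lintegral_map (f := fun y : ℝ≥0∞ => y) measurable_id .of_discrete,
      lintegral_poissonMeasure_cast]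
    exact ENNReal.coe_toNNReal hν

/-- Campbell's formula for the mean. -/
theorem IsPRM.lintegral_lintegral [IsProbabilityMeasure P] (h : IsPRM ν N P) {f : S → ℝ≥0∞}
    (hf : Measurable f) : ∫⁻ θ, ∫⁻ x, f x ∂(N θ) ∂P = ∫⁻ x, f x ∂ν := by
  have : P.bind N = ν := by
    ext B hB
    rw [Measure.bind_apply hB h.measurable.aemeasurable, h.lintegral_apply hB]
  rw [← Measure.lintegral_bind h.measurable.aemeasurable hf.aemeasurable, this]

end Campbell

/-- `f` on `(0, ∞) × Ω`, extended by the constant `c`. -/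
def onPos {Ω Y : Type*} (c : Y) (f : ℝ × Ω → Y) (x : ℝ × Ω) : Y :=
  if 0 < x.1 then f x else c

theorem measurable_onPos {Ω Y : Type*} [MeasurableSpace Ω] [MeasurableSpace Y] (c : Y) {f : ℝ × Ω → Y}
    (hf : Measurable f) : Measurable (onPos c f) :=
  Measurable.ite (measurableSet_lt measurable_const measurable_fst) hf measurable_const

theorem norm_onPos_le {Ω : Type*} {f : ℝ × Ω → ℂ} (hf : ∀ x, ‖f x‖ ≤ 1) (x : ℝ × Ω) :
    ‖onPos 1 f x‖ ≤ 1 := by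
  unfold onPos
  split_ifs
  · exact hf x
  · simp

theorem norm_prod_onPos_le {Θ Ω : Type*} {t : ℕ → Θ → ℝ} {w : ℕ → Θ → Ω} {ψ : ℝ × Ω → ℂ}
    (hψ : ∀ x, ‖ψ x‖ ≤ 1) (n : ℕ) (θ : Θ) :
    ‖∏ k ∈ Finset.range n, onPos 1 ψ (t k θ, w k θ)‖ ≤ 1 := by
  rw [norm_prod]
  exact Finset.prod_le_one (fun _ _ => norm_nonneg _) (fun k _ => norm_onPos_le hψ _)

/-! ### The characteristic functional of the unmarked points -/

section Points

variable {Θ Ω : Type*} [MeasurableSpace Θ] [MeasurableSpace Ω] {P : Measure Θ}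
  [IsProbabilityMeasure P] {ν : Measure (ℝ × Ω)} {t : ℕ → Θ → ℝ} {w : ℕ → Θ → Ω}

theorem lintegral_tsum_points (hN : IsPRM ν
      (fun θ => pointMeasure (fun k => t k θ) (fun k => w k θ)) P) {f : ℝ × Ω → ℝ≥0∞}
    (hf : Measurable f) :
    ∫⁻ θ, ∑' k, onPos 0 f (t k θ, w k θ) ∂P = ∫⁻ x, f x ∂ν := by
  rw [← hN.lintegral_lintegral hf]
  simp_rw [lintegral_pointMeasure _ _ hf]
  rfl

/-- The expected number of points in `B` is `ν B`, and a count with finite mean is almost surely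
finite. -/
theorem ae_finite_points (hN : IsPRM ν
      (fun θ => pointMeasure (fun k => t k θ) (fun k => w k θ)) P) {B : Set (ℝ × Ω)}
    (hB : MeasurableSet B) (hν : ν B ≠ ∞) :
    ∀ᵐ θ ∂P, {k | 0 < t k θ ∧ (t k θ, w k θ) ∈ B}.Finite := by
  have h1 := hN.lintegral_apply hB
  have h2 := ae_lt_top ((Measure.measurable_coe hB).comp hN.measurable)
    (μ := P) (by simpa [h1] using hν)
  filter_upwards [h2] with θ hθ
  simp only [Function.comp] at hθ
  rw [pointMeasure_apply _ _ hB] at hθ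
  rw [← Set.encard_lt_top_iff]
  simpa using hθ

/-- Grouping the factors by their value `z` turns the product into powers `z ^ N(g = z)`. The value
1 is dropped because its fibre may contain infinitely many points. The floor of `toReal` only reads
the count as a natural number. -/
theorem prod_simpleFunc_points (tt : ℕ → ℝ) (ww : ℕ → Ω) (g : SimpleFunc (ℝ × Ω) ℂ)
    (hfin : {k | 0 < tt k ∧ g (tt k, ww k) ≠ 1}.Finite) :
    ∀ᶠ n in atTop, ∏ k ∈ Finset.range n, onPos 1 g (tt k, ww k) =
      ∏ z ∈ g.range.erase 1, z ^ ⌊(pointMeasure tt ww (g ⁻¹' {z})).toReal⌋₊ := by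
  classical
  have hsub : ∀ᶠ n in atTop, hfin.toFinset ⊆ Finset.range n :=
    (Filter.tendsto_finset_range).eventually_ge_atTop _
  filter_upwards [hsub] with n hn
  rw [← Finset.prod_subset hn]
  · rw [← Finset.prod_fiberwise_of_maps_to (t := g.range.erase 1) (g := fun k => g (tt k, ww k))]
    · refine Finset.prod_congr rfl fun z hz => ?_
      rw [pointMeasure_apply _ _ (g.measurableSet_fiber z)]
      have hz1 : z ≠ 1 := Finset.ne_of_mem_erase hz
      have hset : {k | 0 < tt k ∧ (tt k, ww k) ∈ g ⁻¹' {z}} =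
          ((hfin.toFinset.filter fun k => g (tt k, ww k) = z : Finset ℕ) : Set ℕ) := by
        ext k
        simp only [mem_ofPred_eq, mem_preimage, mem_singleton_iff, Finset.coe_filter,
          Finite.mem_toFinset]
        constructor
        · rintro ⟨h1, h2⟩; exact ⟨⟨h1, h2 ▸ hz1⟩, h2⟩
        · rintro ⟨⟨h1, _⟩, h2⟩; exact ⟨h1, h2⟩
      rw [hset, Set.encard_coe_eq_coe_finsetCard]
      simp only [ENat.toENNReal_coe, ENNReal.toReal_natCast, Nat.floor_natCast]
      rw [Finset.prod_congr rfl (g := fun _ => z), Finset.prod_const]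
      intro k hk
      simp only [Finset.mem_filter, Finite.mem_toFinset, mem_ofPred_eq] at hk
      simp [onPos, hk.1.1, hk.2]
    · intro k hk
      simp only [Finite.mem_toFinset, mem_ofPred_eq] at hk
      exact Finset.mem_erase.2 ⟨hk.2, SimpleFunc.mem_range_self _ _⟩
  · intro k _ hk
    simp only [Finite.mem_toFinset, mem_ofPred_eq, not_and, not_not] at hk
    simp only [onPos]
    split_ifs with h
    · exact hk h
    · rfl

theorem measurable_prod_onPos (ht : ∀ k, Measurable (t k)) (hw : ∀ k, Measurable (w k))
    {ψ : ℝ × Ω → ℂ} (hψ : Measurable ψ) (n : ℕ) :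
    Measurable fun θ => ∏ k ∈ Finset.range n, onPos 1 ψ (t k θ, w k θ) :=
  Finset.measurable_prod _ fun k _ =>
    (measurable_onPos 1 hψ).comp ((ht k).prodMk (hw k))

/-- The fibres of `g` are disjoint, so their counts are independent Poisson variables and the mean
of the product is a product of Poisson generating functions. -/
theorem tendsto_integral_prod_simpleFunc (ht : ∀ k, Measurable (t k))
    (hw : ∀ k, Measurable (w k)) (hN : IsPRM ν
      (fun θ => pointMeasure (fun k => t k θ) (fun k => w k θ)) P) (g : SimpleFunc (ℝ × Ω) ℂ)
    (hg : ∀ x, ‖g x‖ ≤ 1) (hfin : ν {x | g x ≠ 1} ≠ ∞) :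
    Tendsto (fun n => ∫ θ, ∏ k ∈ Finset.range n, onPos 1 g (t k θ, w k θ) ∂P) atTop
      (𝓝 (Complex.exp (∫ x, (g x - 1) ∂ν))) := by
  classical
  have hB : MeasurableSet {x | g x ≠ 1} := (g.measurableSet_fiber 1).compl
  set N := fun θ => pointMeasure (fun k => t k θ) (fun k => w k θ) with hNdef
  have hlim : Tendsto (fun n => ∫ θ, ∏ k ∈ Finset.range n, onPos 1 g (t k θ, w k θ) ∂P) atTop
      (𝓝 (∫ θ, ∏ z ∈ g.range.erase 1, z ^ ⌊(N θ (g ⁻¹' {z})).toReal⌋₊ ∂P)) := by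
    refine tendsto_integral_of_dominated_convergence (fun _ => 1)
      (fun n => (measurable_prod_onPos ht hw g.measurable n).aestronglyMeasurable)
      (integrable_const _) (fun n => ae_of_all _ fun θ => norm_prod_onPos_le hg n θ) ?_
    filter_upwards [ae_finite_points hN hB hfin] with θ hθ
    exact tendsto_nhds_of_eventually_eq (prod_simpleFunc_points _ _ g hθ)
  have hfz : ∀ z ∈ g.range.erase 1, ν (g ⁻¹' {z}) ≠ ∞ := fun z hz =>
    ne_top_of_le_ne_top hfin (measure_mono fun x hx => by
      have : g x = z := hx
      have hz1 : z ≠ 1 := Finset.ne_of_mem_erase hz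
      simpa [this] using hz1)
  have hval : ∫ θ, ∏ z ∈ g.range.erase 1, z ^ ⌊(N θ (g ⁻¹' {z})).toReal⌋₊ ∂P =
      ∏ z ∈ g.range.erase 1, Complex.exp ((ν (g ⁻¹' {z})).toReal * (z - 1)) := by
    let e := (g.range.erase 1).equivFin.symm
    have hind := hN.indep _ (fun i => g ⁻¹' {(e i : ℂ)}) (fun i => g.measurableSet_fiber _)
      (by
        intro i j hij
        refine Disjoint.preimage _ (disjoint_singleton.2 fun h => hij ?_)
        exact e.injective (Subtype.ext h))
    have h1 := hind.integral_fun_prod_comp (𝕜 := ℂ)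
      (f := fun i (y : ℝ≥0∞) => (e i : ℂ) ^ ⌊y.toReal⌋₊)
      (fun i => ((Measure.measurable_coe (g.measurableSet_fiber _)).comp
        hN.measurable).aemeasurable)
      (fun i => by
        have : Measurable fun y : ℝ≥0∞ => (e i : ℂ) ^ ⌊y.toReal⌋₊ := by fun_prop
        exact this.aestronglyMeasurable)
    have h2 : ∀ F : ℂ → ℂ, ∏ z ∈ g.range.erase 1, F z = ∏ i, F (e i) := fun F => by
      rw [← Finset.prod_coe_sort, ← e.prod_comp]
    simp_rw [h2]
    rw [h1]
    refine Finset.prod_congr rfl fun i _ => ?_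
    have hm : Measurable fun θ => N θ (g ⁻¹' {(e i : ℂ)}) :=
      (Measure.measurable_coe (g.measurableSet_fiber _)).comp hN.measurable
    have hf : Measurable fun y : ℝ≥0∞ => (e i : ℂ) ^ ⌊y.toReal⌋₊ := by fun_prop
    have h3 : ∫ θ, (e i : ℂ) ^ ⌊(N θ (g ⁻¹' {(e i : ℂ)})).toReal⌋₊ ∂P =
        ∫ y, (e i : ℂ) ^ ⌊y.toReal⌋₊ ∂(P.map fun θ => N θ (g ⁻¹' {(e i : ℂ)})) :=
      (integral_map hm.aemeasurable hf.aestronglyMeasurable).symm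
    rw [h3, hN.poisson _ (g.measurableSet_fiber _) (hfz _ (e i).2),
      integral_map .of_discrete hf.aestronglyMeasurable]
    simp only [ENNReal.toReal_natCast, Nat.floor_natCast, integral_pow_poissonMeasure]
    rfl
  have hint : ∫ x, (g x - 1) ∂ν =
      ∑ z ∈ g.range.erase 1, ((ν (g ⁻¹' {z})).toReal * (z - 1) : ℂ) := by
    have : ∀ x, g x - 1 = ∑ z ∈ g.range.erase 1,
        (g ⁻¹' {z}).indicator (fun _ => z - 1) x := by
      intro x
      by_cases hx : g x = 1
      · rw [hx, sub_self, Finset.sum_eq_zero]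
        intro z hz
        have hz1 : z ≠ 1 := Finset.ne_of_mem_erase hz
        simp [indicator, hx, hz1.symm]
      · rw [Finset.sum_eq_single (g x)]
        · simp
        · intro z _ hz
          simp [indicator, hz.symm]
        · intro h
          exact absurd (Finset.mem_erase.2 ⟨hx, SimpleFunc.mem_range_self _ _⟩) h
    simp_rw [this]
    rw [integral_finsetSum]
    · refine Finset.sum_congr rfl fun z hz => ?_
      rw [integral_indicator_const _ (g.measurableSet_fiber _)]
      simp [Measure.real]
    · intro z hz
      exact (integrable_indicator_iff (g.measurableSet_fiber _)).2
        (integrableOn_const (hfz z hz))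
  rw [hint, Complex.exp_sum, ← hval]
  exact hlim

/-- The characteristic functional of the points of a Poisson random measure. -/
theorem tendsto_integral_prod_points (ht : ∀ k, Measurable (t k))
    (hw : ∀ k, Measurable (w k)) (hN : IsPRM ν
      (fun θ => pointMeasure (fun k => t k θ) (fun k => w k θ)) P) {ψ : ℝ × Ω → ℂ}
    (hψm : Measurable ψ) (hψ : ∀ x, ‖ψ x‖ ≤ 1) (hint : Integrable (fun x => ψ x - 1) ν) :
    Tendsto (fun n => ∫ θ, ∏ k ∈ Finset.range n, onPos 1 ψ (t k θ, w k θ) ∂P) atTop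
      (𝓝 (Complex.exp (∫ x, (ψ x - 1) ∂ν))) := by
  have h1mem : (1 : ℂ) ∈ Metric.closedBall (0 : ℂ) 1 := by simp
  -- Approximation inside the unit ball keeps all products bounded by 1. The base point 1 gives `‖g
  -- j - 1‖ ≤ 2 ‖ψ - 1‖`, so each `g j - 1` is integrable and the simple case applies.
  let g : ℕ → SimpleFunc (ℝ × Ω) ℂ :=
    SimpleFunc.approxOn ψ hψm (Metric.closedBall (0 : ℂ) 1) 1 h1mem
  have hg : ∀ j x, ‖g j x‖ ≤ 1 := fun j x => by
    simpa using SimpleFunc.approxOn_mem hψm h1mem j x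
  have hL1 : Tendsto (fun j => ∫⁻ x, ‖g j x - ψ x‖ₑ ∂ν) atTop (𝓝 0) :=
    SimpleFunc.tendsto_approxOn_L1_enorm hψm h1mem
      (ae_of_all _ fun x => subset_closure (by simpa using hψ x)) hint.2
  have hgint : ∀ j, Integrable (fun x => g j x - 1) ν := fun j => by
    refine Integrable.mono' (hint.norm.add hint.norm)
      ((g j).measurable.sub measurable_const).aestronglyMeasurable (ae_of_all _ fun x => ?_)
    exact SimpleFunc.norm_approxOn_y₀_le hψm h1mem x j
  have hgfin : ∀ j, ν {x | g j x ≠ 1} ≠ ∞ := fun j => by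
    have h1 : Integrable ((g j).map fun z => z - 1) ν := hgint j
    have h2 := SimpleFunc.measure_support_lt_top_of_integrable _ h1
    refine ne_top_of_le_ne_top h2.ne (measure_mono fun x hx => ?_)
    simpa [Function.mem_support, sub_eq_zero] using hx
  have hsimple := fun j => tendsto_integral_prod_simpleFunc ht hw hN (g j) (hg j) (hgfin j)
  -- Telescoping and Campbell's formula bound the error by the L¹ distance, uniformly in `n`. This
  -- uniformity permits the exchange of the limits in `j` and `n`.
  have hdiff : ∀ j n, ‖∫ θ, ∏ k ∈ Finset.range n, onPos 1 (g j) (t k θ, w k θ) ∂P -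
      ∫ θ, ∏ k ∈ Finset.range n, onPos 1 ψ (t k θ, w k θ) ∂P‖ₑ ≤
        ∫⁻ x, ‖g j x - ψ x‖ₑ ∂ν := by
    intro j n
    rw [← integral_sub]
    rotate_left
    · exact Integrable.of_bound
        (measurable_prod_onPos ht hw (g j).measurable n).aestronglyMeasurable 1
        (ae_of_all _ fun θ => norm_prod_onPos_le (hg j) n θ)
    · exact Integrable.of_bound
        (measurable_prod_onPos ht hw hψm n).aestronglyMeasurable 1
        (ae_of_all _ fun θ => norm_prod_onPos_le hψ n θ)
    refine (enorm_integral_le_lintegral_enorm _).trans ?_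
    have hm : Measurable fun x => ‖g j x - ψ x‖ₑ := ((g j).measurable.sub hψm).enorm
    rw [← lintegral_tsum_points hN hm]
    refine lintegral_mono fun θ => ?_
    have h1 := norm_prod_sub_prod_le' (Finset.range n) (fun k => onPos 1 (g j) (t k θ, w k θ))
      (fun k => onPos 1 ψ (t k θ, w k θ)) (fun k => norm_onPos_le (hg j) _)
      (fun k => norm_onPos_le hψ _)
    rw [← ofReal_norm]
    refine (ENNReal.ofReal_le_ofReal h1).trans ?_
    rw [ENNReal.ofReal_sum_of_nonneg fun _ _ => norm_nonneg _]
    refine le_trans (Finset.sum_le_sum fun k _ => ?_) (ENNReal.sum_le_tsum (Finset.range n))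
    simp only [onPos]
    split_ifs
    · rw [ofReal_norm]
    · simp
  have hlim : Tendsto (fun j => Complex.exp (∫ x, (g j x - 1) ∂ν)) atTop
      (𝓝 (Complex.exp (∫ x, (ψ x - 1) ∂ν))) := by
    refine (Complex.continuous_exp.tendsto _).comp ?_
    refine tendsto_integral_of_L1 _ hint.1 (Eventually.of_forall hgint) ?_
    simpa using hL1
  refine TendstoUniformly.tendsto_of_eventually_tendsto ?_ (Eventually.of_forall hsimple) hlim
  rw [Metric.tendstoUniformly_iff]
  intro ε hε
  have hε' : (0 : ℝ≥0∞) < ENNReal.ofReal ε := by simpa using hε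
  filter_upwards [hL1.eventually_lt_const hε'] with j hj n
  rw [dist_comm, dist_eq_norm, ← ENNReal.ofReal_lt_ofReal_iff hε, ofReal_norm]
  exact (hdiff j n).trans_lt hj
end Points

/-- Boxes whose sides are themselves boxes form a generating π-system. The field `marks` of the
model gives probabilities only for sets of this form. -/
theorem measure_ext_nested_pi {Y E ι κ : Type*} [MeasurableSpace Y] [MeasurableSpace E]
    [Fintype ι] [Fintype κ] {μ₁ μ₂ : Measure (Y × (κ → ι → E))} [IsFiniteMeasure μ₁]
    (h : ∀ (C : Set Y) (B : κ → ι → Set E), MeasurableSet C → (∀ k i, MeasurableSet (B k i)) →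
      μ₁ (C ×ˢ univ.pi fun k => univ.pi (B k)) = μ₂ (C ×ˢ univ.pi fun k => univ.pi (B k))) :
    μ₁ = μ₂ := by
  let D₀ : Set (Set (ι → E)) := Set.pi univ '' Set.pi univ fun _ => {s : Set E | MeasurableSet s}
  let D : Set (Set (κ → ι → E)) := Set.pi univ '' Set.pi univ fun _ => D₀
  have hspan₀ : IsCountablySpanning D₀ :=
    IsCountablySpanning.pi fun _ => isCountablySpanning_measurableSet
  have hgen : MeasurableSpace.generateFrom D = MeasurableSpace.pi :=
    generateFrom_eq_pi (fun _ => generateFrom_pi) fun _ => hspan₀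
  have hspan : IsCountablySpanning D := IsCountablySpanning.pi fun _ => hspan₀
  have hpi : IsPiSystem D := IsPiSystem.pi fun _ => isPiSystem_pi
  have h0 : μ₁ univ = μ₂ univ := by
    have hu : (univ : Set (Y × (κ → ι → E))) =
        univ ×ˢ univ.pi fun _ => univ.pi fun _ => univ := by ext; simp
    rw [hu]
    exact h univ (fun _ _ => univ) .univ fun _ _ => .univ
  refine ext_of_generate_finite (image2 (· ×ˢ ·) {s : Set Y | MeasurableSet s} D) ?_
    (IsPiSystem.prod MeasurableSpace.isPiSystem_measurableSet hpi) ?_ h0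
  · rw [generateFrom_eq_prod (MeasurableSpace.generateFrom_measurableSet) hgen
      isCountablySpanning_measurableSet hspan]
  · rintro _ ⟨C, hC, T, ⟨T', hT', rfl⟩, rfl⟩
    have hT'' : ∀ k, ∃ B : ι → Set E, (∀ i, MeasurableSet (B i)) ∧ univ.pi B = T' k := fun k => by
      obtain ⟨B, hB, hBT⟩ := hT' k (mem_univ k)
      exact ⟨B, fun i => hB i (mem_univ i), hBT⟩
    choose B hB hBT using hT''
    obtain rfl : T' = fun k => univ.pi (B k) := funext fun k => (hBT k).symm
    exact h C B hC hB

/-! ### Adding the marks: joint law, functional and Campbell formula -/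

section Marks

variable {Θ Ω E ι : Type*} [MeasurableSpace Θ] [MeasurableSpace Ω]
    [MeasurableSpace E] [Fintype ι] {G : Kernel ℝ E} {ν : Measure (ℝ × Ω)}
    {τ : ℕ → Θ → ℝ} {w : ℕ → Θ → Ω} {A : ι → ℕ → Θ → E} {P : Measure Θ}

theorem IsIBPModel.measurable_points (h : IsIBPModel G ν τ w A P) :
    Measurable fun θ => (fun k => (τ k θ, w k θ) : ℕ → ℝ × Ω) :=
  measurable_pi_lambda _ fun k => (h.measurable_jump k).prodMk (h.measurable_loc k)

theorem IsIBPModel.measurable_marks (h : IsIBPModel G ν τ w A P) (k : ℕ) :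
    Measurable fun θ => (fun i => A i k θ : ι → E) :=
  measurable_pi_lambda _ fun i => h.measurable_mark i k

variable [IsMarkovKernel G] [IsProbabilityMeasure P]

/-- The law of the marks of the first `n` points. -/
def marksKernel (Ω ι : Type*) [MeasurableSpace Ω] [Fintype ι] (G : Kernel ℝ E) [IsMarkovKernel G]
    (n : ℕ) : Kernel (ℕ → ℝ × Ω) (Fin n → ι → E) :=
  kernelPi fun k : Fin n =>
    (markKernel Ω ι G).comap (fun x : ℕ → ℝ × Ω => x k) (measurable_pi_apply _)

instance (n : ℕ) : IsMarkovKernel (marksKernel Ω ι G n) := by unfold marksKernel; infer_instance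

theorem marksKernel_apply (n : ℕ) (x : ℕ → ℝ × Ω) :
    marksKernel Ω ι G n x = Measure.pi fun k : Fin n => markKernel Ω ι G (x k) := rfl

/-- This upgrades `marks` from boxes to the full joint law of all points and the marks of the first
`n`, so that arbitrary functions of them can be integrated by conditioning on the points. -/
theorem IsIBPModel.map_points_marks (h : IsIBPModel G ν τ w A P) (n : ℕ) :
    P.map (fun θ => ((fun k => (τ k θ, w k θ) : ℕ → ℝ × Ω), fun (k : Fin n) i => A i k θ)) =
      (P.map fun θ => (fun k => (τ k θ, w k θ) : ℕ → ℝ × Ω)) ⊗ₘ marksKernel Ω ι G n := by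
  have hX := h.measurable_points
  have hA : Measurable fun θ => (fun (k : Fin n) i => A i k θ : Fin n → ι → E) :=
    measurable_pi_lambda _ fun k => h.measurable_marks k
  have : IsProbabilityMeasure (P.map
      (fun θ => ((fun k => (τ k θ, w k θ) : ℕ → ℝ × Ω), fun (k : Fin n) i => A i k θ))) :=
    Measure.isProbabilityMeasure_map (hX.prodMk hA).aemeasurable
  refine measure_ext_nested_pi fun C B hC hB => ?_
  have hR : MeasurableSet (univ.pi fun k => univ.pi (B k)) :=
    MeasurableSet.univ_pi fun k => MeasurableSet.univ_pi (hB k)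
  have : IsProbabilityMeasure (P.map fun θ => (fun k => (τ k θ, w k θ) : ℕ → ℝ × Ω)) :=
    Measure.isProbabilityMeasure_map hX.aemeasurable
  rw [Measure.map_apply (hX.prodMk hA) (hC.prod hR), Measure.compProd_apply_prod hC hR,
    setLIntegral_map hC ((marksKernel Ω ι G n).measurable_coe hR) hX]
  -- `marks` expects sets indexed by all of `ℕ`; indices from `n` on are filled with `univ` and play
  -- no role.
  have hm := h.marks C n (fun i k => if hk : k < n then B ⟨k, hk⟩ i else univ) hC
    (fun i k => by
      split_ifs with hk
      · exact hB _ _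
      · exact .univ)
  convert! hm using 1
  · congr 1
    ext θ
    simp only [mem_preimage, mem_prod, mem_univ_pi, mem_ofPred_eq]
    refine and_congr_right fun _ => ⟨fun hh i k hk => by simpa [hk] using hh ⟨k, hk⟩ i,
      fun hh k i => by simpa [k.2] using hh i k k.2⟩
  · refine lintegral_congr fun θ => ?_
    rw [marksKernel_apply, Measure.pi_pi, Finset.prod_comm, Finset.prod_range]
    refine Finset.prod_congr rfl fun k _ => ?_
    rw [markKernel_apply, Measure.pi_pi]
    simp

theorem IsIBPModel.lintegral_mark (h : IsIBPModel G ν τ w A P)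
    {f : (ℝ × Ω) × (ι → E) → ℝ≥0∞} (hf : Measurable f) (k : ℕ) :
    ∫⁻ θ, f ((τ k θ, w k θ), fun i => A i k θ) ∂P =
      ∫⁻ θ, ∫⁻ a, f ((τ k θ, w k θ), a) ∂(markKernel Ω ι G (τ k θ, w k θ)) ∂P := by
  have hX := h.measurable_points
  have hA : Measurable fun θ => (fun (k : Fin (k + 1)) i => A i k θ : Fin (k + 1) → ι → E) :=
    measurable_pi_lambda _ fun k => h.measurable_marks k
  let F : (ℕ → ℝ × Ω) × (Fin (k + 1) → ι → E) → ℝ≥0∞ := fun y => f (y.1 k, y.2 (Fin.last k))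
  have hF : Measurable F := by fun_prop
  have h1 : ∫⁻ θ, f ((τ k θ, w k θ), fun i => A i k θ) ∂P =
      ∫⁻ y, F y ∂(P.map (fun θ => ((fun k => (τ k θ, w k θ) : ℕ → ℝ × Ω),
        fun (k : Fin (k + 1)) i => A i k θ))) := (lintegral_map hF (hX.prodMk hA)).symm
  have : IsProbabilityMeasure (P.map fun θ => (fun k => (τ k θ, w k θ) : ℕ → ℝ × Ω)) :=
    Measure.isProbabilityMeasure_map hX.aemeasurable
  rw [h1, h.map_points_marks, Measure.lintegral_compProd hF, lintegral_map hF.lintegral_kernel_prod_right hX]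
  refine lintegral_congr fun θ => ?_
  simp only [F]
  rw [marksKernel_apply]
  exact (measurePreserving_eval (fun j : Fin (k + 1) => markKernel Ω ι G (τ j θ, w j θ))
    (Fin.last k)).lintegral_comp (f := fun a => f ((τ k θ, w k θ), a)) (by fun_prop)

theorem IsIBPModel.integral_prod_marks (h : IsIBPModel G ν τ w A P)
    {ψ : (ℝ × Ω) × (ι → E) → ℂ} (hψm : Measurable ψ) (hψ : ∀ y, ‖ψ y‖ ≤ 1) (n : ℕ) :
    ∫ θ, ∏ k ∈ Finset.range n, ψ ((τ k θ, w k θ), fun i => A i k θ) ∂P =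
      ∫ θ, ∏ k ∈ Finset.range n,
        ∫ a, ψ ((τ k θ, w k θ), a) ∂(markKernel Ω ι G (τ k θ, w k θ)) ∂P := by
  have hX := h.measurable_points
  have hA : Measurable fun θ => (fun (k : Fin n) i => A i k θ : Fin n → ι → E) :=
    measurable_pi_lambda _ fun k => h.measurable_marks k
  let F : (ℕ → ℝ × Ω) × (Fin n → ι → E) → ℂ := fun y => ∏ k : Fin n, ψ (y.1 k, y.2 k)
  have hF : Measurable F := by fun_prop
  have hF1 : ∀ y, ‖F y‖ ≤ 1 := fun y => by
    simp only [F]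
    rw [norm_prod]
    exact Finset.prod_le_one (fun _ _ => norm_nonneg _) (fun k _ => hψ _)
  have h1 : ∫ θ, ∏ k ∈ Finset.range n, ψ ((τ k θ, w k θ), fun i => A i k θ) ∂P =
      ∫ y, F y ∂(P.map (fun θ => ((fun k => (τ k θ, w k θ) : ℕ → ℝ × Ω),
        fun (k : Fin n) i => A i k θ))) := by
    rw [integral_map (hX.prodMk hA).aemeasurable hF.aestronglyMeasurable]
    simp only [F, Finset.prod_range]
  have : IsProbabilityMeasure (P.map fun θ => (fun k => (τ k θ, w k θ) : ℕ → ℝ × Ω)) :=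
    Measure.isProbabilityMeasure_map hX.aemeasurable
  rw [h1, h.map_points_marks, Measure.integral_compProd
    (Integrable.of_bound hF.aestronglyMeasurable 1 (ae_of_all _ hF1)),
    integral_map hX.aemeasurable
      (hF.stronglyMeasurable.integral_kernel_prod_right).aestronglyMeasurable]
  refine integral_congr_ae (ae_of_all _ fun θ => ?_)
  simp only [F]
  rw [marksKernel_apply, integral_fintype_prod_eq_prod
    (fun (k : Fin n) a => ψ ((τ k θ, w k θ), a)), Finset.prod_range]

/-- The characteristic functional of the marked points. -/
theorem IsIBPModel.tendsto_integral_prod (h : IsIBPModel G ν τ w A P) [SFinite ν]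
    {ψ : (ℝ × Ω) × (ι → E) → ℂ} (hψm : Measurable ψ) (hψ : ∀ y, ‖ψ y‖ ≤ 1)
    (hint : Integrable (fun y => ψ y - 1) (ν ⊗ₘ markKernel Ω ι G)) :
    Tendsto (fun n => ∫ θ, ∏ k ∈ Finset.range n,
      (if 0 < τ k θ then ψ ((τ k θ, w k θ), fun i => A i k θ) else 1) ∂P) atTop
      (𝓝 (Complex.exp (∫ y, (ψ y - 1) ∂(ν ⊗ₘ markKernel Ω ι G)))) := by
  -- Given the points, the marks integrate out factor by factor. It remains to apply the unmarked
  -- functional to the averaged factor `φ`.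
  let φ : ℝ × Ω → ℂ := fun x => ∫ a, ψ (x, a) ∂(markKernel Ω ι G x)
  have hφm : Measurable φ := (StronglyMeasurable.integral_kernel_prod_right (κ := markKernel Ω ι G)
      (f := fun x a => ψ (x, a)) hψm.stronglyMeasurable).measurable
  have hψi : ∀ x, Integrable (fun a => ψ (x, a)) (markKernel Ω ι G x) := fun x =>
    Integrable.of_bound (hψm.comp measurable_prodMk_left).aestronglyMeasurable 1
      (ae_of_all _ fun a => hψ _)
  have hφ : ∀ x, ‖φ x‖ ≤ 1 := fun x => by
    simpa using norm_integral_le_of_norm_le_const (ae_of_all (markKernel Ω ι G x) fun a => hψ (x, a))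
  have hφ1 : ∀ x, φ x - 1 = ∫ a, (ψ (x, a) - 1) ∂(markKernel Ω ι G x) := fun x => by
    rw [integral_sub (hψi x) (integrable_const _)]
    simp [φ]
  have hφint : Integrable (fun x => φ x - 1) ν := by
    simp_rw [hφ1]
    exact Integrable.integral_compProd (κ := Kernel.const Unit ν) (η := (markKernel Ω ι G).comap Prod.snd measurable_snd) (a := ()) hint
  have hlim := tendsto_integral_prod_points h.measurable_jump h.measurable_loc h.prm hφm hφ hφint
  simp_rw [hφ1] at hlim
  rw [Measure.integral_compProd hint]
  refine hlim.congr fun n => ?_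
  -- The factor is set to 1 off positive jumps before conditioning, so padding entries have no
  -- effect on either side.
  have h2 := h.integral_prod_marks (ψ := fun y => if 0 < y.1.1 then ψ y else 1)
    (Measurable.ite (measurableSet_lt measurable_const (measurable_fst.comp measurable_fst))
      hψm measurable_const)
    (fun y => by
      split_ifs
      · exact hψ y
      · simp) n
  rw [h2]
  refine integral_congr_ae (ae_of_all _ fun θ => Finset.prod_congr rfl fun k _ => ?_)
  simp only [onPos]
  split_ifs
  · rfl
  · simp

/-- When only finitely many factors differ from 1, the partial products are eventually constant and
the limit can be taken inside by dominated convergence. All functionals of the customers are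
evaluated in this form. -/
theorem IsIBPModel.integral_eq_exp (h : IsIBPModel G ν τ w A P) [SFinite ν]
    {ψ : (ℝ × Ω) × (ι → E) → ℂ} (hψm : Measurable ψ) (hψ : ∀ y, ‖ψ y‖ ≤ 1)
    (hint : Integrable (fun y => ψ y - 1) (ν ⊗ₘ markKernel Ω ι G)) {F : Θ → ℂ}
    (hF : ∀ᵐ θ ∂P, ∀ᶠ n in atTop, ∏ k ∈ Finset.range n,
      (if 0 < τ k θ then ψ ((τ k θ, w k θ), fun i => A i k θ) else 1) = F θ) :
    ∫ θ, F θ ∂P = Complex.exp (∫ y, (ψ y - 1) ∂(ν ⊗ₘ markKernel Ω ι G)) := by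
  refine tendsto_nhds_unique ?_ (h.tendsto_integral_prod hψm hψ hint)
  refine tendsto_integral_of_dominated_convergence (fun _ => 1) (fun n => ?_)
    (integrable_const _) (fun n => ae_of_all _ fun θ => ?_)
    (hF.mono fun θ hθ => tendsto_nhds_of_eventually_eq hθ)
  · refine (Finset.measurable_prod _ fun k _ => Measurable.ite
      (measurableSet_lt measurable_const (h.measurable_jump k)) ?_
      measurable_const).aestronglyMeasurable
    exact hψm.comp (((h.measurable_jump k).prodMk (h.measurable_loc k)).prodMk
      (h.measurable_marks k))
  · rw [norm_prod]
    refine Finset.prod_le_one (fun _ _ => norm_nonneg _) fun k _ => ?_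
    split_ifs
    · exact hψ _
    · simp

/-- Campbell's formula for the marked points. -/
theorem IsIBPModel.lintegral_tsum_marks (h : IsIBPModel G ν τ w A P) [SFinite ν]
    {f : (ℝ × Ω) × (ι → E) → ℝ≥0∞} (hf : Measurable f) :
    ∫⁻ θ, ∑' k, (if 0 < τ k θ then f ((τ k θ, w k θ), fun i => A i k θ) else 0) ∂P =
      ∫⁻ y, f y ∂(ν ⊗ₘ markKernel Ω ι G) := by
  have hg : Measurable fun y : (ℝ × Ω) × (ι → E) => if 0 < y.1.1 then f y else 0 :=
    Measurable.ite (measurableSet_lt measurable_const (measurable_fst.comp measurable_fst))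
      hf measurable_const
  have hX : ∀ k, Measurable fun θ => ((τ k θ, w k θ), fun i => A i k θ) := fun k =>
    ((h.measurable_jump k).prodMk (h.measurable_loc k)).prodMk (h.measurable_marks k)
  rw [lintegral_tsum (f := fun k θ => if 0 < τ k θ then f ((τ k θ, w k θ), fun i => A i k θ) else 0)
    fun k => (hg.comp (hX k)).aemeasurable, tsum_congr fun k => h.lintegral_mark hg k,
    Measure.lintegral_compProd hf, ← lintegral_tsum_points h.prm hf.lintegral_kernel_prod_right',
    lintegral_tsum]
  · refine tsum_congr fun k => lintegral_congr fun θ => ?_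
    simp only [onPos]
    split_ifs <;> simp
  · intro k
    exact ((measurable_onPos 0 hf.lintegral_kernel_prod_right').comp
      ((h.measurable_jump k).prodMk (h.measurable_loc k))).aemeasurable

theorem IsIBPModel.ae_finite (h : IsIBPModel G ν τ w A P) [SFinite ν]
    {D : Set ((ℝ × Ω) × (ι → E))} (hD : MeasurableSet D) (hfin : (ν ⊗ₘ markKernel Ω ι G) D ≠ ∞) :
    ∀ᵐ θ ∂P, {k | 0 < τ k θ ∧ ((τ k θ, w k θ), fun i => A i k θ) ∈ D}.Finite := by
  have h1 := h.lintegral_tsum_marks (measurable_one.indicator hD)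
  rw [lintegral_indicator_one hD] at h1
  have hm : Measurable fun θ => ∑' k, (if 0 < τ k θ then
      D.indicator (1 : (ℝ × Ω) × (ι → E) → ℝ≥0∞) ((τ k θ, w k θ), fun i => A i k θ) else 0) :=
    Measurable.tsum fun k => Measurable.ite
      (measurableSet_lt measurable_const (h.measurable_jump k))
      ((measurable_one.indicator hD).comp (((h.measurable_jump k).prodMk
        (h.measurable_loc k)).prodMk (h.measurable_marks k))) measurable_const
  filter_upwards [ae_lt_top hm (by rwa [h1])] with θ hθ
  refine (ENNReal.finite_const_le_of_tsum_ne_top hθ.ne one_ne_zero).subset ?_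
  rintro k ⟨hk, hkD⟩
  simp [hk, hkD]

/-- By Campbell's formula the expected number of marked points in a null set is zero. -/
theorem IsIBPModel.ae_forall_mem (h : IsIBPModel G ν τ w A P) [SFinite ν]
    {p : (ℝ × Ω) × (ι → E) → Prop} (hp : ∀ᵐ y ∂(ν ⊗ₘ markKernel Ω ι G), p y) :
    ∀ᵐ θ ∂P, ∀ k, 0 < τ k θ → p ((τ k θ, w k θ), fun i => A i k θ) := by
  obtain ⟨D, hsub, hD, hD0⟩ := exists_measurable_superset_of_null (ae_iff.1 hp)
  have h1 := h.lintegral_tsum_marks (measurable_one.indicator hD)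
  rw [lintegral_indicator_one hD, hD0] at h1
  have hm : Measurable fun θ => ∑' k, (if 0 < τ k θ then
      D.indicator (1 : (ℝ × Ω) × (ι → E) → ℝ≥0∞) ((τ k θ, w k θ), fun i => A i k θ) else 0) :=
    Measurable.tsum fun k => Measurable.ite
      (measurableSet_lt measurable_const (h.measurable_jump k))
      ((measurable_one.indicator hD).comp (((h.measurable_jump k).prodMk
        (h.measurable_loc k)).prodMk (h.measurable_marks k))) measurable_const
  rw [lintegral_eq_zero_iff hm] at h1
  filter_upwards [h1] with θ hθ k hk
  by_contra hcon
  have h2 := ENNReal.tsum_eq_zero.1 hθ k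
  simp [hk, hsub hcon] at h2

end Marks

/-! ### The σ-algebra of vector measures, and uniqueness of characteristic functionals -/

section VectorMeasureSpace

variable {Ω E X : Type*} [MeasurableSpace Ω] [NormedAddCommGroup E] [MeasurableSpace E]
  [MeasurableSpace X]

theorem measurable_vectorMeasure_apply (B : Set Ω) :
    Measurable fun v : VectorMeasure Ω E => v B :=
  (comap_measurable _).mono (le_iSup (fun B : Set Ω =>
    MeasurableSpace.comap (fun v : VectorMeasure Ω E => v B) inferInstance) B) le_rfl

/-- The generating evaluations include nonmeasurable sets, but there every vector measure takes the
value 0. -/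
theorem measurable_vectorMeasure_of_apply {f : X → VectorMeasure Ω E}
    (hf : ∀ B, MeasurableSet B → Measurable fun x => f x B) : Measurable f := by
  refine Measurable.of_le_map (iSup_le fun B => ?_)
  rw [← MeasurableSpace.comap_le_iff_le_map, MeasurableSpace.comap_comp,
    ← measurable_iff_comap_le]
  by_cases hB : MeasurableSet B
  · exact hf B hB
  · have : (fun v : VectorMeasure Ω E => v B) ∘ f = fun _ => 0 := by
      ext x; exact VectorMeasure.not_measurable _ hB
    rw [this]
    exact measurable_const

end VectorMeasureSpace

theorem countablySeparated_of_injective {X Y : Type*} [MeasurableSpace X] [MeasurableSpace Y]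
    [MeasurableSpace.CountablySeparated Y] {f : X → Y} (hf : Measurable f)
    (hinj : Function.Injective f) : MeasurableSpace.CountablySeparated X := by
  obtain ⟨S, hS, hSm, hsep⟩ :=
    (MeasurableSpace.countablySeparated_def (α := Y)).1 inferInstance
  refine ⟨⟨preimage f '' S, hS.image _, ?_, fun x _ y _ h => hinj ?_⟩⟩
  · rintro _ ⟨s, hs, rfl⟩
    exact hf (hSm s hs)
  · exact hsep _ (mem_univ _) _ (mem_univ _) fun s hs => h _ ⟨s, hs, rfl⟩

section Separated

variable {Ω E : Type*} [MeasurableSpace Ω] [StandardBorelSpace Ω]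
    [NormedAddCommGroup E] [NormedSpace ℝ E] [FiniteDimensional ℝ E]
    [MeasurableSpace E] [BorelSpace E]

instance (T : Type*) [Countable T] :
    MeasurableSpace.CountablySeparated (T → VectorMeasure Ω E) := by
  have : CompleteSpace E := FiniteDimensional.complete ℝ E
  have : SecondCountableTopology E :=
    have := FiniteDimensional.proper ℝ E
    inferInstance
  let φ := embeddingReal Ω
  have hφ := measurableEmbedding_embeddingReal Ω
  -- A vector measure is determined by its total mass and its values on preimages of rational
  -- half-lines, a countable π-system generating the σ-algebra of `Ω`. Countable separation is the
  -- property of the target used by Lusin–Souslin.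
  let C : Option ℚ → Set Ω := fun q => q.elim univ fun q => φ ⁻¹' Iic (q : ℝ)
  let f : (T → VectorMeasure Ω E) → T → Option ℚ → E := fun v t q => v t (C q)
  have hf : Measurable f := measurable_pi_lambda _ fun t => measurable_pi_lambda _ fun q =>
    (measurable_vectorMeasure_apply _).comp (measurable_pi_apply t)
  refine countablySeparated_of_injective hf fun v v' h => funext fun t => ?_
  have h' : ∀ q, v t (C q) = v' t (C q) := fun q => congrFun (congrFun h t) q
  refine VectorMeasure.ext_of_generateFrom (preimage φ '' ⋃ a : ℚ, {Iic (a : ℝ)}) ?_ ?_ ?_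
    (h' none)
  · rintro _ ⟨s, hs, rfl⟩
    obtain ⟨q, rfl⟩ := mem_iUnion.1 hs
    exact h' (some q)
  · rw [← MeasurableSpace.comap_generateFrom, ← Real.borel_eq_generateFrom_Iic_rat,
      ← hφ.comap_eq, ← BorelSpace.measurable_eq (α := ℝ)]
  · exact Real.isPiSystem_Iic_rat.comap φ

end Separated

section CharFun

variable {X J E : Type*} [MeasurableSpace X] [NormedAddCommGroup E] [NormedSpace ℝ E]
    [FiniteDimensional ℝ E] [MeasurableSpace E] [BorelSpace E]

/-- Two finite measures on a space whose `σ`-algebra is generated by the family `e` are equal if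
they have the same characteristic functional. -/
theorem measure_ext_of_charFun (e : X → J → E)
    (he : ‹MeasurableSpace X› = MeasurableSpace.pi.comap e) {μ₁ μ₂ : Measure X}
    [IsFiniteMeasure μ₁] [IsFiniteMeasure μ₂]
    (h : ∀ (I : Finset J) (L : J → StrongDual ℝ E),
      ∫ x, Complex.exp ((∑ j ∈ I, L j (e x j) : ℝ) * Complex.I) ∂μ₁ =
        ∫ x, Complex.exp ((∑ j ∈ I, L j (e x j) : ℝ) * Complex.I) ∂μ₂) : μ₁ = μ₂ := by
  classical
  have : CompleteSpace E := FiniteDimensional.complete ℝ E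
  have : SecondCountableTopology E :=
    have := FiniteDimensional.proper ℝ E
    inferInstance
  have hem : Measurable e := measurable_iff_comap_le.2 he.ge
  have key : μ₁.map e = μ₂.map e := by
    -- Measures on a product are determined by their finite-dimensional marginals, and these by
    -- their characteristic functions.
    refine IsProjectiveLimit.unique (P := fun I => (μ₂.map e).map I.restrict) (fun I => ?_)
      fun I => rfl
    have hI : Measurable (I.restrict : (J → E) → (I → E)) := Finset.measurable_restrict I
    refine Measure.ext_of_charFunDual (funext fun L => ?_)
    have hexp : Continuous fun v : I → E => Complex.exp ((L v : ℂ) * Complex.I) := by fun_prop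
    simp only [charFunDual_apply]
    rw [Measure.map_map hI hem, Measure.map_map hI hem,
      integral_map (hI.comp hem).aemeasurable hexp.aestronglyMeasurable,
      integral_map (hI.comp hem).aemeasurable hexp.aestronglyMeasurable]
    -- A functional on `I → E` is the sum of its restrictions to the coordinates; indices off `I`
    -- receive the functional 0, since `h` asks for a family indexed by all of `J`.
    have hL : ∀ x, L ((I.restrict ∘ e) x) = ∑ j ∈ I, (if hj : j ∈ I then
        L.comp (ContinuousLinearMap.single ℝ (fun _ : I => E) ⟨j, hj⟩) else 0) (e x j) := by
      intro x
      rw [← L.sum_comp_single, ← Finset.sum_coe_sort I]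
      refine Finset.sum_congr rfl fun j _ => ?_
      simp
    simp_rw [hL]
    exact h I _
  ext s hs
  obtain ⟨s', hs', rfl⟩ : MeasurableSet[MeasurableSpace.pi.comap e] s := he ▸ hs
  rw [← Measure.map_apply hem hs', key, Measure.map_apply hem hs']

end CharFun

/-! ### The sums defining the customers -/

section LatentSum

variable {Ω E X : Type*} [MeasurableSpace Ω] [NormedAddCommGroup E]

theorem dirac_apply_eq (x : Ω) (a : E) {B : Set Ω} [Decidable (x ∈ B)] (hB : MeasurableSet B) :
    VectorMeasure.dirac x a B = if x ∈ B then a else 0 := by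
  split_ifs with h
  · exact VectorMeasure.dirac_apply_of_mem hB h
  · exact VectorMeasure.dirac_apply_of_notMem h

theorem dirac_eq_zero_iff {x : Ω} {a : E} : VectorMeasure.dirac x a = 0 ↔ a = 0 := by
  refine ⟨fun h => ?_, fun h => by simp [h]⟩
  have := congrArg (fun v : VectorMeasure Ω E => v univ) h
  simpa using this

theorem latentSum_eq_sum {t : ℕ → ℝ} {w : ℕ → Ω} {a : ℕ → E} (s : Finset ℕ)
    (hs : ∀ k, 0 < t k → a k ≠ 0 → k ∈ s) :
    latentSum t w a = ∑ k ∈ s, if 0 < t k then VectorMeasure.dirac (w k) (a k) else 0 := by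
  refine finsum_eq_sum_of_support_subset _ fun k hk => ?_
  simp only [Function.mem_support, ne_eq, ite_eq_right_iff, dirac_eq_zero_iff, not_forall] at hk
  exact hs k hk.1 hk.2

theorem latentSum_of_infinite {t : ℕ → ℝ} {w : ℕ → Ω} {a : ℕ → E}
    (h : ¬ {k | 0 < t k ∧ a k ≠ 0}.Finite) : latentSum t w a = 0 := by
  refine finsum_of_infinite_support ?_
  convert! h using 2
  ext k
  simp [dirac_eq_zero_iff]

variable [MeasurableSpace X] [NormedSpace ℝ E] [FiniteDimensional ℝ E] [MeasurableSpace E]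
  [BorelSpace E]

theorem measurable_latentSum {t : ℕ → X → ℝ} {w : ℕ → X → Ω} {a : ℕ → X → E}
    (ht : ∀ k, Measurable (t k)) (hw : ∀ k, Measurable (w k)) (ha : ∀ k, Measurable (a k)) :
    Measurable fun x => latentSum (fun k => t k x) (fun k => w k x) (fun k => a k x) := by
  classical
  have : SecondCountableTopology E :=
    have := FiniteDimensional.proper ℝ E
    inferInstance
  refine measurable_vectorMeasure_of_apply fun B hB => ?_
  -- `F` is the event that the sum is finite. Off `F` the default value of `∑ᶠ` is 0, matched by the
  -- indicator in `f`, so the partial sums are eventually equal to the sum everywhere.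
  let F : Set X := {x | ∃ n, ∀ k, n ≤ k → ¬ (0 < t k x ∧ a k x ≠ 0)}
  have hF : MeasurableSet F := by
    have : F = ⋃ n, ⋂ k, ⋂ (_ : n ≤ k), {x | ¬ (0 < t k x ∧ a k x ≠ 0)} := by
      ext x; simp [F]
    rw [this]
    refine MeasurableSet.iUnion fun n => MeasurableSet.iInter fun k => MeasurableSet.iInter fun _ =>
      ((measurableSet_lt measurable_const (ht k)).inter
        ((ha k) (measurableSet_singleton 0).compl)).compl
  let f : ℕ → X → E := fun n => F.indicator fun x =>
    ∑ k ∈ Finset.range n, if 0 < t k x ∧ w k x ∈ B then a k x else 0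
  have hf : ∀ n, Measurable (f n) := fun n =>
    (Finset.measurable_sum _ fun k _ => Measurable.ite
      ((measurableSet_lt measurable_const (ht k)).inter (hw k hB)) (ha k)
      measurable_const).indicator hF
  refine measurable_of_tendsto_metrizable hf (tendsto_pi_nhds.2 fun x => ?_)
  by_cases hx : x ∈ F
  · obtain ⟨n, hn⟩ := hx
    refine tendsto_nhds_of_eventually_eq (eventually_ge_atTop n |>.mono fun m hm => ?_)
    simp only [f]
    rw [indicator_of_mem (show x ∈ F from ⟨n, hn⟩), latentSum_eq_sum (Finset.range m)]
    · rw [FunLike.coe_sum, Finset.sum_apply]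
      refine Finset.sum_congr rfl fun k _ => ?_
      by_cases h1 : 0 < t k x
      · simp [h1, dirac_apply_eq _ _ hB]
      · simp [h1]
    · intro k h1 h2
      by_contra hk
      exact hn k (by simp at hk; omega) ⟨h1, h2⟩
  · refine tendsto_nhds_of_eventually_eq (Eventually.of_forall fun m => ?_)
    simp only [f]
    rw [indicator_of_notMem hx, latentSum_of_infinite]
    · rfl
    · intro hfin
      refine hx ⟨hfin.toFinset.sup id + 1, fun k hk hk' => ?_⟩
      have := Finset.le_sup (f := id) (hfin.mem_toFinset.2 hk')
      simp only [id] at this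
      omega

end LatentSum

/-- The probability is `1 - e^(-r) (1 + r)`, and `e^(-r) ≥ 1 - r` bounds it by `1 - (1 - r)(1 + r) =
r²`. -/
theorem poissonMeasure_two_le (r : ℝ≥0) : poissonMeasure r {n | 2 ≤ n} ≤ (r : ℝ≥0∞) ^ 2 := by
  have h1 : (poissonMeasure r).real {n | 2 ≤ n} = 1 - (poissonMeasure r).real {0, 1} := by
    rw [← probReal_compl_eq_one_sub .of_discrete]
    congr 1
    ext n
    simp only [mem_ofPred_eq, mem_compl_iff, mem_insert_iff, mem_singleton_iff]
    omega
  have h2 : (poissonMeasure r).real {0, 1} = Real.exp (-r) + Real.exp (-r) * r := by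
    have : ({0, 1} : Set ℕ) = {0} ∪ {1} := rfl
    rw [this, measureReal_union (by simp) .of_discrete, poissonMeasure_real_singleton,
      poissonMeasure_real_singleton]
    simp
  have h3 : (poissonMeasure r).real {n | 2 ≤ n} ≤ (r : ℝ) ^ 2 := by
    rw [h1, h2]
    have := Real.add_one_le_exp (-(r : ℝ))
    nlinarith [r.2]
  rw [← ENNReal.ofReal_toReal (measure_ne_top (poissonMeasure r) _)]
  refine (ENNReal.ofReal_le_ofReal h3).trans ?_
  rw [ENNReal.ofReal_pow r.coe_nonneg, ENNReal.ofReal_coe_nnreal]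

/-! ### Distinct points have distinct locations -/

section Distinct

/-- The sum is the `μ × μ` measure of the pairs lying in a common cell of width `1/n`. These sets
converge pointwise to the diagonal, which is null when `μ` has no atoms. -/
theorem tendsto_sum_sq_cells {Ω : Type*} [MeasurableSpace Ω] [StandardBorelSpace Ω] (μ : Measure Ω) [IsFiniteMeasure μ]
    (hμ : ∀ ω, μ {ω} = 0) :
    Tendsto (fun n : ℕ => ∑' j : ℤ, μ ((fun ω => ⌊n * embeddingReal Ω ω⌋) ⁻¹' {j}) ^ 2) atTop
      (𝓝 0) := by
  have hφ := measurableEmbedding_embeddingReal Ω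
  have hc : ∀ n : ℕ, Measurable fun ω => ⌊n * embeddingReal Ω ω⌋ := fun n =>
    (measurable_const.mul hφ.measurable).floor
  let D : ℕ → Set (Ω × Ω) := fun n =>
    ⋃ j : ℤ, (((fun ω => ⌊n * embeddingReal Ω ω⌋) ⁻¹' {j}) ×ˢ
      ((fun ω => ⌊n * embeddingReal Ω ω⌋) ⁻¹' {j}))
  have hDm : ∀ n, MeasurableSet (D n) := fun n =>
    MeasurableSet.iUnion fun j => (hc n (measurableSet_singleton j)).prod
      (hc n (measurableSet_singleton j))
  have hD : ∀ n, (μ.prod μ) (D n) =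
      ∑' j : ℤ, μ ((fun ω => ⌊n * embeddingReal Ω ω⌋) ⁻¹' {j}) ^ 2 := fun n => by
    rw [measure_iUnion _ fun j => (hc n (measurableSet_singleton j)).prod
      (hc n (measurableSet_singleton j))]
    · simp_rw [Measure.prod_prod, sq]
    · intro i j hij
      refine Disjoint.set_prod_left (Disjoint.preimage _ (disjoint_singleton.2 hij)) _ _
  have hdiag : MeasurableSet (diagonal Ω) := measurableSet_diagonal
  have h0 : (μ.prod μ) (diagonal Ω) = 0 := by
    rw [Measure.prod_apply hdiag]
    have : ∀ x : Ω, Prod.mk x ⁻¹' diagonal Ω = {x} := fun x => by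
      ext y; simp [eq_comm]
    simp [this, hμ]
  simp_rw [← hD]
  rw [← h0]
  refine tendsto_measure_of_tendsto_indicator atTop hDm MeasurableSet.univ (by simp)
    (Eventually.of_forall fun _ => subset_univ _) ?_
  rintro ⟨x, y⟩
  have hmem : ∀ n, (x, y) ∈ D n ↔ ⌊n * embeddingReal Ω x⌋ = ⌊n * embeddingReal Ω y⌋ := by
    intro n
    simp only [D, mem_iUnion, mem_prod, mem_preimage, mem_singleton_iff]
    exact ⟨fun ⟨j, h1, h2⟩ => h1.trans h2.symm, fun h => ⟨_, rfl, h.symm⟩⟩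
  by_cases hxy : x = y
  · subst hxy
    exact Eventually.of_forall fun n => iff_of_true ((hmem n).2 rfl) rfl
  · have hne : 0 < |embeddingReal Ω x - embeddingReal Ω y| := by
      rw [abs_pos, sub_ne_zero]
      exact fun h => hxy (hφ.injective h)
    -- Once `n` exceeds the inverse distance of the two images, they no longer share a cell of width
    -- `1/n`.
    obtain ⟨m, hm⟩ := exists_nat_gt (1 / |embeddingReal Ω x - embeddingReal Ω y|)
    filter_upwards [eventually_ge_atTop m] with n hn
    simp only [hmem, mem_diagonal_iff, hxy, iff_false]
    intro h
    have h1 := Int.abs_sub_lt_one_of_floor_eq_floor h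
    rw [← mul_sub, abs_mul, Nat.abs_cast] at h1
    rw [div_lt_iff₀ hne] at hm
    have : (m : ℝ) ≤ n := by exact_mod_cast hn
    nlinarith

variable {Θ Ω : Type*} [MeasurableSpace Θ] [MeasurableSpace Ω] {P : Measure Θ}
  {ν : Measure (ℝ × Ω)} {t : ℕ → Θ → ℝ} {w : ℕ → Θ → Ω}

theorem measure_two_points_le (hN : IsPRM ν
      (fun θ => pointMeasure (fun k => t k θ) (fun k => w k θ)) P) {B : Set (ℝ × Ω)}
    (hB : MeasurableSet B) (hν : ν B ≠ ∞) :
    P {θ | ∃ k l, k ≠ l ∧ 0 < t k θ ∧ 0 < t l θ ∧ (t k θ, w k θ) ∈ B ∧ (t l θ, w l θ) ∈ B} ≤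
      (ν B) ^ 2 := by
  have hm : Measurable fun θ => pointMeasure (fun k => t k θ) (fun k => w k θ) B :=
    (Measure.measurable_coe hB).comp hN.measurable
  have h2 : P {θ | 2 ≤ pointMeasure (fun k => t k θ) (fun k => w k θ) B} ≤ (ν B) ^ 2 := by
    have : {θ | 2 ≤ pointMeasure (fun k => t k θ) (fun k => w k θ) B} =
      (fun θ => pointMeasure (fun k => t k θ) (fun k => w k θ) B) ⁻¹' Ici 2 := rfl
    rw [this, ← Measure.map_apply hm measurableSet_Ici, hN.poisson B hB hν,
      Measure.map_apply .of_discrete measurableSet_Ici]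
    have h3 : (fun n : ℕ => (n : ℝ≥0∞)) ⁻¹' Ici 2 = {n | 2 ≤ n} := by
      ext n
      simp only [mem_preimage, mem_Ici, mem_ofPred_eq]
      exact_mod_cast Iff.rfl
    rw [h3]
    refine (poissonMeasure_two_le _).trans ?_
    rw [ENNReal.coe_toNNReal hν]
  refine (measure_mono ?_).trans h2
  rintro θ ⟨k, l, hkl, hk, hl, hkB, hlB⟩
  simp only [mem_ofPred_eq]
  rw [pointMeasure_apply _ _ hB]
  have h4 : ({k, l} : Set ℕ) ⊆ {k | 0 < t k θ ∧ (t k θ, w k θ) ∈ B} := by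
    rintro j (rfl | rfl)
    · exact ⟨hk, hkB⟩
    · exact ⟨hl, hlB⟩
  have h5 := Set.encard_le_encard h4
  rw [Set.encard_pair hkl] at h5
  exact_mod_cast (ENat.toENNReal_le.2 h5)

/-- The points of a Poisson random measure have distinct locations if its intensity does not
charge the sets `ℝ × {ω}`. -/
theorem ae_injective_loc [StandardBorelSpace Ω] [SigmaFinite ν]
    (hν : ∀ ω : Ω, ν (univ ×ˢ {ω}) = 0) (hN : IsPRM ν
      (fun θ => pointMeasure (fun k => t k θ) (fun k => w k θ)) P) :
    ∀ᵐ θ ∂P, ∀ k l, 0 < t k θ → 0 < t l θ → w k θ = w l θ → k = l := by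
  have key : ∀ m, P {θ | ∃ k l, k ≠ l ∧ 0 < t k θ ∧ 0 < t l θ ∧
      (t k θ, w k θ) ∈ spanningSets ν m ∧ (t l θ, w l θ) ∈ spanningSets ν m ∧
      w k θ = w l θ} = 0 := by
    intro m
    set B := spanningSets ν m with hBdef
    have hB : MeasurableSet B := measurableSet_spanningSets ν m
    have hBfin : ν B < ∞ := measure_spanningSets_lt_top ν m
    -- The intensity may be infinite, so points are first confined to a spanning set; `μ` is then a
    -- finite measure of locations without atoms.
    let μ : Measure Ω := (ν.restrict B).map Prod.snd
    have : IsFiniteMeasure (ν.restrict B) := ⟨by simpa using hBfin⟩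
    have hμapp : ∀ C, MeasurableSet C → μ C = ν (B ∩ Prod.snd ⁻¹' C) := fun C hC => by
      rw [Measure.map_apply measurable_snd hC, Measure.restrict_apply (measurable_snd hC),
        inter_comm]
    have hμ : ∀ ω, μ {ω} = 0 := fun ω => by
      rw [hμapp _ (measurableSet_singleton ω)]
      refine measure_mono_null ?_ (hν ω)
      rintro x ⟨_, hx⟩
      exact ⟨mem_univ _, hx⟩
    refine le_antisymm (ge_of_tendsto' (tendsto_sum_sq_cells μ hμ) fun n => ?_) zero_le
    have hc : ∀ j : ℤ, MeasurableSet ((fun ω => ⌊n * embeddingReal Ω ω⌋) ⁻¹' {j}) := fun j =>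
      (measurable_const.mul (measurable_embeddingReal Ω)).floor (measurableSet_singleton j)
    -- Two points with a common location share a cell for every `n`, and each cell holds two points
    -- with probability at most the square of its mass.
    calc _ ≤ P (⋃ j : ℤ, {θ | ∃ k l, k ≠ l ∧ 0 < t k θ ∧ 0 < t l θ ∧
          (t k θ, w k θ) ∈ B ∩ Prod.snd ⁻¹' ((fun ω => ⌊n * embeddingReal Ω ω⌋) ⁻¹' {j}) ∧
          (t l θ, w l θ) ∈ B ∩ Prod.snd ⁻¹' ((fun ω => ⌊n * embeddingReal Ω ω⌋) ⁻¹' {j})}) := by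
          refine measure_mono ?_
          rintro θ ⟨k, l, hkl, hk, hl, hkB, hlB, hw⟩
          refine mem_iUnion.2 ⟨⌊n * embeddingReal Ω (w k θ)⌋, k, l, hkl, hk, hl, ⟨hkB, rfl⟩, hlB, ?_⟩
          simp [hw]
      _ ≤ ∑' j : ℤ, _ := measure_iUnion_le _
      _ ≤ _ := by
          refine ENNReal.tsum_le_tsum fun j => ?_
          rw [hμapp _ (hc j)]
          exact measure_two_points_le hN (hB.inter (measurable_snd (hc j)))
            (ne_top_of_le_ne_top hBfin.ne (measure_mono inter_subset_left))
  have h2 := ae_all_iff.2 fun m => measure_eq_zero_iff_ae_notMem.1 (key m)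
  filter_upwards [h2] with θ hθ k l hk hl hw
  by_contra hkl
  obtain ⟨m, hm⟩ := mem_iUnion.1 ((iUnion_spanningSets ν).symm ▸ mem_univ (t k θ, w k θ))
  obtain ⟨m', hm'⟩ := mem_iUnion.1 ((iUnion_spanningSets ν).symm ▸ mem_univ (t l θ, w l θ))
  exact hθ (max m m') ⟨k, l, hkl, hk, hl, monotone_spanningSets ν (le_max_left _ _) hm,
    monotone_spanningSets ν (le_max_right _ _) hm', hw⟩

end Distinct

/-! ### A point sequence with the Poisson functional is a Poisson random measure -/

section PRMOfFunctional

variable {Θ Ω : Type*} [MeasurableSpace Θ] [MeasurableSpace Ω] {P : Measure Θ}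
  {ν : Measure (ℝ × Ω)} {t : ℕ → Θ → ℝ} {w : ℕ → Θ → Ω}

theorem measurable_pointMeasure (ht : ∀ k, Measurable (t k)) (hw : ∀ k, Measurable (w k)) :
    Measurable fun θ => pointMeasure (fun k => t k θ) (fun k => w k θ) := by
  refine Measure.measurable_of_measurable_coe _ fun B hB => ?_
  simp_rw [← lintegral_indicator_one hB, lintegral_pointMeasure _ _ (measurable_one.indicator hB)]
  exact Measurable.tsum fun k => Measurable.ite (measurableSet_lt measurable_const (ht k))
    ((measurable_one.indicator hB).comp ((ht k).prodMk (hw k))) measurable_const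

theorem sum_indicator_toReal_pointMeasure {n : ℕ} (tt : ℕ → ℝ) (ww : ℕ → Ω)
    {B : Set (ℝ × Ω)} (hB : MeasurableSet B)
    (hn : ∀ k, 0 < tt k → (tt k, ww k) ∈ B → k < n) :
    ∑ k ∈ Finset.range n, onPos (0 : ℝ) (B.indicator 1) (tt k, ww k) =
      (pointMeasure tt ww B).toReal := by
  classical
  have hset : {k | 0 < tt k ∧ (tt k, ww k) ∈ B} =
      ((Finset.range n).filter fun k => 0 < tt k ∧ (tt k, ww k) ∈ B : Finset ℕ) := by
    ext k
    simp only [mem_ofPred_eq, Finset.coe_filter, Finset.mem_range]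
    exact ⟨fun h => ⟨hn k h.1 h.2, h⟩, fun h => h.2⟩
  rw [pointMeasure_apply _ _ hB, hset, Set.encard_coe_eq_coe_finsetCard, Finset.card_filter]
  rw [ENat.toENNReal_coe, ENNReal.toReal_natCast, Nat.cast_sum]
  refine Finset.sum_congr rfl fun k _ => ?_
  by_cases h1 : 0 < tt k <;> by_cases h2 : (tt k, ww k) ∈ B <;> simp [onPos, h1, h2]

/-- A sequence of points with the characteristic functional of a Poisson random measure. -/
structure HasPoissonFunctional (ν : Measure (ℝ × Ω)) (t : ℕ → Θ → ℝ) (w : ℕ → Θ → Ω)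
    (P : Measure Θ) : Prop where
  measurable_jump : ∀ k, Measurable (t k)
  measurable_loc : ∀ k, Measurable (w k)
  finite : ∀ B, MeasurableSet B → ν B ≠ ∞ →
    ∀ᵐ θ ∂P, {k | 0 < t k θ ∧ (t k θ, w k θ) ∈ B}.Finite
  tendsto : ∀ ψ : ℝ × Ω → ℂ, Measurable ψ → (∀ x, ‖ψ x‖ ≤ 1) →
    Integrable (fun x => ψ x - 1) ν →
    Tendsto (fun n => ∫ θ, ∏ k ∈ Finset.range n, onPos 1 ψ (t k θ, w k θ) ∂P) atTop
      (𝓝 (Complex.exp (∫ x, (ψ x - 1) ∂ν)))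

variable [IsProbabilityMeasure P]

/-- Take `ψ = exp(i ∑ sᵢ 1_{Bᵢ})`. By disjointness `ψ - 1` equals `e^(i sᵢ) - 1` on `Bᵢ` and 0
elsewhere, so the exponent is a sum over `i`. The resulting factorisation yields both the Poisson
laws and their independence. -/
theorem HasPoissonFunctional.integral_exp_sum (h : HasPoissonFunctional ν t w P)
    {ι : Type*} [Fintype ι] (B : ι → Set (ℝ × Ω)) (hB : ∀ i, MeasurableSet (B i))
    (hdisj : Pairwise (Function.onFun Disjoint B)) (hν : ∀ i, ν (B i) ≠ ∞) (s : ι → ℝ) :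
    ∫ θ, Complex.exp ((∑ i, s i * (pointMeasure (fun k => t k θ) (fun k => w k θ) (B i)).toReal
        : ℝ) * Complex.I) ∂P =
      ∏ i, Complex.exp ((ν (B i)).toReal * (Complex.exp (s i * Complex.I) - 1)) := by
  classical
  let f : ℝ × Ω → ℝ := fun x => ∑ i, s i * (B i).indicator 1 x
  let ψ : ℝ × Ω → ℂ := fun x => Complex.exp ((f x : ℝ) * Complex.I)
  have hf : Measurable f := Finset.measurable_sum _ fun i _ =>
    measurable_const.mul (measurable_one.indicator (hB i))
  have hψm : Measurable ψ := by fun_prop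
  have hψ : ∀ x, ‖ψ x‖ ≤ 1 := fun x => (Complex.norm_exp_ofReal_mul_I _).le
  have hψ1 : ∀ x, ψ x - 1 =
      ∑ i, (B i).indicator (fun _ => Complex.exp (s i * Complex.I) - 1) x := fun x => by
    by_cases hx : ∃ i, x ∈ B i
    · obtain ⟨i, hi⟩ := hx
      have hne : ∀ j, j ≠ i → x ∉ B j := fun j hj hxj =>
        (hdisj hj).le_bot ⟨hxj, hi⟩
      have hfx : f x = s i := by
        simp only [f]
        rw [Finset.sum_eq_single i (fun j _ hj => by simp [hne j hj]) (by simp)]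
        simp [hi]
      rw [Finset.sum_eq_single i (fun j _ hj => by simp [hne j hj]) (by simp)]
      simp [ψ, hfx, hi]
    · push Not at hx
      simp [ψ, f, hx]
  have hterm : ∀ i, Integrable ((B i).indicator fun _ => Complex.exp (s i * Complex.I) - 1) ν :=
    fun i => (integrable_indicator_iff (hB i)).2 (integrableOn_const (hν i))
  have hint : Integrable (fun x => ψ x - 1) ν := by
    simp_rw [hψ1]
    exact integrable_finsetSum _ fun i _ => hterm i
  have hval : ∫ x, (ψ x - 1) ∂ν =
      ∑ i, ((ν (B i)).toReal * (Complex.exp (s i * Complex.I) - 1) : ℂ) := by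
    simp_rw [hψ1]
    rw [integral_finsetSum _ fun i _ => hterm i]
    refine Finset.sum_congr rfl fun i _ => ?_
    rw [integral_indicator_const _ (hB i)]
    simp [Measure.real]
  rw [← Complex.exp_sum, ← hval]
  refine tendsto_nhds_unique ?_ (h.tendsto ψ hψm hψ hint)
  refine tendsto_integral_of_dominated_convergence (fun _ => 1)
    (fun n => (measurable_prod_onPos h.measurable_jump h.measurable_loc hψm
      n).aestronglyMeasurable)
    (integrable_const _) (fun n => ae_of_all _ fun θ => norm_prod_onPos_le hψ n θ) ?_
  filter_upwards [ae_all_iff.2 fun i => h.finite (B i) (hB i) (hν i)] with θ hθ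
  refine tendsto_nhds_of_eventually_eq ?_
  have hev : ∀ i, ∀ᶠ n in atTop, ∀ k, 0 < t k θ → (t k θ, w k θ) ∈ B i → k < n := fun i => by
    filter_upwards [eventually_gt_atTop ((hθ i).toFinset.sup id)] with n hn k hk hkB
    exact (Finset.le_sup (f := id) ((hθ i).mem_toFinset.2 ⟨hk, hkB⟩)).trans_lt hn
  filter_upwards [eventually_all.2 hev] with n hn
  have h1 : ∀ k, onPos 1 ψ (t k θ, w k θ) =
      Complex.exp ((∑ i, s i * onPos 0 ((B i).indicator 1) (t k θ, w k θ) : ℝ) * Complex.I) := by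
    intro k
    by_cases hk : 0 < t k θ <;> simp [onPos, hk, ψ, f]
  simp_rw [h1]
  rw [← Complex.exp_sum, ← Finset.sum_mul, ← Complex.ofReal_sum, Finset.sum_comm]
  simp_rw [← Finset.mul_sum]
  rw [Finset.sum_congr rfl fun i _ => congrArg (s i * ·)
    (sum_indicator_toReal_pointMeasure (fun k => t k θ) (fun k => w k θ) (hB i) (hn i))]

/-- Characteristic functions determine the law of the real-valued count; it is carried back to
`ℝ≥0∞` because the count is almost surely finite. -/
theorem HasPoissonFunctional.map_eq (h : HasPoissonFunctional ν t w P) {B : Set (ℝ × Ω)}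
    (hB : MeasurableSet B) (hν : ν B ≠ ∞) :
    P.map (fun θ => pointMeasure (fun k => t k θ) (fun k => w k θ) B) =
      (poissonMeasure (ν B).toNNReal).map (fun n : ℕ => (n : ℝ≥0∞)) := by
  have hm : Measurable fun θ => pointMeasure (fun k => t k θ) (fun k => w k θ) B :=
    (Measure.measurable_coe hB).comp (measurable_pointMeasure h.measurable_jump h.measurable_loc)
  have hreal : P.map (fun θ => (pointMeasure (fun k => t k θ) (fun k => w k θ) B).toReal) =
      (poissonMeasure (ν B).toNNReal).map (fun n : ℕ => (n : ℝ)) := by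
    have : IsProbabilityMeasure
        (P.map (fun θ => (pointMeasure (fun k => t k θ) (fun k => w k θ) B).toReal)) :=
      Measure.isProbabilityMeasure_map hm.ennreal_toReal.aemeasurable
    refine Measure.ext_of_charFun (funext fun s => ?_)
    rw [charFun_map_cast_poissonMeasure, charFun_apply_real,
      integral_map hm.ennreal_toReal.aemeasurable (by fun_prop)]
    have := h.integral_exp_sum (fun _ : Unit => B) (fun _ => hB)
      (fun i j hij => absurd (Subsingleton.elim i j) hij) (fun _ => hν) (fun _ => s)
    simp only [Finset.univ_unique, Finset.sum_singleton, Finset.prod_singleton] at this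
    simpa [ENNReal.coe_toNNReal_eq_toReal] using this
  have hfin : ∀ᵐ θ ∂P, pointMeasure (fun k => t k θ) (fun k => w k θ) B =
      ENNReal.ofReal (pointMeasure (fun k => t k θ) (fun k => w k θ) B).toReal := by
    filter_upwards [h.finite B hB hν] with θ hθ
    rw [ENNReal.ofReal_toReal]
    rw [pointMeasure_apply _ _ hB]
    simpa using hθ
  rw [Measure.map_congr hfin]
  have := congrArg (Measure.map ENNReal.ofReal) hreal
  rw [Measure.map_map ENNReal.measurable_ofReal hm.ennreal_toReal,
    Measure.map_map ENNReal.measurable_ofReal .of_discrete] at this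
  simpa [Function.comp_def] using this

theorem HasPoissonFunctional.ae_eq_top [SigmaFinite ν] (h : HasPoissonFunctional ν t w P)
    {B : Set (ℝ × Ω)} (hB : MeasurableSet B) (hν : ν B = ∞) :
    ∀ᵐ θ ∂P, pointMeasure (fun k => t k θ) (fun k => w k θ) B = ∞ := by
  have hm : ∀ {B}, MeasurableSet B →
      Measurable fun θ => pointMeasure (fun k => t k θ) (fun k => w k θ) B := fun hB =>
    (Measure.measurable_coe hB).comp (measurable_pointMeasure h.measurable_jump h.measurable_loc)
  -- `F` is `2^(-N)` with value 0 at infinity. Its mean at `B` is at most its mean at each `S j`,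
  -- namely `exp(-ν(S j)/2)`. As `S j` increases to `B` this tends to 0, which forces `N B = ∞`.
  let F : ℝ≥0∞ → ℝ := fun y => if y = ∞ then 0 else (1 / 2) ^ ⌊y.toReal⌋₊
  have hFm : Measurable F := Measurable.ite (measurableSet_singleton ∞) measurable_const
    (by fun_prop)
  have hF0 : ∀ y, 0 ≤ F y := fun y => by
    simp only [F]; split_ifs <;> positivity
  have hF1 : ∀ y, F y ≤ 1 := fun y => by
    simp only [F]; split_ifs
    · norm_num
    · exact pow_le_one₀ (by norm_num) (by norm_num)
  have hFanti : Antitone F := fun x y hxy => by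
    simp only [F]
    split_ifs with h1 h2 h2
    · rfl
    · positivity
    · exact absurd (top_le_iff.1 (h2 ▸ hxy)) h1
    · exact pow_le_pow_of_le_one (by norm_num) (by norm_num)
        (Nat.floor_mono ((ENNReal.toReal_le_toReal h2 h1).2 hxy))
  have hFi : ∀ {g : Θ → ℝ≥0∞}, Measurable g → Integrable (fun θ => F (g θ)) P := fun hg =>
    Integrable.of_bound (hFm.comp hg).aestronglyMeasurable 1 (ae_of_all _ fun θ => by
      rw [Real.norm_of_nonneg (hF0 _)]; exact hF1 _)
  set c := ∫ θ, F (pointMeasure (fun k => t k θ) (fun k => w k θ) B) ∂P with hc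
  let S : ℕ → Set (ℝ × Ω) := fun j => B ∩ spanningSets ν j
  have hS : ∀ j, MeasurableSet (S j) := fun j => hB.inter (measurableSet_spanningSets ν j)
  have hSfin : ∀ j, ν (S j) ≠ ∞ := fun j =>
    ne_top_of_le_ne_top (measure_spanningSets_lt_top ν j).ne (measure_mono inter_subset_right)
  have hle : ∀ j, c ≤ Real.exp (-(ν (S j)).toReal / 2) := by
    intro j
    have h1 : c ≤ ∫ θ, F (pointMeasure (fun k => t k θ) (fun k => w k θ) (S j)) ∂P :=
      integral_mono (hFi (hm hB)) (hFi (hm (hS j))) fun θ =>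
        hFanti (measure_mono inter_subset_left)
    refine h1.trans_eq ?_
    have h2 : ∫ θ, F (pointMeasure (fun k => t k θ) (fun k => w k θ) (S j)) ∂P =
        ∫ y, F y ∂(P.map fun θ => pointMeasure (fun k => t k θ) (fun k => w k θ) (S j)) :=
      (integral_map (hm (hS j)).aemeasurable hFm.aestronglyMeasurable).symm
    rw [h2, h.map_eq (hS j) (hSfin j), integral_map .of_discrete hFm.aestronglyMeasurable]
    have h3 := integral_pow_poissonMeasure (ν (S j)).toNNReal (1 / 2 : ℂ)
    have h4 : ∀ n : ℕ, ((1 / 2 : ℂ) ^ n) = ((F n : ℝ) : ℂ) := fun n => by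
      simp [F]
    simp_rw [h4] at h3
    rw [integral_complex_ofReal] at h3
    have h5 : Complex.exp (((ν (S j)).toNNReal : ℝ) * (1 / 2 - 1)) =
        ((Real.exp (-(ν (S j)).toReal / 2) : ℝ) : ℂ) := by
      rw [Complex.ofReal_exp]
      congr 1
      rw [ENNReal.coe_toNNReal_eq_toReal]
      push_cast
      ring
    rw [h5] at h3
    exact_mod_cast h3
  have hc0 : 0 ≤ c := integral_nonneg fun θ => hF0 _
  have hczero : c = 0 := by
    by_contra hne
    have hpos : 0 < c := lt_of_le_of_ne hc0 (Ne.symm hne)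
    have hbound : ∀ j, ν (S j) ≤ ENNReal.ofReal (-2 * Real.log c) := fun j => by
      rw [← ENNReal.ofReal_toReal (hSfin j)]
      refine ENNReal.ofReal_le_ofReal ?_
      have := Real.log_le_log hpos (hle j)
      rw [Real.log_exp] at this
      linarith
    have hmono : Monotone S := fun i j hij =>
      inter_subset_inter_right _ (monotone_spanningSets ν hij)
    have hU : ⋃ j, S j = B := by
      rw [← inter_iUnion, iUnion_spanningSets, inter_univ]
    have hlim := tendsto_measure_iUnion_atTop (μ := ν) hmono
    rw [hU, hν] at hlim
    exact absurd (le_of_tendsto' hlim hbound) (by simp)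
  rw [hc, integral_eq_zero_iff_of_nonneg (fun θ => hF0 _) (hFi (hm hB))] at hczero
  filter_upwards [hczero] with θ hθ
  by_contra hne
  simp [F, hne] at hθ

theorem HasPoissonFunctional.isPRM [SigmaFinite ν] (h : HasPoissonFunctional ν t w P) :
    IsPRM ν (fun θ => pointMeasure (fun k => t k θ) (fun k => w k θ)) P where
  measurable := measurable_pointMeasure h.measurable_jump h.measurable_loc
  poisson _ hB hν := h.map_eq hB hν
  infinite _ hB hν := h.ae_eq_top hB hν
  indep n B hB hdisj := by
    classical
    -- Counts on sets of infinite mean are almost surely the constant `∞`. Replacing these sets by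
    -- `∅` reduces independence to finite means; the constants are put back at the end.
    let B' : Fin n → Set (ℝ × Ω) := fun i => if ν (B i) = ∞ then ∅ else B i
    have hB' : ∀ i, MeasurableSet (B' i) := fun i => by
      simp only [B']; split_ifs
      · exact .empty
      · exact hB i
    have hsub : ∀ i, B' i ⊆ B i := fun i => by
      simp only [B']; split_ifs
      · exact empty_subset _
      · exact subset_rfl
    have hν' : ∀ i, ν (B' i) ≠ ∞ := fun i => by
      simp only [B']; split_ifs with h1
      · simp
      · exact h1
    have hdisj' : Pairwise (Function.onFun Disjoint B') := fun i j hij =>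
      (hdisj hij).mono (hsub i) (hsub j)
    let Y : Fin n → Θ → ℝ := fun i θ =>
      (pointMeasure (fun k => t k θ) (fun k => w k θ) (B' i)).toReal
    have hY : ∀ i, Measurable (Y i) := fun i =>
      ((Measure.measurable_coe (hB' i)).comp
        (measurable_pointMeasure h.measurable_jump h.measurable_loc)).ennreal_toReal
    have hYind : iIndepFun Y P := by
      rw [iIndepFun_iff_charFun_pi fun i => (hY i).aemeasurable]
      intro s
      have hmY : Measurable fun θ => WithLp.toLp 2 fun i => Y i θ := by fun_prop
      have h1 : charFun (P.map fun θ => WithLp.toLp 2 fun i => Y i θ) s =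
          ∫ θ, Complex.exp ((∑ i, s i * Y i θ : ℝ) * Complex.I) ∂P := by
        rw [charFun_apply, integral_map hmY.aemeasurable (by fun_prop)]
        simp [PiLp.inner_apply]
      have h2 : ∀ i, charFun (P.map (Y i)) (s i) =
          Complex.exp ((ν (B' i)).toReal * (Complex.exp (s i * Complex.I) - 1)) := fun i => by
        rw [charFun_apply_real, integral_map (hY i).aemeasurable (by fun_prop)]
        have := h.integral_exp_sum (fun _ : Unit => B' i) (fun _ => hB' i)
          (fun i j hij => absurd (Subsingleton.elim i j) hij) (fun _ => hν' i) (fun _ => s i)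
        simp only [Finset.univ_unique, Finset.sum_singleton, Finset.prod_singleton] at this
        simpa [Y] using this
      rw [h1]
      simp_rw [h2]
      exact h.integral_exp_sum B' hB' hdisj' hν' s
    refine (hYind.comp (fun i y => if ν (B i) = ∞ then ∞ else ENNReal.ofReal y) fun i => ?_).congr
      fun i => ?_
    · split_ifs
      · exact measurable_const
      · exact ENNReal.measurable_ofReal
    · by_cases hi : ν (B i) = ∞
      · filter_upwards [h.ae_eq_top (hB i) hi] with θ hθ
        simp [hi, hθ]
      · filter_upwards [h.finite (B i) (hB i) hi] with θ hθ
        simp only [Function.comp, hi, if_false, Y, B']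
        rw [ENNReal.ofReal_toReal]
        rw [pointMeasure_apply _ _ (hB i)]
        simpa using hθ

end PRMOfFunctional

/-! ### The intensity measure -/

section Intensity

variable {Ω : Type*} [MeasurableSpace Ω] {B₀ : Measure Ω}
  {ρ : ℝ → Ω → ℝ≥0∞}

/-- Since `min(s, 1) > 0` for `s > 0`, the integrability condition forces `ρ < ∞` almost everywhere,
and a finite density preserves σ-finiteness. -/
theorem sigmaFinite_intensity [SigmaFinite B₀] (hm : Measurable (Function.uncurry ρ))
    (hρ : ∀ ω, ∫⁻ s in Ioi (0 : ℝ), ENNReal.ofReal (min s 1) * ρ s ω < ∞) :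
    SigmaFinite (intensity ρ B₀) := by
  refine SigmaFinite.withDensity_of_ne_top ?_
  have hset : MeasurableSet {x : ℝ × Ω | ρ x.1 x.2 ≠ ∞} :=
    hm (measurableSet_singleton ∞).compl
  rw [Measure.ae_prod_iff_ae_ae hset, Measure.ae_ae_comm hset]
  refine ae_of_all _ fun ω => ?_
  have hmω : Measurable fun s => ρ s ω := hm.comp measurable_prodMk_right
  have h1 := ae_lt_top (by fun_prop) (hρ ω).ne
  filter_upwards [h1, ae_restrict_mem measurableSet_Ioi] with s hs hs0 htop
  rw [htop, ENNReal.mul_top] at hs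
  · exact lt_irrefl _ hs
  · have : 0 < min s 1 := lt_min hs0 one_pos
    simpa using this

theorem intensity_prod_singleton [SigmaFinite B₀] [NullSingletonClass B₀] (ω : Ω) :
    intensity ρ B₀ (univ ×ˢ {ω}) = 0 := by
  refine withDensity_absolutelyContinuous _ _ ?_
  rw [Measure.prod_prod, measure_singleton, mul_zero]

theorem intensity_rhoM {E : Type*} [Zero E] [MeasurableSpace E] [MeasurableSingletonClass E]
    (G : Kernel ℝ E) (hm : Measurable (Function.uncurry ρ)) (M : ℕ) :
    intensity (rhoM G ρ M) B₀ =
      (intensity ρ B₀).withDensity fun x => (1 - piA G x.1) ^ M := by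
  have hπ : Measurable fun x : ℝ × Ω => (1 - piA G x.1) ^ M :=
    (measurable_const.sub ((G.measurable_coe (measurableSet_singleton 0).compl).comp
      measurable_fst)).pow_const M
  have hm' : Measurable fun x : ℝ × Ω => ρ x.1 x.2 := hm
  rw [intensity, intensity, ← withDensity_mul _ hm' hπ]
  congr 1
  ext x
  simp [rhoM, mul_comm]

end Intensity

/-! ### Points not chosen by the first `M` customers -/

section Split

/-- The marks of the first `M` customers are independent of the mark of the last one. -/
theorem map_markKernel_init_last {Ω E : Type*} [MeasurableSpace Ω] [MeasurableSpace E]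
    {G : Kernel ℝ E} [IsMarkovKernel G] (M : ℕ) (x : ℝ × Ω) :
    (markKernel Ω (Fin (M + 1)) G x).map
      (fun a => ((fun i : Fin M => a i.castSucc), a (Fin.last M))) =
    (markKernel Ω (Fin M) G x).prod (G x.1) := by
  have h := (measurePreserving_piFinSuccAbove (fun _ : Fin (M + 1) => G x.1) (Fin.last M)).map_eq
  rw [← Measure.prod_swap, markKernel_apply, markKernel_apply, ← h,
    Measure.map_map measurable_swap (MeasurableEquiv.measurable _)]
  congr 1
  ext a
  · simp [MeasurableEquiv.piFinSuccAbove, Fin.init]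
  · simp [MeasurableEquiv.piFinSuccAbove]

variable {Ω E : Type*} [MeasurableSpace Ω] [Zero E] [MeasurableSpace E]
  [MeasurableSingletonClass E] {G : Kernel ℝ E}

theorem measurable_one_sub_piA_pow (M : ℕ) :
    Measurable fun x : ℝ × Ω => (1 - piA G x.1) ^ M :=
  (measurable_const.sub ((G.measurable_coe (measurableSet_singleton 0).compl).comp
    measurable_fst)).pow_const M

variable [IsMarkovKernel G]

theorem kernel_zero_eq (s : ℝ) : G s {0} = 1 - piA G s := by
  rw [piA, prob_compl_eq_one_sub (measurableSet_singleton 0),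
    ENNReal.sub_sub_cancel ENNReal.one_ne_top prob_le_one]

theorem markKernel_init_zero_last (M : ℕ) (x : ℝ × Ω) {s : Set (Unit → E)}
    (hs : MeasurableSet s) :
    markKernel Ω (Fin (M + 1)) G x
      {a | (∀ i : Fin M, a i.castSucc = 0) ∧ (fun _ => a (Fin.last M)) ∈ s} =
    (1 - piA G x.1) ^ M * markKernel Ω Unit G x s := by
  have hc : Measurable fun (e : E) (_ : Unit) => e := measurable_pi_lambda _ fun _ => measurable_id
  have hu : markKernel Ω Unit G x = (G x.1).map fun (e : E) (_ : Unit) => e := by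
    have h := (measurePreserving_funUnique (G x.1) Unit).symm.map_eq
    rw [markKernel_apply, ← h]
    rfl
  have h0 : MeasurableSet ({0} : Set (Fin M → E)) := measurableSet_singleton 0
  have h1 : {a : Fin (M + 1) → E | (∀ i : Fin M, a i.castSucc = 0) ∧
      (fun _ => a (Fin.last M)) ∈ s} =
      (fun a : Fin (M + 1) → E => ((fun i : Fin M => a i.castSucc), a (Fin.last M))) ⁻¹'
        ({0} ×ˢ ((fun (e : E) (_ : Unit) => e) ⁻¹' s)) := by
    ext a
    simp [funext_iff]
  have hpi : ({0} : Set (Fin M → E)) = univ.pi fun _ => {0} := by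
    ext a; simp [funext_iff]
  rw [h1, ← Measure.map_apply (by fun_prop) (h0.prod (hc hs)), map_markKernel_init_last,
    Measure.prod_prod, hu, Measure.map_apply hc hs, hpi, markKernel_apply, Measure.pi_pi]
  simp [kernel_zero_eq]

/-- The points which are not chosen by the first `M` customers, with the mark of the last one. -/
theorem map_restrict_init_zero (M : ℕ) (ν : Measure (ℝ × Ω)) [SFinite ν] :
    ((ν ⊗ₘ markKernel Ω (Fin (M + 1)) G).restrict
      {y | ∀ i : Fin M, y.2 i.castSucc = 0}).map (fun y => (y.1, fun _ : Unit => y.2 (Fin.last M))) =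
    (ν.withDensity fun x => (1 - piA G x.1) ^ M) ⊗ₘ markKernel Ω Unit G := by
  have hf : Measurable fun y : (ℝ × Ω) × (Fin (M + 1) → E) =>
      (y.1, fun _ : Unit => y.2 (Fin.last M)) := by fun_prop
  have hZ : MeasurableSet {y : (ℝ × Ω) × (Fin (M + 1) → E) | ∀ i : Fin M, y.2 i.castSucc = 0} := by
    simp only [ofPred_forall]
    refine MeasurableSet.iInter fun i => ?_
    exact (show Measurable fun y : (ℝ × Ω) × (Fin (M + 1) → E) => y.2 i.castSucc by fun_prop)
      (measurableSet_singleton 0)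
  ext s hs
  rw [Measure.map_apply hf hs, Measure.restrict_apply (hf hs), Measure.compProd_apply ((hf hs).inter hZ),
    Measure.compProd_apply hs, lintegral_withDensity_eq_lintegral_mul _
      (measurable_one_sub_piA_pow M) (Kernel.measurable_kernel_prodMk_left hs)]
  refine lintegral_congr fun x => ?_
  rw [Pi.mul_apply, ← markKernel_init_zero_last M x (measurable_prodMk_left hs)]
  congr 1
  ext a
  simp [and_comm]

end Split

/-- Finiteness and the functional depend only on the law of the sequence of points, so they transfer
from `Θ` to the sequence space on which `IsIBPLaw` is formulated. -/
theorem HasPoissonFunctional.of_map {Θ Θ' Ω : Type*} [MeasurableSpace Θ] [MeasurableSpace Θ']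
    [MeasurableSpace Ω] {P : Measure Θ} {P' : Measure Θ'} {ν : Measure (ℝ × Ω)}
    {t : ℕ → Θ → ℝ} {w : ℕ → Θ → Ω} {t' : ℕ → Θ' → ℝ} {w' : ℕ → Θ' → Ω}
    (h : HasPoissonFunctional ν t w P) (ht' : ∀ k, Measurable (t' k))
    (hw' : ∀ k, Measurable (w' k))
    (heq : P'.map (fun θ k => (t' k θ, w' k θ)) = P.map fun θ k => (t k θ, w k θ)) :
    HasPoissonFunctional ν t' w' P' := by
  have hX : Measurable fun θ => (fun k => (t k θ, w k θ) : ℕ → ℝ × Ω) :=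
    measurable_pi_lambda _ fun k => (h.measurable_jump k).prodMk (h.measurable_loc k)
  have hX' : Measurable fun θ => (fun k => (t' k θ, w' k θ) : ℕ → ℝ × Ω) :=
    measurable_pi_lambda _ fun k => (ht' k).prodMk (hw' k)
  refine ⟨ht', hw', fun B hB hν => ?_, fun ψ hψm hψ hint => ?_⟩
  · have hS : MeasurableSet {x : ℕ → ℝ × Ω | {k | 0 < (x k).1 ∧ x k ∈ B}.Finite} := by
      have hpt := measurable_pointMeasure (Ω := Ω) (t := fun k (x : ℕ → ℝ × Ω) => (x k).1)
        (w := fun k x => (x k).2) (fun k => by fun_prop) (fun k => by fun_prop)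
      have hm := (Measure.measurable_coe hB).comp hpt (measurableSet_singleton ∞).compl
      convert! hm using 1
      ext x
      simp only [mem_preimage, Function.comp, mem_compl_iff, mem_singleton_iff, mem_ofPred_eq]
      rw [pointMeasure_apply _ _ hB]
      simp
    have h1 := h.finite B hB hν
    have h2 : ∀ᵐ x ∂(P.map fun θ => (fun k => (t k θ, w k θ) : ℕ → ℝ × Ω)),
        {k | 0 < (x k).1 ∧ x k ∈ B}.Finite := (ae_map_iff hX.aemeasurable hS).2 h1
    rw [← heq] at h2
    exact (ae_map_iff hX'.aemeasurable hS).1 h2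
  · refine (h.tendsto ψ hψm hψ hint).congr fun n => ?_
    have hF : Measurable fun x : ℕ → ℝ × Ω => ∏ k ∈ Finset.range n, onPos 1 ψ (x k) :=
      Finset.measurable_prod _ fun k _ => (measurable_onPos 1 hψm).comp (measurable_pi_apply k)
    have h1 := integral_map (μ := P) hX.aemeasurable hF.aestronglyMeasurable
    have h2 := integral_map (μ := P') hX'.aemeasurable hF.aestronglyMeasurable
    rw [heq] at h2
    exact h1.symm.trans h2

/-! ### Thinning, and existence of the law IBP(A, ρ_M B₀) -/

section Thinning

variable {Θ Ω E : Type*} [MeasurableSpace Θ] [MeasurableSpace Ω] [Zero E]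
    [MeasurableSpace E] [MeasurableSingletonClass E] {G : Kernel ℝ E}
    {ν : Measure (ℝ × Ω)} {M : ℕ}
    {τ : ℕ → Θ → ℝ} {w : ℕ → Θ → Ω} {A : Fin (M + 1) → ℕ → Θ → E} {P : Measure Θ}

theorem measurableSet_init_zero {Y : Type*} [MeasurableSpace Y] :
    MeasurableSet {y : Y × (Fin (M + 1) → E) | ∀ i : Fin M, y.2 i.castSucc = 0} := by
  simp only [ofPred_forall]
  refine MeasurableSet.iInter fun i => ?_
  exact (show Measurable fun y : Y × (Fin (M + 1) → E) => y.2 i.castSucc by fun_prop)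
    (measurableSet_singleton 0)

/-- The points that are not chosen by the first `M` customers; the others get jump size `0`. -/
def thinnedJump (τ : ℕ → Θ → ℝ) (A : Fin (M + 1) → ℕ → Θ → E) (k : ℕ) (θ : Θ) : ℝ :=
  open Classical in if ∀ i : Fin M, A i.castSucc k θ = 0 then τ k θ else 0

theorem IsIBPModel.measurable_thinnedJump (h : IsIBPModel G ν τ w A P) (k : ℕ) :
    Measurable (thinnedJump τ A k) := by
  refine Measurable.ite ?_ (h.measurable_jump k) measurable_const
  simp only [ofPred_forall]
  exact MeasurableSet.iInter fun i => h.measurable_mark _ _ (measurableSet_singleton 0)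

variable [IsMarkovKernel G] [SFinite ν]

theorem map_fst_restrict_init_zero :
    ((ν ⊗ₘ markKernel Ω (Fin (M + 1)) G).restrict
      {y | ∀ i : Fin M, y.2 i.castSucc = 0}).map Prod.fst =
    ν.withDensity fun x => (1 - piA G x.1) ^ M := by
  have h := congrArg (Measure.map Prod.fst) (map_restrict_init_zero (G := G) M ν)
  rw [Measure.map_map measurable_fst (by fun_prop), ← Measure.fst, Measure.fst_compProd] at h
  exact h

variable [IsProbabilityMeasure P]

theorem IsIBPModel.hasPoissonFunctional_thinned (h : IsIBPModel G ν τ w A P) :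
    HasPoissonFunctional (ν.withDensity fun x => (1 - piA G x.1) ^ M)
      (thinnedJump τ A) w P := by
  classical
  have hZ : MeasurableSet {y : (ℝ × Ω) × (Fin (M + 1) → E) | ∀ i : Fin M, y.2 i.castSucc = 0} :=
    measurableSet_init_zero
  refine ⟨h.measurable_thinnedJump, h.measurable_loc, fun B hB hν => ?_,
    fun ψ hψm hψ hint => ?_⟩
  · rw [← map_fst_restrict_init_zero, Measure.map_apply measurable_fst hB,
      Measure.restrict_apply (measurable_fst hB)] at hν
    filter_upwards [h.ae_finite ((measurable_fst hB).inter hZ) hν] with θ hθ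
    refine hθ.subset ?_
    rintro k ⟨hk, hkB⟩
    simp only [thinnedJump] at hk hkB
    split_ifs at hk hkB with hA
    · exact ⟨hk, hkB, hA⟩
    · exact absurd hk (lt_irrefl _)
  -- A thinned-out point contributes the factor 1. Thus the functional of the thinned points at `ψ`
  -- is the marked functional at `φ`, whose exponent lives on the unchosen points only.
  · let φ : (ℝ × Ω) × (Fin (M + 1) → E) → ℂ :=
      fun y => if ∀ i : Fin M, y.2 i.castSucc = 0 then ψ y.1 else 1
    have hφm : Measurable φ := Measurable.ite hZ (hψm.comp measurable_fst) measurable_const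
    have hφ : ∀ y, ‖φ y‖ ≤ 1 := fun y => by
      simp only [φ]
      split_ifs
      · exact hψ _
      · simp
    have hφ1 : (fun y => φ y - 1) = {y : (ℝ × Ω) × (Fin (M + 1) → E) |
        ∀ i : Fin M, y.2 i.castSucc = 0}.indicator ((fun x => ψ x - 1) ∘ Prod.fst) := by
      ext y
      by_cases hy : ∀ i : Fin M, y.2 i.castSucc = 0 <;> simp [φ, hy, indicator]
    rw [← map_fst_restrict_init_zero] at hint
    have hφint : Integrable (fun y => φ y - 1) (ν ⊗ₘ markKernel Ω (Fin (M + 1)) G) := by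
      rw [hφ1, integrable_indicator_iff hZ]
      exact (integrable_map_measure hint.1 measurable_fst.aemeasurable).1 hint
    have hval : ∫ y, (φ y - 1) ∂(ν ⊗ₘ markKernel Ω (Fin (M + 1)) G) =
        ∫ x, (ψ x - 1) ∂(ν.withDensity fun x => (1 - piA G x.1) ^ M) := by
      rw [← map_fst_restrict_init_zero, integral_map measurable_fst.aemeasurable hint.1, hφ1,
        integral_indicator hZ]
      rfl
    rw [← hval]
    refine (h.tendsto_integral_prod hφm hφ hφint).congr fun n => ?_
    refine integral_congr_ae (ae_of_all _ fun θ => Finset.prod_congr rfl fun k _ => ?_)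
    simp only [onPos, thinnedJump, φ]
    split_ifs <;> first | rfl | (exfalso; linarith)

/-- The generative model with intensity `(1 - π)^M ν` exists. -/
theorem IsIBPModel.exists_isIBPLaw {E : Type*} [NormedAddCommGroup E] [MeasurableSpace E]
    [MeasurableSingletonClass E] {G : Kernel ℝ E} [IsMarkovKernel G]
    {A : Fin (M + 1) → ℕ → Θ → E} (h : IsIBPModel G ν τ w A P)
    [SigmaFinite (ν.withDensity fun x => (1 - piA G x.1) ^ M)] :
    ∃ m : Measure (VectorMeasure Ω E),
      IsIBPLaw G (ν.withDensity fun x => (1 - piA G x.1) ^ M) m := by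
  have hT : Measurable fun θ => (fun k => (thinnedJump τ A k θ, w k θ) : ℕ → ℝ × Ω) :=
    measurable_pi_lambda _ fun k => (h.measurable_thinnedJump k).prodMk (h.measurable_loc k)
  let law : Measure (ℕ → ℝ × Ω) := P.map fun θ k => (thinnedJump τ A k θ, w k θ)
  have hR : IsProbabilityMeasure law := Measure.isProbabilityMeasure_map hT.aemeasurable
  -- The thinned points receive new independent marks; only the law of the points is taken from the
  -- given model.
  let κ : Kernel (ℕ → ℝ × Ω) (ℕ → E) := kernelInfinitePi fun k : ℕ =>
    G.comap (fun x : ℕ → ℝ × Ω => (x k).1) (by fun_prop)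
  have hκ : IsMarkovKernel κ := by simp only [κ]; infer_instance
  let Q : Measure ((ℕ → ℝ × Ω) × (ℕ → E)) := law ⊗ₘ κ
  have hQfst : Q.map Prod.fst = law := by
    rw [← Measure.fst, Measure.fst_compProd]
  have hPF : HasPoissonFunctional (ν.withDensity fun x => (1 - piA G x.1) ^ M)
      (fun k (x : (ℕ → ℝ × Ω) × (ℕ → E)) => (x.1 k).1) (fun k x => (x.1 k).2) Q :=
    h.hasPoissonFunctional_thinned.of_map (fun k => by fun_prop) (fun k => by fun_prop) hQfst
  refine ⟨_, Q, inferInstance, ⟨hPF.measurable_jump, hPF.measurable_loc, fun _ k => by fun_prop,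
    ?_, hPF.isPRM, fun C n B hC hB => ?_⟩, rfl⟩
  · have hS : MeasurableSet {x : ℕ → ℝ × Ω | ∀ k, 0 ≤ (x k).1} := by
      simp only [ofPred_forall]
      exact MeasurableSet.iInter fun k => measurableSet_le measurable_const (by fun_prop)
    have h1 : ∀ᵐ x ∂law, ∀ k, 0 ≤ (x k).1 := by
      refine (ae_map_iff hT.aemeasurable hS).2 ?_
      filter_upwards [h.jump_nonneg] with θ hθ k
      simp only [thinnedJump]
      split_ifs
      · exact hθ k
      · exact le_rfl
    rw [← hQfst] at h1
    exact (ae_map_iff measurable_fst.aemeasurable hS).1 h1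
  · have hBs : MeasurableSet (((Finset.range n : Finset ℕ) : Set ℕ).pi (B ())) :=
      MeasurableSet.pi (Finset.countable_toSet _) fun k _ => hB () k
    have hset : {x : (ℕ → ℝ × Ω) × (ℕ → E) | (fun k => ((x.1 k).1, (x.1 k).2)) ∈ C ∧
        ∀ i : Unit, ∀ k < n, x.2 k ∈ B i k} =
        C ×ˢ (((Finset.range n : Finset ℕ) : Set ℕ).pi (B ())) := by
      ext x
      simp only [mem_ofPred_eq, mem_prod, Set.mem_pi, Finset.coe_range, mem_Iio]
      exact and_congr_right fun _ => ⟨fun h => h (), fun h _ => h⟩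
    have hκm : Measurable fun x : ℕ → ℝ × Ω => ∏ i : Unit, ∏ k ∈ Finset.range n,
        G (x k).1 (B i k) :=
      Finset.measurable_prod _ fun i _ => Finset.measurable_prod _ fun k _ =>
        (G.measurable_coe (hB i k)).comp (by fun_prop)
    have hR' : ∫⁻ x in C, (∏ i : Unit, ∏ k ∈ Finset.range n, G (x k).1 (B i k)) ∂law =
        ∫⁻ x in Prod.fst ⁻¹' C, (∏ i : Unit, ∏ k ∈ Finset.range n, G (x.1 k).1 (B i k)) ∂Q := by
      rw [← hQfst, setLIntegral_map hC hκm measurable_fst]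
    rw [hset, Measure.compProd_apply_prod hC hBs]
    refine Eq.trans ?_ hR'
    refine lintegral_congr fun x => ?_
    simp only [κ, kernelInfinitePi, Kernel.coe_mk]
    rw [Measure.infinitePi_pi _ fun k _ => hB () k]
    simp

end Thinning

theorem lintegral_fin_prod {E : Type*} [MeasurableSpace E] (μ : Measure E) [SigmaFinite μ] :
    ∀ {n : ℕ} (f : Fin n → E → ℝ≥0∞), (∀ i, Measurable (f i)) →
    ∫⁻ a : Fin n → E, ∏ i, f i (a i) ∂(Measure.pi fun _ => μ) = ∏ i, ∫⁻ x, f i x ∂μ := by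
  intro n
  induction n with
  | zero =>
    intro f _
    simp
  | succ n ih =>
    intro f hf
    have h := (measurePreserving_piFinSuccAbove (fun _ : Fin (n + 1) => μ) 0)
    rw [← h.symm.lintegral_comp_emb (MeasurableEquiv.measurableEmbedding _)]
    simp_rw [MeasurableEquiv.piFinSuccAbove_symm_apply, Fin.insertNthEquiv, Fin.prod_univ_succ,
      Fin.insertNth_zero]
    simp only [Equiv.coe_fn_mk, Fin.cons_zero, Fin.cons_succ, cast_eq]
    rw [lintegral_prod_mul (f := f 0) (g := fun a : Fin n → E => ∏ i, f i.succ (a i))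
      (hf 0).aemeasurable (Finset.measurable_prod _ fun i _ =>
        (hf _).comp (measurable_pi_apply i)).aemeasurable, ih _ fun i => hf _]

theorem pi_withDensity {E : Type*} [MeasurableSpace E] (μ : Measure E) [SigmaFinite μ] {n : ℕ}
    (r : Fin n → E → ℝ≥0∞) (hr : ∀ i, Measurable (r i)) [∀ i, SigmaFinite (μ.withDensity (r i))] :
    (Measure.pi fun i => μ.withDensity (r i)) =
      (Measure.pi fun _ : Fin n => μ).withDensity fun a => ∏ i, r i (a i) := by
  refine (Measure.pi_eq fun s hs => ?_)
  rw [withDensity_apply _ (MeasurableSet.univ_pi hs), ← lintegral_indicator (MeasurableSet.univ_pi hs)]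
  have h1 : ∀ a : Fin n → E, (univ.pi s).indicator (fun a => ∏ i, r i (a i)) a =
      ∏ i, (s i).indicator (r i) (a i) := fun a => by
    by_cases ha : a ∈ univ.pi s
    · rw [indicator_of_mem ha]
      exact Finset.prod_congr rfl fun i _ => (indicator_of_mem (ha i (mem_univ i)) _).symm
    · rw [indicator_of_notMem ha]
      simp only [Set.mem_pi, mem_univ, true_imp_iff, not_forall] at ha
      obtain ⟨i, hi⟩ := ha
      exact (Finset.prod_eq_zero (Finset.mem_univ i) (indicator_of_notMem hi _)).symm
  simp_rw [h1]
  rw [lintegral_fin_prod μ _ fun i => (hr i).indicator (hs i)]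
  refine Finset.prod_congr rfl fun i _ => ?_
  rw [withDensity_apply _ (hs i), lintegral_indicator (hs i)]

/-! ### The intensity of chosen features and its disintegration -/

section Feature

variable {Ω E : Type*} [MeasurableSpace Ω] [Zero E] [MeasurableSpace E]

/-- The intensity of the features `ω` chosen by one of `M` customers, with their scores `a` and
their jumps `s`. -/
def featureMeasure (G : Kernel ℝ E) [IsMarkovKernel G] (ν : Measure (ℝ × Ω)) (M : ℕ) :
    Measure ((Ω × (Fin M → E)) × ℝ) :=
  ((ν ⊗ₘ markKernel Ω (Fin M) G).restrict {y | y.2 ≠ 0}).map fun y => ((y.1.2, y.2), y.1.1)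

variable [MeasurableSingletonClass E] {G : Kernel ℝ E} [IsMarkovKernel G]
  {ν : Measure (ℝ × Ω)} [SFinite ν] {M : ℕ}

theorem measurableSet_snd_ne_zero {Y : Type*} [MeasurableSpace Y] {ι : Type*} [Countable ι] :
    MeasurableSet {y : Y × (ι → E) | y.2 ≠ 0} :=
  measurable_snd (measurableSet_singleton 0).compl

theorem featureMeasure_apply {S : Set ((Ω × (Fin M → E)) × ℝ)} (hS : MeasurableSet S) :
    featureMeasure G ν M S =
      ∫⁻ x, Measure.pi (fun _ : Fin M => G x.1) {a | a ≠ 0 ∧ ((x.2, a), x.1) ∈ S} ∂ν := by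
  have hf : Measurable fun y : (ℝ × Ω) × (Fin M → E) => ((y.1.2, y.2), y.1.1) := by fun_prop
  rw [featureMeasure, Measure.map_apply hf hS, Measure.restrict_apply (hf hS),
    Measure.compProd_apply ((hf hS).inter measurableSet_snd_ne_zero)]
  refine lintegral_congr fun x => ?_
  rw [markKernel_apply]
  congr 1
  ext a
  simp [and_comm]

/-- A union bound over the customers. With `hfin` it makes the expected number of chosen features
finite. -/
theorem markKernel_ne_zero_le {ι : Type*} [Fintype ι] (x : ℝ × Ω) :
    markKernel Ω ι G x {a | a ≠ 0} ≤ Fintype.card ι * piA G x.1 := by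
  have h1 : {a : ι → E | a ≠ 0} ⊆ ⋃ i, Function.eval i ⁻¹' {0}ᶜ := fun a ha => by
    obtain ⟨i, hi⟩ := Function.ne_iff.1 ha
    exact mem_iUnion.2 ⟨i, hi⟩
  refine (measure_mono h1).trans ((measure_iUnion_fintype_le _ _).trans ?_)
  rw [markKernel_apply]
  have h2 : ∀ i : ι, (Measure.pi fun _ : ι => G x.1) (Function.eval i ⁻¹' {0}ᶜ) = piA G x.1 :=
    fun i => (measurePreserving_eval (fun _ : ι => G x.1) i).measure_preimage
      (measurableSet_singleton 0).compl.nullMeasurableSet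
  rw [Finset.sum_congr rfl fun i _ => h2 i]
  simp

theorem compProd_ne_zero_lt_top {ι : Type*} [Fintype ι] (hfin : ∫⁻ x, piA G x.1 ∂ν < ∞) :
    (ν ⊗ₘ markKernel Ω ι G) {y | y.2 ≠ 0} < ∞ := by
  rw [Measure.compProd_apply measurableSet_snd_ne_zero]
  refine (lintegral_mono fun x => markKernel_ne_zero_le x).trans_lt ?_
  rw [lintegral_const_mul' _ _ (ENNReal.natCast_ne_top _)]
  exact ENNReal.mul_lt_top (ENNReal.natCast_lt_top _) hfin

theorem isFiniteMeasure_featureMeasure (hfin : ∫⁻ x, piA G x.1 ∂ν < ∞) :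
    IsFiniteMeasure (featureMeasure G ν M) := by
  have : IsFiniteMeasure ((ν ⊗ₘ markKernel Ω (Fin M) G).restrict {y | y.2 ≠ 0}) :=
    ⟨by simpa using compProd_ne_zero_lt_top hfin⟩
  unfold featureMeasure
  infer_instance

/-- The posterior jump laws are the disintegrations of `featureMeasure`. -/
theorem isPosteriorJumpLaw_iff (hfin : ∫⁻ x, piA G x.1 ∂ν < ∞)
    (P : Kernel (Ω × (Fin M → E)) ℝ) [hP : IsMarkovKernel P] :
    IsPosteriorJumpLaw G ν P ↔
      featureMeasure G ν M = (featureMeasure G ν M).fst ⊗ₘ P := by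
  have hfm := isFiniteMeasure_featureMeasure (M := M) hfin
  have h1 : ∀ (D : Set (Ω × (Fin M → E))) (T : Set ℝ), MeasurableSet D → MeasurableSet T →
      ∫⁻ x, T.indicator (fun _ => Measure.pi (fun _ : Fin M => G x.1)
        {a | a ≠ 0 ∧ (x.2, a) ∈ D}) x.1 ∂ν = featureMeasure G ν M (D ×ˢ T) := by
    intro D T hD hT
    rw [featureMeasure_apply (hD.prod hT)]
    refine lintegral_congr fun x => ?_
    by_cases hx : x.1 ∈ T <;> simp [hx]
  have h2 : ∀ (D : Set (Ω × (Fin M → E))) (T : Set ℝ), MeasurableSet D → MeasurableSet T →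
      ∫⁻ x, ∫⁻ a in {a | a ≠ 0 ∧ (x.2, a) ∈ D}, P (x.2, a) T
        ∂(Measure.pi (fun _ : Fin M => G x.1)) ∂ν =
      ((featureMeasure G ν M).fst ⊗ₘ P) (D ×ˢ T) := by
    intro D T hD hT
    have hPT : Measurable fun y => P y T := P.measurable_coe hT
    have hf : Measurable fun y : (ℝ × Ω) × (Fin M → E) => (y.1.2, y.2) := by fun_prop
    have hPT' : Measurable fun y : (ℝ × Ω) × (Fin M → E) => P (y.1.2, y.2) T := hPT.comp hf
    have hfst : (featureMeasure G ν M).fst =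
        ((ν ⊗ₘ markKernel Ω (Fin M) G).restrict {y | y.2 ≠ 0}).map fun y => (y.1.2, y.2) := by
      rw [featureMeasure, Measure.fst, Measure.map_map measurable_fst (by fun_prop)]
      rfl
    rw [Measure.compProd_apply_prod hD hT, hfst, setLIntegral_map hD hPT hf,
      Measure.restrict_restrict (hf hD), ← lintegral_indicator
        ((hf hD).inter measurableSet_snd_ne_zero), Measure.lintegral_compProd
        (hPT'.indicator ((hf hD).inter measurableSet_snd_ne_zero))]
    refine lintegral_congr fun x => ?_
    have hm : MeasurableSet {a : Fin M → E | a ≠ 0 ∧ (x.2, a) ∈ D} :=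
      (measurableSet_singleton 0).compl.inter (measurable_prodMk_left hD)
    rw [← lintegral_indicator hm, markKernel_apply]
    refine lintegral_congr fun a => ?_
    by_cases ha : a = 0 <;> by_cases haD : (x.2, a) ∈ D <;> simp [indicator, ha, haD]
  constructor
  · rintro ⟨_, h⟩
    exact Measure.ext_prod fun {D T} hD hT => by rw [← h1 D T hD hT, ← h2 D T hD hT, h D T hD hT]
  · exact fun h => ⟨hP, fun D T hD hT => by rw [h1 D T hD hT, h2 D T hD hT, ← h]⟩

/-- A finite measure whose second factor is `ℝ`, a standard Borel space, has a conditional kernel.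
-/
theorem exists_isPosteriorJumpLaw (hfin : ∫⁻ x, piA G x.1 ∂ν < ∞) :
    ∃ P : Kernel (Ω × (Fin M → E)) ℝ, IsPosteriorJumpLaw G ν P := by
  have hfm := isFiniteMeasure_featureMeasure (M := M) hfin
  exact ⟨(featureMeasure G ν M).condKernel, (isPosteriorJumpLaw_iff hfin _).2
    ((featureMeasure G ν M).disintegrate _).symm⟩

end Feature

/-! ### The jump law when the scores have a density -/

section Density

variable {Ω E : Type*} [MeasurableSpace Ω] [Zero E] [MeasurableSpace E]
  [MeasurableSingletonClass E] {G : Kernel ℝ E} [IsMarkovKernel G] {M : ℕ}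
  {ρ : ℝ → Ω → ℝ≥0∞} {B₀ : Measure Ω} [SFinite B₀] {lam : Measure E} [SigmaFinite lam]
  {g : E → ℝ → ℝ≥0∞}

theorem measurable_hFun (hg : Measurable (Function.uncurry g)) :
    Measurable fun z : E × ℝ => hFun G g z.1 z.2 := by
  have hπ : Measurable fun s : ℝ => 1 - piA G s :=
    measurable_const.sub (G.measurable_coe (measurableSet_singleton 0).compl)
  unfold hFun
  exact Measurable.ite (measurable_fst (measurableSet_singleton 0)) measurable_const
    (hg.div (hπ.comp measurable_snd))

theorem measurable_jumpDensity (hρ : Measurable (Function.uncurry ρ))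
    (hg : Measurable (Function.uncurry g)) :
    Measurable fun y : (Ω × (Fin M → E)) × ℝ => jumpDensity G ρ g y.1.1 y.1.2 y.2 := by
  have hπ : Measurable fun s : ℝ => 1 - piA G s :=
    measurable_const.sub (G.measurable_coe (measurableSet_singleton 0).compl)
  unfold jumpDensity
  refine Measurable.mul (Measurable.mul ((hπ.comp measurable_snd).pow_const M) ?_)
    (Finset.measurable_prod _ fun i _ => ?_)
  · exact hρ.comp (measurable_snd.prodMk (measurable_fst.comp measurable_fst))
  · exact (measurable_hFun hg).comp (f := fun y : (Ω × (Fin M → E)) × ℝ => (y.1.2 i, y.2)) (by fun_prop)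

/-- The law of the scores of `M` customers has the density `(1 - π)^M ∏ hᵢ` with respect to a
product measure. -/
theorem pi_eq_withDensity (hg : Measurable (Function.uncurry g)) {s : ℝ} (h0 : G s {0} ≠ 0)
    (hd : (G s).restrict {0}ᶜ = (lam.restrict {0}ᶜ).withDensity fun a => g a s) :
    (Measure.pi fun _ : Fin M => G s) =
      (Measure.pi fun _ : Fin M => Measure.dirac 0 + lam.restrict {0}ᶜ).withDensity
        fun a => (1 - piA G s) ^ M * ∏ i, hFun G g (a i) s := by
  classical
  rw [kernel_zero_eq] at h0
  set c := 1 - piA G s with hc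
  have hctop : c ≠ ∞ := ne_top_of_le_ne_top ENNReal.one_ne_top tsub_le_self
  -- With respect to `δ₀` plus `lam` off 0, the law `G s` has density `r`: its mass `c` at zero, and
  -- `g` elsewhere. Then `r = c h`, where `c ≠ 0` is needed to cancel the division in `hFun`.
  let r : E → ℝ≥0∞ := fun a => if a = 0 then c else g a s
  have hgs : Measurable fun a => g a s := hg.comp measurable_prodMk_right
  have hr : Measurable r := Measurable.ite (measurableSet_singleton 0) measurable_const hgs
  have hG : G s = (Measure.dirac 0 + lam.restrict {0}ᶜ).withDensity r := by
    have h1 : (lam.restrict {0}ᶜ).withDensity r = (G s).restrict {0}ᶜ := by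
      rw [hd]
      refine withDensity_congr_ae ?_
      filter_upwards [ae_restrict_mem (measurableSet_singleton (0 : E)).compl] with a ha
      simp only [r]
      exact if_neg ha
    have h2 : (Measure.dirac (0 : E)).withDensity r = (G s).restrict {0} := by
      rw [withDensity_congr_ae (g := fun _ => c), withDensity_const,
        Measure.restrict_singleton, kernel_zero_eq]
      rw [ae_dirac_eq]
      exact if_pos rfl
    rw [withDensity_add_measure, h1, h2]
    exact (Measure.restrict_add_restrict_compl (measurableSet_singleton 0)).symm
  have hsf : SigmaFinite ((Measure.dirac 0 + lam.restrict {0}ᶜ).withDensity r) := by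
    rw [← hG]; infer_instance
  conv_lhs => rw [hG]
  rw [pi_withDensity _ (fun _ => r) fun _ => hr]
  congr 1
  ext a
  have h3 : ∀ i, r (a i) = c * hFun G g (a i) s := fun i => by
    by_cases hi : a i = 0
    · simp [r, hFun, hi]
    · simp only [r, hFun, hi, if_false]
      rw [← hc, ENNReal.mul_div_cancel h0 hctop]
  simp_rw [h3]
  rw [Finset.prod_mul_distrib, Finset.prod_const, Finset.card_univ, Fintype.card_fin]

theorem featureMeasure_eq_withDensity (hρ : Measurable (Function.uncurry ρ))
    (hg : Measurable (Function.uncurry g)) [SFinite (intensity ρ B₀)]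
    (h0 : ∀ᵐ x ∂(intensity ρ B₀), G x.1 {0} ≠ 0)
    (hd : ∀ᵐ x ∂(intensity ρ B₀),
      (G x.1).restrict {0}ᶜ = (lam.restrict {0}ᶜ).withDensity (fun a => g a x.1)) :
    featureMeasure G (intensity ρ B₀) M =
      (((B₀.prod (Measure.pi fun _ : Fin M => Measure.dirac 0 + lam.restrict {0}ᶜ)).restrict
        {y | y.2 ≠ 0}).prod ((volume : Measure ℝ).restrict (Ioi 0))).withDensity
        fun y => jumpDensity G ρ g y.1.1 y.1.2 y.2 := by
  set lam₀ : Measure E := Measure.dirac 0 + lam.restrict {0}ᶜ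
  set v : Measure ℝ := (volume : Measure ℝ).restrict (Ioi 0)
  have hJ := measurable_jumpDensity (G := G) (M := M) hρ hg
  ext S hS
  let F : (Ω × (Fin M → E)) × ℝ → ℝ≥0∞ := fun y =>
    {y : Ω × (Fin M → E) | y.2 ≠ 0}.indicator 1 y.1 *
      S.indicator (fun y => jumpDensity G ρ g y.1.1 y.1.2 y.2) y
  have hF : Measurable F := Measurable.mul
    ((measurable_one.indicator measurableSet_snd_ne_zero).comp measurable_fst) (hJ.indicator hS)
  have hρ' : Measurable fun x : ℝ × Ω => ρ x.1 x.2 := hρ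
  -- The hypotheses hold almost everywhere for the intensity, hence for the base measure only where
  -- `ρ ≠ 0`. Where `ρ = 0` both sides vanish.
  have key : ∀ᵐ x ∂(v.prod B₀), ρ x.1 x.2 *
      Measure.pi (fun _ : Fin M => G x.1) {a | a ≠ 0 ∧ ((x.2, a), x.1) ∈ S} =
      ∫⁻ a, F ((x.2, a), x.1) ∂(Measure.pi fun _ : Fin M => lam₀) := by
    have h := (ae_withDensity_iff hρ').1 (h0.and hd)
    filter_upwards [h] with x hx
    by_cases hρ0 : ρ x.1 x.2 = 0
    · have hz : ∀ a, F ((x.2, a), x.1) = 0 := fun a => by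
        refine mul_eq_zero_of_right _ ?_
        by_cases ha : ((x.2, a), x.1) ∈ S <;> simp [indicator, ha, jumpDensity, hρ0]
      simp [hz, hρ0]
    · obtain ⟨hx0, hxd⟩ := hx hρ0
      have hm : MeasurableSet {a : Fin M → E | a ≠ 0 ∧ ((x.2, a), x.1) ∈ S} :=
        (measurableSet_singleton 0).compl.inter
          ((show Measurable fun a : Fin M → E => ((x.2, a), x.1) by fun_prop) hS)
      have hh : Measurable fun a : Fin M → E => (1 - piA G x.1) ^ M * ∏ i, hFun G g (a i) x.1 :=
        measurable_const.mul (Finset.measurable_prod _ fun i _ => (measurable_hFun hg).comp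
          (f := fun a : Fin M → E => (a i, x.1)) (by fun_prop))
      rw [pi_eq_withDensity hg hx0 hxd, withDensity_apply _ hm, ← lintegral_const_mul _ hh,
        ← lintegral_indicator hm]
      refine lintegral_congr fun a => ?_
      by_cases ha : a = 0 <;> by_cases haS : ((x.2, a), x.1) ∈ S <;>
        simp [F, indicator, ha, haS, jumpDensity]
      ring
  have hm : MeasurableSet {y : (ℝ × Ω) × (Fin M → E) | y.2 ≠ 0 ∧ ((y.1.2, y.2), y.1.1) ∈ S} :=
    measurableSet_snd_ne_zero.inter ((show Measurable fun y : (ℝ × Ω) × (Fin M → E) =>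
      ((y.1.2, y.2), y.1.1) by fun_prop) hS)
  have hmeas : Measurable fun x : ℝ × Ω =>
      Measure.pi (fun _ : Fin M => G x.1) {a | a ≠ 0 ∧ ((x.2, a), x.1) ∈ S} :=
    Kernel.measurable_kernel_prodMk_left (κ := markKernel Ω (Fin M) G) hm
  rw [featureMeasure_apply hS, withDensity_apply _ hS, intensity,
    lintegral_withDensity_eq_lintegral_mul _ hρ' hmeas]
  simp only [Pi.mul_apply]
  rw [lintegral_congr_ae key, lintegral_prod_symm, ← lintegral_indicator hS, lintegral_prod,
    ← lintegral_indicator measurableSet_snd_ne_zero, lintegral_prod]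
  · refine lintegral_congr fun ω => ?_
    rw [lintegral_lintegral_swap]
    · refine lintegral_congr fun a => ?_
      by_cases ha : a = 0 <;> simp [F, ha]
    · exact (hF.comp (f := fun z : ℝ × (Fin M → E) => ((ω, z.2), z.1)) (by fun_prop)).aemeasurable
  · exact ((hJ.indicator hS).lintegral_prod_right'.indicator
      measurableSet_snd_ne_zero).aemeasurable
  · exact (hJ.indicator hS).aemeasurable
  · exact (Measurable.lintegral_prod_right' (f := fun z : (ℝ × Ω) × (Fin M → E) =>
      F ((z.1.2, z.2), z.1.1)) (hF.comp (by fun_prop))).aemeasurable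

/-- The normalised sections of a joint density disintegrate the measure, and disintegrations of a
finite measure are almost everywhere unique. -/
theorem ae_eq_normalized_withDensity {X : Type*} [MeasurableSpace X] {μ : Measure (X × ℝ)}
    [IsFiniteMeasure μ] {Q : Measure X} [SFinite Q] {v : Measure ℝ} [SFinite v]
    {J : X → ℝ → ℝ≥0∞} (hJ : Measurable (Function.uncurry J))
    (hμ : μ = (Q.prod v).withDensity (Function.uncurry J)) (P : Kernel X ℝ) [IsFiniteKernel P]
    (hP : μ = μ.fst ⊗ₘ P) :
    ∀ᵐ y ∂μ.fst, P y = (∫⁻ s, J y s ∂v)⁻¹ • v.withDensity (J y) := by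
  have hJy : ∀ y, Measurable (J y) := fun y => hJ.comp measurable_prodMk_left
  let c : X → ℝ≥0∞ := fun y => ∫⁻ s, J y s ∂v
  have hc : Measurable c := hJ.lintegral_prod_right'
  have hT : ∀ {T : Set ℝ}, MeasurableSet T → Measurable fun y => ∫⁻ s in T, J y s ∂v :=
    fun {T} hT => hJ.lintegral_prod_right' (ν := v.restrict T)
  let κ : Kernel X ℝ :=
    { toFun := fun y => (c y)⁻¹ • v.withDensity (J y)
      measurable' := by
        refine Measure.measurable_of_measurable_coe _ fun T hTm => ?_
        simp only [Measure.smul_apply, smul_eq_mul, withDensity_apply _ hTm]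
        exact hc.inv.mul (hT hTm) }
  have hκ : ∀ y {T : Set ℝ}, MeasurableSet T → κ y T = (c y)⁻¹ * ∫⁻ s in T, J y s ∂v :=
    fun y T hTm => by
      change ((c y)⁻¹ • v.withDensity (J y)) T = _
      rw [Measure.smul_apply, smul_eq_mul, withDensity_apply _ hTm]
  -- The bound `c⁻¹ * c ≤ 1` also holds in `ℝ≥0∞` for `c = 0` and `c = ∞`, so no exceptional set has
  -- to be removed.
  have hκf : IsFiniteKernel κ := ⟨⟨1, ENNReal.one_lt_top, fun y => by
    rw [hκ y MeasurableSet.univ, setLIntegral_univ]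
    exact ENNReal.inv_mul_le_one _⟩⟩
  have hrect : ∀ {D : Set X} {T : Set ℝ}, MeasurableSet D → MeasurableSet T →
      μ (D ×ˢ T) = ∫⁻ y in D, ∫⁻ s in T, J y s ∂v ∂Q := fun {D T} hD hTm => by
    rw [hμ, withDensity_apply _ (hD.prod hTm), ← Measure.prod_restrict,
      lintegral_prod _ hJ.aemeasurable]
    rfl
  have hfst : μ.fst = Q.withDensity c := by
    ext D hD
    rw [Measure.fst_apply hD, withDensity_apply _ hD, ← prod_univ, hrect hD MeasurableSet.univ]
    simp only [setLIntegral_univ, c]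
  have hcfin : ∀ᵐ y ∂Q, c y ≠ ∞ := by
    have h := hrect MeasurableSet.univ MeasurableSet.univ
    simp only [setLIntegral_univ] at h
    filter_upwards [ae_lt_top hc (by rw [← h]; exact measure_ne_top _ _)] with y hy using hy.ne
  have hκμ : μ = μ.fst ⊗ₘ κ := by
    refine Measure.ext_prod fun {D T} hD hTm => ?_
    rw [Measure.compProd_apply_prod hD hTm, hrect hD hTm, hfst,
      setLIntegral_withDensity_eq_setLIntegral_mul _ hc (κ.measurable_coe hTm) hD]
    refine lintegral_congr_ae (ae_restrict_of_ae ?_)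
    filter_upwards [hcfin] with y hy
    rw [Pi.mul_apply, hκ y hTm, ← mul_assoc]
    by_cases h0 : c y = 0
    · have : ∫⁻ s in T, J y s ∂v = 0 :=
        le_antisymm ((setLIntegral_le_lintegral T _).trans h0.le) zero_le
      rw [this, mul_zero]
    · rw [ENNReal.mul_inv_cancel h0 hy, one_mul]
  filter_upwards [eq_condKernel_of_measure_eq_compProd P hP,
    eq_condKernel_of_measure_eq_compProd κ hκμ] with y h1 h2
  rw [h1, ← h2]
  rfl

theorem IsPosteriorJumpLaw.ae_eq_jumpDensityLaw {P : Kernel (Ω × (Fin M → E)) ℝ}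
    (hρ : Measurable (Function.uncurry ρ)) (hg : Measurable (Function.uncurry g))
    [SFinite (intensity ρ B₀)] (hfin : ∫⁻ x, piA G x.1 ∂(intensity ρ B₀) < ∞)
    (hP : IsPosteriorJumpLaw G (intensity ρ B₀) P)
    (h0 : ∀ᵐ x ∂(intensity ρ B₀), G x.1 {0} ≠ 0)
    (hd : ∀ᵐ x ∂(intensity ρ B₀),
      (G x.1).restrict {0}ᶜ = (lam.restrict {0}ᶜ).withDensity (fun a => g a x.1)) :
    ∀ᵐ y ∂(featureMeasure G (intensity ρ B₀) M).fst, P y = jumpDensityLaw G ρ g y.1 y.2 := by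
  have hm := hP.1
  have hfm := isFiniteMeasure_featureMeasure (M := M) hfin
  have hJ : Measurable (Function.uncurry fun (y : Ω × (Fin M → E)) s =>
    jumpDensity G ρ g y.1 y.2 s) := measurable_jumpDensity hρ hg
  exact ae_eq_normalized_withDensity hJ (featureMeasure_eq_withDensity hρ hg h0 hd) P
    ((isPosteriorJumpLaw_iff hfin P).1 hP)

end Density

/-- A family of Markov kernels on the ranges of disjoint measurable embeddings extends to a Markov
kernel. -/
theorem exists_kernel_extend {Z W : Type*} [MeasurableSpace Z] [MeasurableSpace W]
    {Y : ℕ → Type*} [∀ n, MeasurableSpace (Y n)] {Ψ : ∀ n, Y n → Z}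
    (hΨ : ∀ n, MeasurableEmbedding (Ψ n))
    (hd : ∀ i j, i ≠ j → Disjoint (range (Ψ i)) (range (Ψ j)))
    (K : ∀ n, Kernel (Y n) W) [∀ n, IsMarkovKernel (K n)] (m : Measure W)
    [IsProbabilityMeasure m] :
    ∃ κ : Kernel Z W, IsMarkovKernel κ ∧ ∀ n y, κ (Ψ n y) = K n y := by
  let t : Option ℕ → Set Z := fun o => o.elim (⋃ n, range (Ψ n))ᶜ fun n => range (Ψ n)
  let f : Option ℕ → Z → Measure W := fun o =>
    o.elim (fun _ => m) fun n => Function.extend (Ψ n) (K n) fun _ => m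
  have ht : ∀ o, MeasurableSet (t o) := by
    rintro (_ | n)
    · exact (MeasurableSet.iUnion fun n => (hΨ n).measurableSet_range).compl
    · exact (hΨ n).measurableSet_range
  have hf : ∀ o, Measurable (f o) := by
    rintro (_ | n)
    · exact measurable_const
    · exact (hΨ n).measurable_extend (K n).measurable measurable_const
  have hdis : Pairwise fun i j => Disjoint (t i) (t j) := by
    rintro (_ | i) (_ | j) hij
    · exact absurd rfl hij
    · exact disjoint_compl_left_iff_subset.2 (subset_iUnion (fun n => range (Ψ n)) j)
    · exact disjoint_compl_right_iff_subset.2 (subset_iUnion (fun n => range (Ψ n)) i)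
    · exact hd i j fun h => hij (h ▸ rfl)
  obtain ⟨k, hk, hkf⟩ := exists_measurable_piecewise t ht f hf fun i j hij x hx =>
    absurd hx.2 ((hdis hij).notMem_of_mem_left hx.1)
  have hval : ∀ n y, k (Ψ n y) = K n y := fun n y => by
    rw [hkf (some n) (mem_range_self y)]
    exact (hΨ n).injective.extend_apply (K n) (fun _ => m) y
  refine ⟨⟨k, hk⟩, ⟨fun z => ?_⟩, hval⟩
  change IsProbabilityMeasure (k z)
  by_cases hz : z ∈ ⋃ n, range (Ψ n)
  · obtain ⟨n, y, rfl⟩ := mem_iUnion.1 hz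
    rw [hval]
    infer_instance
  · rw [hkf none hz]
    exact ‹IsProbabilityMeasure m›

/-! ### Encoding the first `M` customers by sorted lists of features -/

section Config

variable {Ω E : Type*} [MeasurableSpace Ω] [NormedAddCommGroup E] {M n : ℕ}

/-- The measures of `M` customers who give the scores `(y ℓ).2` to the features `(y ℓ).1`. -/
def configCustomers (y : Fin n → Ω × (Fin M → E)) (i : Fin M) : VectorMeasure Ω E :=
  ∑ l, VectorMeasure.dirac (y l).1 ((y l).2 i)

variable [MeasurableSingletonClass Ω]

theorem configCustomers_singleton {y : Fin n → Ω × (Fin M → E)}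
    (hy : Function.Injective fun l => (y l).1) (l : Fin n) (i : Fin M) :
    configCustomers y i {(y l).1} = (y l).2 i := by
  classical
  rw [configCustomers, FunLike.coe_sum, Finset.sum_apply, Finset.sum_eq_single l]
  · rw [dirac_apply_eq _ _ (measurableSet_singleton _), if_pos (mem_singleton _)]
  · intro l' _ hl
    rw [dirac_apply_eq _ _ (measurableSet_singleton _), if_neg]
    exact fun h => hl (hy h)
  · exact fun h => absurd (Finset.mem_univ l) h

theorem configCustomers_singleton_of_notMem {y : Fin n → Ω × (Fin M → E)} {ω : Ω}
    (hω : ω ∉ range fun l => (y l).1) (i : Fin M) : configCustomers y i {ω} = 0 := by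
  classical
  rw [configCustomers, FunLike.coe_sum, Finset.sum_apply]
  refine Finset.sum_eq_zero fun l _ => ?_
  rw [dirac_apply_eq _ _ (measurableSet_singleton _), if_neg]
  exact fun h => hω ⟨l, h⟩

theorem scores_configCustomers {y : Fin n → Ω × (Fin M → E)}
    (hy : Function.Injective fun l => (y l).1) (l : Fin n) :
    scores (configCustomers y) (y l).1 = (y l).2 :=
  funext fun i => configCustomers_singleton hy l i

theorem featureSet_configCustomers {y : Fin n → Ω × (Fin M → E)}
    (hy : Function.Injective fun l => (y l).1) (h0 : ∀ l, (y l).2 ≠ 0) :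
    featureSet (configCustomers y) = range fun l => (y l).1 := by
  ext ω
  constructor
  · rintro ⟨i, hi⟩
    by_contra hω
    exact hi (configCustomers_singleton_of_notMem hω i)
  · rintro ⟨l, rfl⟩
    obtain ⟨i, hi⟩ := Function.ne_iff.1 (h0 l)
    exact ⟨i, by rw [configCustomers_singleton hy]; exact hi⟩

variable [MeasurableSpace E]

variable (Ω E M n) in
/-- Lists of `n` features with nonzero scores, in increasing order. -/
def sortedConfigs [StandardBorelSpace Ω] : Set (Fin n → Ω × (Fin M → E)) :=
  {y | StrictMono (fun l => embeddingReal Ω (y l).1) ∧ ∀ l, (y l).2 ≠ 0}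

variable [StandardBorelSpace Ω]

theorem injective_of_mem_sortedConfigs {y : Fin n → Ω × (Fin M → E)}
    (hy : y ∈ sortedConfigs Ω E M n) : Function.Injective fun l => (y l).1 :=
  fun _ _ h => hy.1.injective (congrArg (embeddingReal Ω) h)

theorem measurableSet_sortedConfigs [MeasurableSingletonClass E] :
    MeasurableSet (sortedConfigs Ω E M n) := by
  have hφ := (measurableEmbedding_embeddingReal Ω).measurable
  have h1 : sortedConfigs Ω E M n =
      (⋂ (i : Fin n) (j : Fin n) (_ : i < j),
        {y | embeddingReal Ω (y i).1 < embeddingReal Ω (y j).1}) ∩ ⋂ l, {y | (y l).2 ≠ 0} := by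
    ext y
    simp [sortedConfigs, StrictMono]
  rw [h1]
  refine MeasurableSet.inter (MeasurableSet.iInter fun i => MeasurableSet.iInter fun j =>
    MeasurableSet.iInter fun _ => measurableSet_lt (hφ.comp (by fun_prop)) (hφ.comp (by fun_prop)))
    (MeasurableSet.iInter fun l => ?_)
  exact (show Measurable fun y : Fin n → Ω × (Fin M → E) => (y l).2 by fun_prop)
    (measurableSet_singleton 0).compl

/-- The measures determine the set of features and their scores. The length of the list is the
number of features, and increasing order leaves only one way to list them. -/
theorem configCustomers_inj {n' : ℕ} {y : Fin n → Ω × (Fin M → E)}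
    {y' : Fin n' → Ω × (Fin M → E)} (hy : y ∈ sortedConfigs Ω E M n)
    (hy' : y' ∈ sortedConfigs Ω E M n') (h : configCustomers y = configCustomers y') :
    ∃ e : n = n', ∀ l, y l = y' (Fin.cast e l) := by
  have hi := injective_of_mem_sortedConfigs hy
  have hi' := injective_of_mem_sortedConfigs hy'
  have hr : range (fun l => (y l).1) = range fun l => (y' l).1 := by
    rw [← featureSet_configCustomers hi hy.2, ← featureSet_configCustomers hi' hy'.2, h]
  have hn : n = n' := by
    have h1 := congrArg Set.ncard hr
    rwa [← image_univ, ← image_univ, ncard_image_of_injective _ hi,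
      ncard_image_of_injective _ hi', ncard_univ, ncard_univ, Nat.card_fin, Nat.card_fin] at h1
  subst hn
  refine ⟨rfl, fun l => ?_⟩
  have h1 : (fun l => embeddingReal Ω (y l).1) = fun l => embeddingReal Ω (y' l).1 := by
    refine (StrictMono.range_inj hy.1 hy'.1).1 ?_
    have := congrArg (image (embeddingReal Ω)) hr
    rwa [← range_comp, ← range_comp] at this
  have h2 : (y l).1 = (y' l).1 :=
    (measurableEmbedding_embeddingReal Ω).injective (congrFun h1 l)
  refine Prod.ext h2 ?_
  rw [Fin.cast_refl, id, ← scores_configCustomers hi, ← scores_configCustomers hi', h, h2]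

end Config

/-! ### The predictive law as a Markov kernel -/

section Predictive

variable {Ω E : Type*} [MeasurableSpace Ω] [StandardBorelSpace Ω] [NormedAddCommGroup E]
  [NormedSpace ℝ E] [FiniteDimensional ℝ E] [MeasurableSpace E] [BorelSpace E] {M n : ℕ}

theorem measurable_sum_dirac {X ι : Type*} [MeasurableSpace X] [Fintype ι] {w : ι → X → Ω}
    {a : ι → X → E} (hw : ∀ i, Measurable (w i)) (ha : ∀ i, Measurable (a i)) :
    Measurable fun x => ∑ i, VectorMeasure.dirac (w i x) (a i x) := by
  classical
  have : SecondCountableTopology E :=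
    have := FiniteDimensional.proper ℝ E
    inferInstance
  refine measurable_vectorMeasure_of_apply fun B hB => ?_
  simp only [FunLike.coe_sum, Finset.sum_apply, dirac_apply_eq _ _ hB]
  exact Finset.measurable_sum _ fun i _ => Measurable.ite (hw i hB) (ha i) measurable_const

theorem measurable_vectorMeasure_add {X : Type*} [MeasurableSpace X]
    {f g : X → VectorMeasure Ω E} (hf : Measurable f) (hg : Measurable g) :
    Measurable fun x => f x + g x := by
  have : SecondCountableTopology E :=
    have := FiniteDimensional.proper ℝ E
    inferInstance
  refine measurable_vectorMeasure_of_apply fun B _ => ?_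
  simp only [FunLike.coe_add, Pi.add_apply]
  exact ((measurable_vectorMeasure_apply B).comp hf).add ((measurable_vectorMeasure_apply B).comp hg)

/-- This is Lusin–Souslin: an injective measurable map from a standard Borel space to a countably
separated one is an embedding. A kernel on lists can therefore be pushed to a kernel on tuples of
measures. -/
theorem measurableEmbedding_configCustomers :
    MeasurableEmbedding fun y : sortedConfigs Ω E M n => configCustomers y.1 := by
  have hc : CompleteSpace E := FiniteDimensional.complete ℝ E
  have : SecondCountableTopology E :=
    have := FiniteDimensional.proper ℝ E
    inferInstance
  have := (measurableSet_sortedConfigs (Ω := Ω) (E := E) (M := M) (n := n)).standardBorel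
  have hl : ∀ l, Measurable fun y : sortedConfigs Ω E M n => y.1 l :=
    fun l => (measurable_pi_apply l).comp measurable_subtype_coe
  refine Measurable.measurableEmbedding (measurable_pi_lambda _ fun i => ?_) fun y y' h => ?_
  · exact measurable_sum_dirac (w := fun l (y : sortedConfigs Ω E M n) => (y.1 l).1)
      (a := fun l y => (y.1 l).2 i) (fun l => measurable_fst.comp (hl l))
      fun l => (measurable_pi_apply i).comp (measurable_snd.comp (hl l))
  · obtain ⟨_, h2⟩ := configCustomers_inj y.2 y'.2 h
    exact Subtype.ext (funext h2)

theorem measurable_add_sum_dirac : Measurable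
    fun x : (Fin n → Ω × (Fin M → E)) × (VectorMeasure Ω E × (Fin n → ℝ × E)) =>
      x.2.1 + ∑ l, VectorMeasure.dirac (x.1 l).1 (x.2.2 l).2 :=
  measurable_vectorMeasure_add (by fun_prop)
    (measurable_sum_dirac (fun l => by fun_prop) fun l => by fun_prop)

/-- The predictive law given the list of the features and their scores. -/
def configPredictive (m : Measure (VectorMeasure Ω E)) [IsProbabilityMeasure m] (G : Kernel ℝ E)
    [IsMarkovKernel G] (P : Kernel (Ω × (Fin M → E)) ℝ) [IsMarkovKernel P] :
    Kernel (Fin n → Ω × (Fin M → E)) (VectorMeasure Ω E) :=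
  (Kernel.id ×ₖ (Kernel.const _ m ×ₖ kernelPi fun l : Fin n =>
    (P ⊗ₖ Kernel.prodMkLeft _ G).comap (fun y => y l) (measurable_pi_apply l))).map
    fun x => x.2.1 + ∑ l, VectorMeasure.dirac (x.1 l).1 (x.2.2 l).2

variable {m : Measure (VectorMeasure Ω E)} [IsProbabilityMeasure m] {G : Kernel ℝ E}
  [IsMarkovKernel G] {P : Kernel (Ω × (Fin M → E)) ℝ} [IsMarkovKernel P]

instance : IsMarkovKernel (configPredictive (n := n) m G P) :=
  Kernel.IsMarkovKernel.map _ measurable_add_sum_dirac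

theorem configPredictive_apply (y : Fin n → Ω × (Fin M → E)) :
    configPredictive m G P y = (m.prod (Measure.pi fun l => P (y l) ⊗ₘ G)).map
      fun x => x.1 + ∑ l, VectorMeasure.dirac (y l).1 (x.2 l).2 := by
  have h : ∀ l, (P ⊗ₖ Kernel.prodMkLeft _ G) (y l) = P (y l) ⊗ₘ G := fun l => by
    rw [Kernel.compProd_apply_eq_compProd_sectR]
    rfl
  rw [configPredictive, Kernel.map_apply _ measurable_add_sum_dirac, Kernel.prod_apply,
    Kernel.id_apply, Kernel.prod_apply, Kernel.const_apply, kernelPi_apply, Measure.dirac_prod,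
    Measure.map_map measurable_add_sum_dirac (by fun_prop)]
  simp only [Kernel.comap_apply, h]
  rfl

/-- The two laws differ only in how the independent pairs are indexed, by the set `S` or by
positions in the list; the bijection `e` matches them. -/
theorem predictiveLaw_configCustomers {y : Fin n → Ω × (Fin M → E)}
    (hy : y ∈ sortedConfigs Ω E M n) {S : Finset Ω}
    (hS : (S : Set Ω) = featureSet (configCustomers y)) :
    predictiveLaw m G P (configCustomers y) S = configPredictive m G P y := by
  have hi := injective_of_mem_sortedConfigs hy
  rw [featureSet_configCustomers hi hy.2] at hS
  have hmem : ∀ l, (y l).1 ∈ S := fun l => by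
    rw [← Finset.mem_coe, hS]
    exact mem_range_self l
  let e : Fin n ≃ S := Equiv.ofBijective (fun l => ⟨(y l).1, hmem l⟩)
    ⟨fun l l' h => hi (congrArg Subtype.val h), fun ω => by
      obtain ⟨l, hl⟩ : ω.1 ∈ range fun l => (y l).1 := hS ▸ Finset.mem_coe.2 ω.2
      exact ⟨l, Subtype.ext hl⟩⟩
  have he : ∀ l, (e l : Ω) = (y l).1 := fun l => rfl
  have hpi := measurePreserving_piCongrLeft
    (fun ω : S => P (ω.1, scores (configCustomers y) ω.1) ⊗ₘ G) e
  have hsc : ∀ l, P ((e l).1, scores (configCustomers y) (e l).1) = P (y l) := fun l => by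
    rw [he, scores_configCustomers hi]
  simp only [hsc] at hpi
  have hmeas : Measurable fun x : VectorMeasure Ω E × (S → ℝ × E) =>
      x.1 + ∑ ω : S, VectorMeasure.dirac ω.1 (x.2 ω).2 :=
    measurable_vectorMeasure_add (by fun_prop)
      (measurable_sum_dirac (fun l => by fun_prop) fun l => by fun_prop)
  rw [predictiveLaw, configPredictive_apply, ← ((MeasurePreserving.id m).prod hpi).map_eq,
    Measure.map_map hmeas (by fun_prop)]
  congr 1
  ext1 x
  simp only [Function.comp_apply]
  congr 1
  rw [← e.sum_comp]
  refine Finset.sum_congr rfl fun l _ => ?_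
  have h1 : Equiv.piCongrLeft (fun _ : S => ℝ × E) e x.2 (e l) = x.2 l :=
    Equiv.piCongrLeft_apply_apply _ _ _ _
  rw [he, MeasurableEquiv.coe_piCongrLeft]
  exact congrArg (fun z : ℝ × E => VectorMeasure.dirac (y l).1 z.2) h1

/-- The predictive laws form a Markov kernel. -/
theorem exists_kernel_predictiveLaw (m : Measure (VectorMeasure Ω E)) [IsProbabilityMeasure m]
    (G : Kernel ℝ E) [IsMarkovKernel G] (P : Kernel (Ω × (Fin M → E)) ℝ) [IsMarkovKernel P] :
    ∃ κ : Kernel (Fin M → VectorMeasure Ω E) (VectorMeasure Ω E), IsMarkovKernel κ ∧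
      ∀ (n : ℕ), ∀ y ∈ sortedConfigs Ω E M n,
        κ (configCustomers y) = configPredictive m G P y := by
  -- Off the ranges of the encodings `κ` is the constant `m`. The first `M` customers avoid that set
  -- almost surely, by `IsIBPModel.ae_exists_sortedConfig`.
  obtain ⟨κ, hκ, h⟩ := exists_kernel_extend
    (Y := fun n => sortedConfigs Ω E M n)
    (fun n => measurableEmbedding_configCustomers (Ω := Ω) (E := E) (M := M) (n := n))
    (fun i j hij => disjoint_left.2 fun z ⟨y, hy⟩ ⟨y', hy'⟩ =>
      hij (configCustomers_inj y.2 y'.2 (hy.trans hy'.symm)).1)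
    (fun n => (configPredictive m G P).comap Subtype.val measurable_subtype_coe) m
  exact ⟨κ, hκ, fun n y hy => h n ⟨y, hy⟩⟩

end Predictive

/-! ### Splitting the exponent into unchosen and chosen points -/

section FeatureLast

variable {Ω E : Type*} [MeasurableSpace Ω] [Zero E] [MeasurableSpace E]
  [MeasurableSingletonClass E] {G : Kernel ℝ E} [IsMarkovKernel G]
  {ν : Measure (ℝ × Ω)} [SFinite ν] {M : ℕ}

theorem measurableSet_init_ne_zero {Y : Type*} [MeasurableSpace Y] :
    MeasurableSet {y : Y × (Fin (M + 1) → E) | (fun i : Fin M => y.2 i.castSucc) ≠ 0} :=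
  (show Measurable fun y : Y × (Fin (M + 1) → E) => fun i : Fin M => y.2 i.castSucc by fun_prop)
    (measurableSet_singleton 0).compl

instance : SFinite (featureMeasure G ν M) := by
  unfold featureMeasure
  infer_instance

/-- A feature chosen by one of the first `M` customers gets, independently of their scores, the
mark of the last customer. -/
theorem map_restrict_init_ne_zero :
    ((ν ⊗ₘ markKernel Ω (Fin (M + 1)) G).restrict
      {y | (fun i : Fin M => y.2 i.castSucc) ≠ 0}).map
      (fun y => (((y.1.2, fun i : Fin M => y.2 i.castSucc), y.1.1), y.2 (Fin.last M))) =
    featureMeasure G ν M ⊗ₘ Kernel.prodMkLeft (Ω × (Fin M → E)) G := by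
  have hf : Measurable fun y : (ℝ × Ω) × (Fin (M + 1) → E) =>
      (((y.1.2, fun i : Fin M => y.2 i.castSucc), y.1.1), y.2 (Fin.last M)) := by fun_prop
  have hg : Measurable fun y : (ℝ × Ω) × (Fin M → E) => ((y.1.2, y.2), y.1.1) := by fun_prop
  ext S hS
  have hi : Measurable fun z : (Ω × (Fin M → E)) × ℝ =>
      Kernel.prodMkLeft (Ω × (Fin M → E)) G z (Prod.mk z ⁻¹' S) :=
    Kernel.measurable_kernel_prodMk_left hS
  have hi' : Measurable fun y : (ℝ × Ω) × (Fin M → E) =>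
      G y.1.1 (Prod.mk ((y.1.2, y.2), y.1.1) ⁻¹' S) := hi.comp hg
  rw [Measure.map_apply hf hS, Measure.restrict_apply (hf hS),
    Measure.compProd_apply ((hf hS).inter measurableSet_init_ne_zero),
    Measure.compProd_apply hS, featureMeasure, lintegral_map hi hg,
    ← lintegral_indicator measurableSet_snd_ne_zero]
  simp only [Kernel.prodMkLeft_apply]
  rw [Measure.lintegral_compProd (hi'.indicator measurableSet_snd_ne_zero)]
  refine lintegral_congr fun x => ?_
  let D : Set ((Fin M → E) × E) := {b | b.1 ≠ 0 ∧ (((x.2, b.1), x.1), b.2) ∈ S}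
  have hD : MeasurableSet D := by
    refine MeasurableSet.inter (measurable_fst (measurableSet_singleton 0).compl) ?_
    exact (show Measurable fun b : (Fin M → E) × E => (((x.2, b.1), x.1), b.2) by fun_prop) hS
  have h1 : Prod.mk x ⁻¹' ((fun y : (ℝ × Ω) × (Fin (M + 1) → E) =>
      (((y.1.2, fun i : Fin M => y.2 i.castSucc), y.1.1), y.2 (Fin.last M))) ⁻¹' S ∩
      {y | (fun i : Fin M => y.2 i.castSucc) ≠ 0}) =
      (fun a => ((fun i : Fin M => a i.castSucc), a (Fin.last M))) ⁻¹' D := by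
    ext a
    simp [D, and_comm]
  rw [h1, ← Measure.map_apply (by fun_prop) hD, map_markKernel_init_last,
    Measure.prod_apply hD]
  refine lintegral_congr fun a => ?_
  by_cases ha : a = 0
  · simp [D, ha]
  · rw [indicator_of_mem (show (x, a) ∈ {y : (ℝ × Ω) × (Fin M → E) | y.2 ≠ 0} from ha)]
    congr 1
    ext b
    simp [D, ha]

theorem map_restrict_init_ne_zero_fst :
    ((ν ⊗ₘ markKernel Ω (Fin (M + 1)) G).restrict
      {y | (fun i : Fin M => y.2 i.castSucc) ≠ 0}).map
      (fun y => (y.1.2, fun i : Fin M => y.2 i.castSucc)) = (featureMeasure G ν M).fst := by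
  have h := congrArg (Measure.map fun z => z.1.1) (map_restrict_init_ne_zero (G := G) (ν := ν)
    (M := M))
  rw [Measure.map_map (by fun_prop) (by fun_prop)] at h
  have h2 : (featureMeasure G ν M ⊗ₘ Kernel.prodMkLeft (Ω × (Fin M → E)) G).map
      (fun z => z.1.1) = (featureMeasure G ν M).fst := by
    have h3 := Measure.fst_compProd (featureMeasure G ν M)
      (Kernel.prodMkLeft (Ω × (Fin M → E)) G)
    conv_rhs => rw [← h3, Measure.fst, Measure.fst, Measure.map_map measurable_fst measurable_fst]
    rfl
  rw [← h2, ← h]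
  rfl

/-- `ψ - 1` is bounded by 2 and vanishes where all marks are zero; the remaining set has finite
measure. -/
theorem integrable_sub_one {ι : Type*} [Fintype ι] (hfin : ∫⁻ x, piA G x.1 ∂ν < ∞)
    {ψ : (ℝ × Ω) × (ι → E) → ℂ} (hψm : Measurable ψ) (hψ : ∀ y, ‖ψ y‖ ≤ 1)
    (h0 : ∀ y, y.2 = 0 → ψ y = 1) :
    Integrable (fun y => ψ y - 1) (ν ⊗ₘ markKernel Ω ι G) := by
  have h1 : Integrable ({y : (ℝ × Ω) × (ι → E) | y.2 ≠ 0}.indicator fun _ => (2 : ℝ))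
      (ν ⊗ₘ markKernel Ω ι G) :=
    (integrable_indicator_iff measurableSet_snd_ne_zero).2
      (integrableOn_const (compProd_ne_zero_lt_top hfin).ne)
  refine h1.mono' (hψm.sub_const 1).aestronglyMeasurable (ae_of_all _ fun y => ?_)
  by_cases hy : y.2 = 0
  · simp [h0 y hy, hy]
  · rw [indicator_of_mem (show y ∈ {y : (ℝ × Ω) × (ι → E) | y.2 ≠ 0} from hy)]
    refine (norm_sub_le _ _).trans ?_
    rw [norm_one]
    linarith [hψ y]

variable {P : Kernel (Ω × (Fin M → E)) ℝ} [IsMarkovKernel P]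

/-- Splitting the points by whether they are chosen by the first `M` customers. -/
theorem integral_sub_one_split (hfin : ∫⁻ x, piA G x.1 ∂ν < ∞)
    (hP : featureMeasure G ν M = (featureMeasure G ν M).fst ⊗ₘ P)
    {t : Ω × (Fin M → E) → ℂ} {u : Ω × E → ℂ} {Φ : Ω × (Fin M → E) → ℂ}
    (htm : Measurable t) (hum : Measurable u) (hΦm : Measurable Φ)
    (ht : ∀ y, ‖t y‖ ≤ 1) (hu : ∀ y, ‖u y‖ ≤ 1) (hΦ1 : ∀ y, ‖Φ y‖ ≤ 1)
    (ht0 : ∀ ω, t (ω, 0) = 1) (hu0 : ∀ ω, u (ω, 0) = 1)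
    (hΦ : ∀ x, Φ x = ∫ z, u (x.1, z.2) ∂(P x ⊗ₘ G)) :
    ∫ y, (t (y.1.2, fun i : Fin M => y.2 i.castSucc) * u (y.1.2, y.2 (Fin.last M)) - 1)
        ∂(ν ⊗ₘ markKernel Ω (Fin (M + 1)) G) =
      ∫ y, (u (y.1.2, y.2 ()) - 1)
        ∂((ν.withDensity fun x => (1 - piA G x.1) ^ M) ⊗ₘ markKernel Ω Unit G) +
      ∫ y, ((open Classical in if (fun i : Fin M => y.2 i.castSucc) = 0 then 1 else
        t (y.1.2, fun i : Fin M => y.2 i.castSucc) *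
          Φ (y.1.2, fun i : Fin M => y.2 i.castSucc)) - 1)
        ∂(ν ⊗ₘ markKernel Ω (Fin (M + 1)) G) := by
  classical
  set μ := ν ⊗ₘ markKernel Ω (Fin (M + 1)) G with hμ
  have hfm := isFiniteMeasure_featureMeasure (M := M) hfin
  let ini : (ℝ × Ω) × (Fin (M + 1) → E) → Fin M → E := fun y i => y.2 i.castSucc
  have hini : Measurable ini := by fun_prop
  -- `Z` holds the points chosen by the first `M` customers. On its complement `t = 1` and `ψ₂ = 1`,
  -- leaving the thinned integral of `u - 1`; on `Z` the integrals of `ψ₁` and `ψ₂` agree.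
  let Z : Set ((ℝ × Ω) × (Fin (M + 1) → E)) := {y | ini y ≠ 0}
  have hZ : MeasurableSet Z := measurableSet_init_ne_zero
  have hZc : Zᶜ = {y | ∀ i : Fin M, y.2 i.castSucc = 0} := by
    ext y
    simp [Z, ini, funext_iff]
  have hZfin : μ Z < ∞ := by
    have hsub : Z ⊆ {y | y.2 ≠ 0} := fun y hy h0 => hy (by ext i; simp [ini, h0])
    exact (measure_mono hsub).trans_lt (compProd_ne_zero_lt_top hfin)
  let ψ₁ : (ℝ × Ω) × (Fin (M + 1) → E) → ℂ := fun y =>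
    t (y.1.2, ini y) * u (y.1.2, y.2 (Fin.last M))
  let ψ₂ : (ℝ × Ω) × (Fin (M + 1) → E) → ℂ := fun y =>
    if ini y = 0 then 1 else t (y.1.2, ini y) * Φ (y.1.2, ini y)
  have hψ₁m : Measurable ψ₁ := (htm.comp (by fun_prop)).mul (hum.comp (by fun_prop))
  have hψ₂m : Measurable ψ₂ := Measurable.ite (hini (measurableSet_singleton 0)) measurable_const
    ((htm.comp (by fun_prop)).mul (hΦm.comp (by fun_prop)))
  have hψ₁ : ∀ y, ‖ψ₁ y‖ ≤ 1 := fun y => by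
    rw [norm_mul]
    exact mul_le_one₀ (ht _) (norm_nonneg _) (hu _)
  have hψ₂ : ∀ y, ‖ψ₂ y‖ ≤ 1 := fun y => by
    simp only [ψ₂]
    split_ifs
    · simp
    · rw [norm_mul]
      exact mul_le_one₀ (ht _) (norm_nonneg _) (hΦ1 _)
  have hint₁ : Integrable (fun y => ψ₁ y - 1) μ :=
    integrable_sub_one hfin hψ₁m hψ₁ fun y hy => by
      have : ini y = 0 := by ext i; simp [ini, hy]
      simp [ψ₁, this, hy, ht0, hu0]
  have hint₂ : Integrable (fun y => ψ₂ y - 1) μ :=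
    integrable_sub_one hfin hψ₂m hψ₂ fun y hy => by
      have : ini y = 0 := by ext i; simp [ini, hy]
      simp [ψ₂, this]
  change ∫ y, (ψ₁ y - 1) ∂μ = _ + ∫ y, (ψ₂ y - 1) ∂μ
  rw [← integral_add_compl hZ hint₁, ← integral_add_compl hZ hint₂]
  have hc₂ : ∫ y in Zᶜ, (ψ₂ y - 1) ∂μ = 0 := by
    rw [setIntegral_congr_fun hZ.compl (g := fun _ => 0), integral_zero]
    intro y hy
    have : ini y = 0 := by simpa [Z] using hy
    simp [ψ₂, this]
  have hc₁ : ∫ y in Zᶜ, (ψ₁ y - 1) ∂μ = ∫ y, (u (y.1.2, y.2 ()) - 1)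
      ∂((ν.withDensity fun x => (1 - piA G x.1) ^ M) ⊗ₘ markKernel Ω Unit G) := by
    have hm' : Measurable fun y : (ℝ × Ω) × (Unit → E) => u (y.1.2, y.2 ()) - 1 :=
      (hum.comp (by fun_prop)).sub_const 1
    have hl : Measurable fun y : (ℝ × Ω) × (Fin (M + 1) → E) =>
      (y.1, fun _ : Unit => y.2 (Fin.last M)) := by fun_prop
    rw [← map_restrict_init_zero, ← hμ, integral_map hl.aemeasurable
      hm'.aestronglyMeasurable, hZc]
    refine setIntegral_congr_fun (hZc ▸ hZ.compl) fun y hy => ?_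
    have : ini y = 0 := funext hy
    simp [ψ₁, this, ht0]
  -- Bayes' rule: on `Z` the last mark has law `G(· | s)` given location, scores and jump, while `s`
  -- has law `P(· | ω, a)` given location and scores. Integrating both out turns `u` into `Φ`.
  have hm : ∫ y in Z, ψ₁ y ∂μ = ∫ y in Z, ψ₂ y ∂μ := by
    have h1 : ∫ y in Z, ψ₂ y ∂μ = ∫ x, t x * Φ x ∂(featureMeasure G ν M).fst := by
      have hm' : Measurable fun x => t x * Φ x := htm.mul hΦm
      have hl : Measurable fun y : (ℝ × Ω) × (Fin (M + 1) → E) =>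
        (y.1.2, fun i : Fin M => y.2 i.castSucc) := by fun_prop
      rw [← map_restrict_init_ne_zero_fst, ← hμ, integral_map hl.aemeasurable
        hm'.aestronglyMeasurable]
      exact setIntegral_congr_fun hZ fun y hy => if_neg hy
    have htu : Measurable fun z : ((Ω × (Fin M → E)) × ℝ) × E =>
        t z.1.1 * u (z.1.1.1, z.2) := (htm.comp (by fun_prop)).mul (hum.comp (by fun_prop))
    have h2 : ∫ y in Z, ψ₁ y ∂μ = ∫ z, t z.1.1 * u (z.1.1.1, z.2)
        ∂(featureMeasure G ν M ⊗ₘ Kernel.prodMkLeft (Ω × (Fin M → E)) G) := by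
      have hl : Measurable fun y : (ℝ × Ω) × (Fin (M + 1) → E) =>
        (((y.1.2, fun i : Fin M => y.2 i.castSucc), y.1.1), y.2 (Fin.last M)) := by fun_prop
      rw [← map_restrict_init_ne_zero, ← hμ, integral_map hl.aemeasurable
        htu.aestronglyMeasurable]
    have htu1 : ∀ z : ((Ω × (Fin M → E)) × ℝ) × E, ‖t z.1.1 * u (z.1.1.1, z.2)‖ ≤ 1 := fun z => by
      rw [norm_mul]
      exact mul_le_one₀ (ht _) (norm_nonneg _) (hu _)
    have hI := Integrable.of_bound (μ := featureMeasure G ν M ⊗ₘ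
      Kernel.prodMkLeft (Ω × (Fin M → E)) G) htu.aestronglyMeasurable 1 (ae_of_all _ htu1)
    rw [h1, h2, Measure.integral_compProd hI]
    have hI' := hI.integral_compProd
    conv_lhs => rw [hP]
    rw [Measure.integral_compProd (by rw [← hP]; exact hI')]
    refine integral_congr_ae (ae_of_all _ fun x => ?_)
    simp only [Kernel.prodMkLeft_apply]
    have hux : Measurable fun z : ℝ × E => u (x.1, z.2) := hum.comp (by fun_prop)
    rw [hΦ x, Measure.integral_compProd (Integrable.of_bound
      hux.aestronglyMeasurable 1 (ae_of_all _ fun z => hu _)),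
      ← integral_const_mul]
    refine integral_congr_ae (ae_of_all _ fun s => ?_)
    exact integral_const_mul _ _
  have hfinZ : IsFiniteMeasure (μ.restrict Z) := ⟨by simpa using hZfin⟩
  have hi₁ : Integrable ψ₁ (μ.restrict Z) :=
    Integrable.of_bound hψ₁m.aestronglyMeasurable 1 (ae_of_all _ hψ₁)
  have hi₂ : Integrable ψ₂ (μ.restrict Z) :=
    Integrable.of_bound hψ₂m.aestronglyMeasurable 1 (ae_of_all _ hψ₂)
  rw [hc₂, hc₁, integral_sub hi₁ (integrable_const 1), integral_sub hi₂ (integrable_const 1), hm]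
  ring

end FeatureLast

theorem eventually_prod_range_eq {f : ℕ → ℂ} {K : Finset ℕ} (h : ∀ k ∉ K, f k = 1) :
    ∀ᶠ n in atTop, ∏ k ∈ Finset.range n, f k = ∏ k ∈ K, f k := by
  filter_upwards [tendsto_finset_range.eventually (eventually_ge_atTop K)] with n hn
  exact (Finset.prod_subset hn fun k _ hk => h k hk).symm

/-- Almost surely only finitely many terms are nonzero, so additivity of `T` suffices and no
continuity is required. -/
theorem map_latentSum {Ω E ι : Type*} [MeasurableSpace Ω] [NormedAddCommGroup E]
    (T : (ι → VectorMeasure Ω E) →+ ℝ) {t : ℕ → ℝ} {w : ℕ → Ω} {a : ι → ℕ → E} (K : Finset ℕ)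
    (hK : ∀ i k, 0 < t k → a i k ≠ 0 → k ∈ K) :
    T (fun i => latentSum t w (a i)) =
      ∑ k ∈ K, if 0 < t k then T (fun i => VectorMeasure.dirac (w k) (a i k)) else 0 := by
  have h1 : (fun i => latentSum t w (a i)) =
      ∑ k ∈ K, if 0 < t k then (fun i => VectorMeasure.dirac (w k) (a i k)) else 0 := by
    ext1 i
    rw [latentSum_eq_sum K (hK i), Finset.sum_apply]
    refine Finset.sum_congr rfl fun k _ => ?_
    split_ifs <;> rfl
  rw [h1, map_sum]
  refine Finset.sum_congr rfl fun k _ => ?_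
  split_ifs
  · rfl
  · exact map_zero T

theorem exists_sorted_enumeration {Ω : Type*} [MeasurableSpace Ω] [StandardBorelSpace Ω]
    {w : ℕ → Ω} (K : Finset ℕ) (hinj : InjOn w K) :
    ∃ k : Fin K.card → ℕ, Function.Injective k ∧ Finset.univ.image k = K ∧
      StrictMono fun l => embeddingReal Ω (w (k l)) := by
  classical
  have hφ : InjOn (fun k => embeddingReal Ω (w k)) K := fun k hk k' hk' h =>
    hinj hk hk' ((measurableEmbedding_embeddingReal Ω).injective h)
  let s : Finset ℝ := K.image fun k => embeddingReal Ω (w k)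
  have hs : s.card = K.card := Finset.card_image_of_injOn hφ
  let f := s.orderEmbOfFin hs
  have hf : ∀ l, ∃ k ∈ K, embeddingReal Ω (w k) = f l := fun l =>
    Finset.mem_image.1 (s.orderEmbOfFin_mem hs l)
  choose k hk hkf using hf
  have hki : Function.Injective k := fun l l' h =>
    f.injective (by rw [← hkf, ← hkf, h])
  refine ⟨k, hki, ?_, fun l l' h => ?_⟩
  · refine Finset.eq_of_subset_of_card_le (Finset.image_subset_iff.2 fun l _ => hk l) ?_
    rw [Finset.card_image_of_injective _ hki, Finset.card_univ, Fintype.card_fin]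
  · change embeddingReal Ω (w (k l)) < embeddingReal Ω (w (k l'))
    rw [hkf, hkf]
    exact f.strictMono h

/-- Finitely many features with distinct locations can be listed in increasing order. -/
theorem exists_sortedConfig {Ω E : Type*} [MeasurableSpace Ω] [StandardBorelSpace Ω]
    [NormedAddCommGroup E] [MeasurableSpace E] {M : ℕ} {t : ℕ → ℝ} {w : ℕ → Ω}
    {a : Fin M → ℕ → E} {K : Finset ℕ} (hK : ∀ k, k ∈ K ↔ 0 < t k ∧ (fun i => a i k) ≠ 0)
    (hinj : ∀ k l, 0 < t k → 0 < t l → w k = w l → k = l) :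
    ∃ k : Fin K.card → ℕ, Function.Injective k ∧ Finset.univ.image k = K ∧
      (fun l => (w (k l), fun i => a i (k l))) ∈ sortedConfigs Ω E M K.card ∧
      (fun i => latentSum t w (a i)) = configCustomers fun l => (w (k l), fun i => a i (k l)) := by
  obtain ⟨k, hki, hkK, hmono⟩ := exists_sorted_enumeration (w := w) K
    fun k hk l hl => hinj k l ((hK k).1 hk).1 ((hK l).1 hl).1
  have hmem : ∀ l, k l ∈ K := fun l => hkK ▸ Finset.mem_image_of_mem k (Finset.mem_univ l)
  refine ⟨k, hki, hkK, ⟨hmono, fun l => ((hK _).1 (hmem l)).2⟩, ?_⟩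
  ext1 i
  rw [latentSum_eq_sum K fun k hk hak => (hK k).2 ⟨hk, fun h => hak (congrFun h i)⟩,
    configCustomers]
  conv_lhs => rw [← hkK]
  rw [Finset.sum_image fun _ _ _ _ h => hki h]
  exact Finset.sum_congr rfl fun l _ => if_pos ((hK _).1 (hmem l)).1

/-! ### Characteristic functionals of the customers -/

section Functional

variable {Ω E Θ ι : Type*} [MeasurableSpace Ω] [StandardBorelSpace Ω] [NormedAddCommGroup E]
  [NormedSpace ℝ E] [FiniteDimensional ℝ E] [MeasurableSpace E] [BorelSpace E]
  [MeasurableSpace Θ] [Fintype ι] {Pr : Measure Θ} [IsProbabilityMeasure Pr]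
  {ν : Measure (ℝ × Ω)} [SFinite ν] {G : Kernel ℝ E} [IsMarkovKernel G]
  {τ : ℕ → Θ → ℝ} {w : ℕ → Θ → Ω}

theorem measurable_dirac : Measurable fun x : Ω × E => VectorMeasure.dirac x.1 x.2 := by
  classical
  refine measurable_vectorMeasure_of_apply fun B hB => ?_
  simp only [dirac_apply_eq _ _ hB]
  exact Measurable.ite (measurable_fst hB) measurable_snd measurable_const

theorem IsIBPModel.measurable_customer {A : ι → ℕ → Θ → E} (h : IsIBPModel G ν τ w A Pr) (i : ι) :
    Measurable (customer τ w A i) :=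
  measurable_latentSum h.measurable_jump h.measurable_loc (h.measurable_mark i)

theorem IsIBPModel.ae_finite_marks {A : ι → ℕ → Θ → E} (h : IsIBPModel G ν τ w A Pr)
    (hfin : ∫⁻ x, piA G x.1 ∂ν < ∞) :
    ∀ᵐ θ ∂Pr, {k | 0 < τ k θ ∧ (fun i => A i k θ) ≠ 0}.Finite :=
  h.ae_finite measurableSet_snd_ne_zero (compProd_ne_zero_lt_top hfin).ne

theorem exp_sum_ite (K : Finset ℕ) (p : ℕ → Prop) [DecidablePred p] (f : ℕ → ℝ) :
    Complex.exp ((∑ k ∈ K, if p k then f k else 0 : ℝ) * Complex.I) =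
      ∏ k ∈ K, if p k then Complex.exp (f k * Complex.I) else 1 := by
  rw [Complex.ofReal_sum, Finset.sum_mul, Complex.exp_sum]
  refine Finset.prod_congr rfl fun k _ => ?_
  split_ifs <;> simp

/-- The characteristic functional of the customers. -/
theorem IsIBPModel.integral_exp_customer {A : ι → ℕ → Θ → E} (h : IsIBPModel G ν τ w A Pr)
    (hfin : ∫⁻ x, piA G x.1 ∂ν < ∞) (T : (ι → VectorMeasure Ω E) →+ ℝ) (hT : Measurable T) :
    ∫ θ, Complex.exp (T (fun i => customer τ w A i θ) * Complex.I) ∂Pr =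
      Complex.exp (∫ y, (Complex.exp (T (fun i => VectorMeasure.dirac y.1.2 (y.2 i)) * Complex.I) - 1)
        ∂(ν ⊗ₘ markKernel Ω ι G)) := by
  have hψm : Measurable fun y : (ℝ × Ω) × (ι → E) =>
      Complex.exp (T (fun i => VectorMeasure.dirac y.1.2 (y.2 i)) * Complex.I) := by
    refine Complex.measurable_exp.comp ((Complex.measurable_ofReal.comp (hT.comp ?_)).mul_const _)
    exact measurable_pi_lambda _ fun i => measurable_dirac.comp
      (f := fun y : (ℝ × Ω) × (ι → E) => (y.1.2, y.2 i)) (by fun_prop)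
  have hψ1 : ∀ y : (ℝ × Ω) × (ι → E),
      ‖Complex.exp (T (fun i => VectorMeasure.dirac y.1.2 (y.2 i)) * Complex.I)‖ ≤ 1 :=
    fun y => (Complex.norm_exp_ofReal_mul_I _).le
  have hzero : ∀ ω : Ω, ∀ a : ι → E, a = 0 →
      T (fun i => VectorMeasure.dirac ω (a i)) = 0 := fun ω a ha => by
    have : (fun i => VectorMeasure.dirac ω (a i)) = 0 := by
      ext1 i
      exact dirac_eq_zero_iff.2 (congrFun ha i)
    rw [this, map_zero]
  refine h.integral_eq_exp hψm hψ1 (integrable_sub_one hfin hψm hψ1 fun y hy => ?_) ?_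
  · simp [hzero _ _ hy]
  · filter_upwards [h.ae_finite_marks hfin] with θ hθ
    have hK : ∀ k, k ∈ hθ.toFinset ↔ 0 < τ k θ ∧ (fun i => A i k θ) ≠ 0 := fun k => by simp
    unfold customer
    rw [map_latentSum T hθ.toFinset fun i k hk ha => (hK k).2 ⟨hk, fun h0 => ha (congrFun h0 i)⟩,
      exp_sum_ite]
    refine eventually_prod_range_eq fun k hk => ?_
    split_ifs with h0
    · have := hzero (w k θ) (fun i => A i k θ) (by
        by_contra hne
        exact hk ((hK k).2 ⟨h0, hne⟩))
      simp [this]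
    · rfl

theorem IsIBPLaw.isProbabilityMeasure {m : Measure (VectorMeasure Ω E)} (hm : IsIBPLaw G ν m) :
    IsProbabilityMeasure m := by
  obtain ⟨Q, hQ, h, rfl⟩ := hm
  exact Measure.isProbabilityMeasure_map (h.measurable_customer ()).aemeasurable

theorem IsIBPLaw.integral_exp {m : Measure (VectorMeasure Ω E)} (hm : IsIBPLaw G ν m)
    (hfin : ∫⁻ x, piA G x.1 ∂ν < ∞) (U : VectorMeasure Ω E →+ ℝ) (hU : Measurable U) :
    ∫ z, Complex.exp (U z * Complex.I) ∂m =
      Complex.exp (∫ y, (Complex.exp (U (VectorMeasure.dirac y.1.2 (y.2 ())) * Complex.I) - 1)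
        ∂(ν ⊗ₘ markKernel Ω Unit G)) := by
  obtain ⟨Q, hQ, h, rfl⟩ := hm
  have hUm : Measurable fun z => Complex.exp (U z * Complex.I) := by fun_prop
  have hc : Measurable fun x : (ℕ → ℝ × Ω) × (ℕ → E) =>
    latentSum (fun k => (x.1 k).1) (fun k => (x.1 k).2) x.2 := h.measurable_customer ()
  rw [integral_map hc.aemeasurable hUm.aestronglyMeasurable]
  exact h.integral_exp_customer hfin
    (U.comp (Pi.evalAddMonoidHom (fun _ : Unit => VectorMeasure Ω E) ()))
    (hU.comp (measurable_pi_apply ()))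

end Functional

/-! ### The joint characteristic functional of past and next customers -/

section Conditional

variable {Ω E Θ : Type*} [MeasurableSpace Ω] [StandardBorelSpace Ω] [NormedAddCommGroup E]
  [NormedSpace ℝ E] [FiniteDimensional ℝ E] [MeasurableSpace E] [BorelSpace E]
  {G : Kernel ℝ E} [IsMarkovKernel G] {M n : ℕ}
  {P : Kernel (Ω × (Fin M → E)) ℝ} [IsMarkovKernel P]

theorem map_configCustomers (T : (Fin M → VectorMeasure Ω E) →+ ℝ)
    (y : Fin n → Ω × (Fin M → E)) :
    T (configCustomers y) = ∑ l, T (fun i => VectorMeasure.dirac (y l).1 ((y l).2 i)) := by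
  rw [← map_sum]
  congr 1
  ext1 i
  rw [Finset.sum_apply, configCustomers]

/-- The characteristic functional of the score that the next customer gives to a feature. -/
def featureCharFun (G : Kernel ℝ E) (P : Kernel (Ω × (Fin M → E)) ℝ)
    (U : VectorMeasure Ω E →+ ℝ) (x : Ω × (Fin M → E)) : ℂ :=
  ∫ z, Complex.exp (U (VectorMeasure.dirac x.1 z.2) * Complex.I) ∂(P x ⊗ₘ G)

theorem norm_featureCharFun_le (U : VectorMeasure Ω E →+ ℝ) (x : Ω × (Fin M → E)) :
    ‖featureCharFun G P U x‖ ≤ 1 := by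
  refine (norm_integral_le_of_norm_le_const (C := 1)
    (ae_of_all _ fun z => (Complex.norm_exp_ofReal_mul_I _).le)).trans ?_
  simp

theorem measurable_exp_dirac {U : VectorMeasure Ω E →+ ℝ} (hU : Measurable U) :
    Measurable fun x : Ω × E => Complex.exp (U (VectorMeasure.dirac x.1 x.2) * Complex.I) :=
  Complex.measurable_exp.comp
    ((Complex.measurable_ofReal.comp (hU.comp measurable_dirac)).mul_const _)

theorem measurable_featureCharFun {U : VectorMeasure Ω E →+ ℝ} (hU : Measurable U) :
    Measurable (featureCharFun G P U) := by
  have h : ∀ x, (P ⊗ₖ Kernel.prodMkLeft _ G) x = P x ⊗ₘ G := fun x => by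
    rw [Kernel.compProd_apply_eq_compProd_sectR]
    rfl
  have h2 : Measurable fun q : (Ω × (Fin M → E)) × (ℝ × E) =>
      Complex.exp (U (VectorMeasure.dirac q.1.1 q.2.2) * Complex.I) :=
    (measurable_exp_dirac hU).comp (f := fun q : (Ω × (Fin M → E)) × (ℝ × E) => (q.1.1, q.2.2))
      (by fun_prop)
  have h3 := (h2.stronglyMeasurable.integral_kernel_prod_right'
    (κ := P ⊗ₖ Kernel.prodMkLeft _ G)).measurable
  simp only [h] at h3
  exact h3

/-- The fresh part and the scores of the old features are independent, so the functional of their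
sum factorises. -/
theorem integral_exp_configPredictive {m : Measure (VectorMeasure Ω E)} [IsProbabilityMeasure m]
    {U : VectorMeasure Ω E →+ ℝ} (hU : Measurable U) (y : Fin n → Ω × (Fin M → E)) :
    ∫ z, Complex.exp (U z * Complex.I) ∂(configPredictive m G P y) =
      (∫ z, Complex.exp (U z * Complex.I) ∂m) * ∏ l, featureCharFun G P U (y l) := by
  have hUm : Measurable fun z => Complex.exp (U z * Complex.I) := by fun_prop
  have hadd : Measurable fun x : VectorMeasure Ω E × (Fin n → ℝ × E) =>
      x.1 + ∑ l, VectorMeasure.dirac (y l).1 (x.2 l).2 :=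
    measurable_add_sum_dirac.comp measurable_prodMk_left
  rw [configPredictive_apply, integral_map hadd.aemeasurable hUm.aestronglyMeasurable]
  have h1 : ∀ x : VectorMeasure Ω E × (Fin n → ℝ × E),
      Complex.exp (U (x.1 + ∑ l, VectorMeasure.dirac (y l).1 (x.2 l).2) * Complex.I) =
      Complex.exp (U x.1 * Complex.I) *
        ∏ l, Complex.exp (U (VectorMeasure.dirac (y l).1 (x.2 l).2) * Complex.I) := fun x => by
    rw [map_add, map_sum, Complex.ofReal_add, Complex.ofReal_sum, add_mul, Complex.exp_add,
      Finset.sum_mul, Complex.exp_sum]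
  simp_rw [h1]
  rw [integral_prod_mul (fun z => Complex.exp (U z * Complex.I)) fun b : Fin n → ℝ × E =>
    ∏ l, Complex.exp (U (VectorMeasure.dirac (y l).1 (b l).2) * Complex.I),
    integral_fintype_prod_eq_prod fun (l : Fin n) (z : ℝ × E) =>
      Complex.exp (U (VectorMeasure.dirac (y l).1 z.2) * Complex.I)]
  rfl

variable [MeasurableSpace Θ] {Pr : Measure Θ} [IsProbabilityMeasure Pr]
  {ν : Measure (ℝ × Ω)} [SigmaFinite ν] {τ : ℕ → Θ → ℝ} {w : ℕ → Θ → Ω}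
  {A : Fin (M + 1) → ℕ → Θ → E}

theorem lintegral_piA_withDensity_lt_top (hfin : ∫⁻ x, piA G x.1 ∂ν < ∞) :
    ∫⁻ x, piA G x.1 ∂(ν.withDensity fun x => (1 - piA G x.1) ^ M) < ∞ := by
  refine (lintegral_mono' ?_ le_rfl).trans_lt hfin
  refine (withDensity_mono (g := 1) (ae_of_all _ fun x => ?_)).trans withDensity_one.le
  exact pow_le_one₀ zero_le tsub_le_self

/-- Besides placing the customers in the range of the encoding, this records the point index `k l`
of each listed feature, so that products over features become products over points. -/
theorem IsIBPModel.ae_exists_sortedConfig (h : IsIBPModel G ν τ w A Pr)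
    (hfin : ∫⁻ x, piA G x.1 ∂ν < ∞) (hν : ∀ ω, ν (univ ×ˢ {ω}) = 0) :
    ∀ᵐ θ ∂Pr, ∃ (K : Finset ℕ) (k : Fin K.card → ℕ),
      (∀ k, k ∈ K ↔ 0 < τ k θ ∧ (fun i : Fin M => A i.castSucc k θ) ≠ 0) ∧
      Function.Injective k ∧ Finset.univ.image k = K ∧
      (fun l => (w (k l) θ, fun i : Fin M => A i.castSucc (k l) θ)) ∈ sortedConfigs Ω E M K.card ∧
      firstCustomers τ w A θ =
        configCustomers fun l => (w (k l) θ, fun i : Fin M => A i.castSucc (k l) θ) := by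
  filter_upwards [h.ae_finite_marks hfin, ae_injective_loc hν h.prm] with θ h1 h2
  have h3 : {k | 0 < τ k θ ∧ (fun i : Fin M => A i.castSucc k θ) ≠ 0}.Finite := by
    refine h1.subset fun k hk => ⟨hk.1, fun h0 => hk.2 ?_⟩
    ext i
    exact congrFun h0 i.castSucc
  have hK : ∀ k, k ∈ h3.toFinset ↔ 0 < τ k θ ∧ (fun i : Fin M => A i.castSucc k θ) ≠ 0 :=
    fun k => by simp
  obtain ⟨k, hk⟩ := exists_sortedConfig (a := fun i k => A i.castSucc k θ) hK h2
  exact ⟨h3.toFinset, k, hK, hk⟩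

theorem IsIBPModel.measurable_firstCustomers (h : IsIBPModel G ν τ w A Pr) :
    Measurable (firstCustomers τ w A) :=
  measurable_pi_lambda _ fun i => h.measurable_customer i.castSucc

/-- The joint characteristic functional of the first `M` customers and the next one. -/
theorem IsIBPModel.integral_exp_pair (h : IsIBPModel G ν τ w A Pr)
    (hfin : ∫⁻ x, piA G x.1 ∂ν < ∞) (hν : ∀ ω, ν (univ ×ˢ {ω}) = 0)
    (hP : featureMeasure G ν M = (featureMeasure G ν M).fst ⊗ₘ P)
    {m : Measure (VectorMeasure Ω E)} [IsProbabilityMeasure m]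
    (hm : IsIBPLaw G (ν.withDensity fun x => (1 - piA G x.1) ^ M) m)
    {κ : Kernel (Fin M → VectorMeasure Ω E) (VectorMeasure Ω E)} [IsMarkovKernel κ]
    (hκ : ∀ (n : ℕ), ∀ y ∈ sortedConfigs Ω E M n, κ (configCustomers y) = configPredictive m G P y)
    (T : (Fin M → VectorMeasure Ω E) →+ ℝ) (hT : Measurable T)
    (U : VectorMeasure Ω E →+ ℝ) (hU : Measurable U) :
    ∫ θ, Complex.exp ((T (firstCustomers τ w A θ) + U (customer τ w A (Fin.last M) θ) : ℝ) *
        Complex.I) ∂Pr =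
      ∫ θ, Complex.exp (T (firstCustomers τ w A θ) * Complex.I) *
        ∫ z, Complex.exp (U z * Complex.I) ∂(κ (firstCustomers τ w A θ)) ∂Pr := by
  classical
  -- `V` combines `T` and `U` into one functional of all `M + 1` customers, whose characteristic
  -- functional is the left side.
  let V : (Fin (M + 1) → VectorMeasure Ω E) →+ ℝ :=
    { toFun := fun z => T (fun i => z i.castSucc) + U (z (Fin.last M))
      map_zero' := by
        rw [show (fun i : Fin M => (0 : Fin (M + 1) → VectorMeasure Ω E) i.castSucc) = 0 from rfl]
        simp
      map_add' := fun z z' => by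
        rw [show (fun i : Fin M => (z + z') i.castSucc) =
          (fun i : Fin M => z i.castSucc) + fun i => z' i.castSucc from rfl, map_add,
          Pi.add_apply, map_add]
        ring }
  have hV : Measurable V := (hT.comp (by fun_prop)).add (hU.comp (by fun_prop))
  have hL := h.integral_exp_customer hfin V hV
  let t : Ω × (Fin M → E) → ℂ := fun x =>
    Complex.exp (T (fun i => VectorMeasure.dirac x.1 (x.2 i)) * Complex.I)
  let u : Ω × E → ℂ := fun x => Complex.exp (U (VectorMeasure.dirac x.1 x.2) * Complex.I)
  have htm : Measurable t := by
    refine Complex.measurable_exp.comp ((Complex.measurable_ofReal.comp (hT.comp ?_)).mul_const _)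
    exact measurable_pi_lambda _ fun i => measurable_dirac.comp
      (f := fun x : Ω × (Fin M → E) => (x.1, x.2 i)) (by fun_prop)
  have hum : Measurable u := measurable_exp_dirac hU
  have ht0 : ∀ ω, t (ω, 0) = 1 := fun ω => by
    have : (fun i : Fin M => VectorMeasure.dirac ω ((0 : Fin M → E) i)) = 0 := by
      ext1 i
      exact dirac_eq_zero_iff.2 rfl
    simp only [t, this]
    simp
  have hu0 : ∀ ω, u (ω, 0) = 1 := fun ω => by simp [u]
  have ht1 : ∀ x, ‖t x‖ ≤ 1 := fun x => (Complex.norm_exp_ofReal_mul_I _).le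
  have hu1 : ∀ x, ‖u x‖ ≤ 1 := fun x => (Complex.norm_exp_ofReal_mul_I _).le
  have hΦm := measurable_featureCharFun (G := G) (P := P) hU
  let ψ : (ℝ × Ω) × (Fin (M + 1) → E) → ℂ := fun y =>
    if (fun i : Fin M => y.2 i.castSucc) = 0 then 1 else
      t (y.1.2, fun i : Fin M => y.2 i.castSucc) *
        featureCharFun G P U (y.1.2, fun i : Fin M => y.2 i.castSucc)
  have hini : Measurable fun y : (ℝ × Ω) × (Fin (M + 1) → E) =>
    fun i : Fin M => y.2 i.castSucc := by fun_prop
  have hψm : Measurable ψ := Measurable.ite (hini (measurableSet_singleton 0)) measurable_const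
    ((htm.comp (by fun_prop)).mul (hΦm.comp (by fun_prop)))
  have hψ1 : ∀ y, ‖ψ y‖ ≤ 1 := fun y => by
    simp only [ψ]
    split_ifs
    · simp
    · rw [norm_mul]
      exact mul_le_one₀ (ht1 _) (norm_nonneg _) (norm_featureCharFun_le U _)
  have hint : Integrable (fun y => ψ y - 1) (ν ⊗ₘ markKernel Ω (Fin (M + 1)) G) :=
    integrable_sub_one hfin hψm hψ1 fun y hy => if_pos (by ext i; simp [hy])
  set φ := ∫ z, Complex.exp (U z * Complex.I) ∂m with hφ
  have hφe := hm.integral_exp (lintegral_piA_withDensity_lt_top hfin) U hU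
  rw [← hφ] at hφe
  -- Being an exponential, the functional of the fresh part does not vanish; it can be divided out
  -- of the right side, leaving a pure product over the chosen points.
  have hφ0 : φ ≠ 0 := hφe ▸ Complex.exp_ne_zero _
  -- The right side divided by `φ` is the product of the factors `ψ`: `t` times the featurewise
  -- functional at chosen points, and 1 elsewhere. The Poisson functional evaluates it as the
  -- exponential of the second integral in `integral_sub_one_split`.
  have hR := h.integral_eq_exp hψm hψ1 hint (F := fun θ => φ⁻¹ *
    (Complex.exp (T (firstCustomers τ w A θ) * Complex.I) *
      ∫ z, Complex.exp (U z * Complex.I) ∂(κ (firstCustomers τ w A θ)))) (by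
    filter_upwards [h.ae_exists_sortedConfig hfin hν] with θ ⟨K, k, hK, hki, hkK, hy, hX⟩
    have hmem : ∀ l, 0 < τ (k l) θ ∧ (fun i : Fin M => A i.castSucc (k l) θ) ≠ 0 := fun l =>
      (hK _).1 (hkK ▸ Finset.mem_image_of_mem k (Finset.mem_univ l))
    have hF : φ⁻¹ * (Complex.exp (T (firstCustomers τ w A θ) * Complex.I) *
        ∫ z, Complex.exp (U z * Complex.I) ∂(κ (firstCustomers τ w A θ))) =
        ∏ j ∈ K, if 0 < τ j θ then ψ ((τ j θ, w j θ), fun i => A i j θ) else 1 := by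
      rw [hX, hκ _ _ hy, integral_exp_configPredictive hU, map_configCustomers,
        Complex.ofReal_sum, Finset.sum_mul, Complex.exp_sum, mul_left_comm, ← hφ,
        inv_mul_cancel_left₀ hφ0, ← Finset.prod_mul_distrib]
      conv_rhs => rw [← hkK]
      rw [Finset.prod_image fun _ _ _ _ h => hki h]
      refine Finset.prod_congr rfl fun l _ => ?_
      rw [if_pos (hmem l).1]
      exact (if_neg (hmem l).2).symm
    rw [hF]
    refine eventually_prod_range_eq fun j hj => ?_
    split_ifs with h0
    · refine if_pos ?_
      by_contra hne
      exact hj ((hK j).2 ⟨h0, hne⟩)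
    · rfl)
  have hsplit := integral_sub_one_split hfin hP htm hum hΦm ht1 hu1 (norm_featureCharFun_le U)
    ht0 hu0 fun x => rfl
  have hψV : ∀ y : (ℝ × Ω) × (Fin (M + 1) → E),
      Complex.exp (V (fun i => VectorMeasure.dirac y.1.2 (y.2 i)) * Complex.I) =
      t (y.1.2, fun i : Fin M => y.2 i.castSucc) * u (y.1.2, y.2 (Fin.last M)) := fun y => by
    simp only [t, u]
    rw [← Complex.exp_add, ← add_mul, ← Complex.ofReal_add]
    rfl
  simp_rw [hψV] at hL
  rw [integral_const_mul] at hR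
  rw [hsplit, Complex.exp_add, ← hφe] at hL
  refine hL.trans ?_
  rw [← hR, mul_inv_cancel_left₀ hφ0]

end Conditional

/-! ### Identification of the conditional law -/

section Main

variable {Ω E Θ : Type*} [MeasurableSpace Ω] [StandardBorelSpace Ω] [NormedAddCommGroup E]
  [NormedSpace ℝ E] [FiniteDimensional ℝ E] [MeasurableSpace E] [BorelSpace E]
  {G : Kernel ℝ E} [IsMarkovKernel G] {M : ℕ}
  {P : Kernel (Ω × (Fin M → E)) ℝ} [IsMarkovKernel P]
  [MeasurableSpace Θ] {Pr : Measure Θ} [IsProbabilityMeasure Pr]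
  {ν : Measure (ℝ × Ω)} [SigmaFinite ν] {τ : ℕ → Θ → ℝ} {w : ℕ → Θ → Ω}
  {A : Fin (M + 1) → ℕ → Θ → E}

/-- The conditional law of the next customer, given the first `M` customers. -/
theorem IsIBPModel.hasCondDistrib (h : IsIBPModel G ν τ w A Pr)
    (hfin : ∫⁻ x, piA G x.1 ∂ν < ∞) (hν : ∀ ω, ν (univ ×ˢ {ω}) = 0)
    (hP : featureMeasure G ν M = (featureMeasure G ν M).fst ⊗ₘ P)
    {m : Measure (VectorMeasure Ω E)} [IsProbabilityMeasure m]
    (hm : IsIBPLaw G (ν.withDensity fun x => (1 - piA G x.1) ^ M) m)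
    {κ : Kernel (Fin M → VectorMeasure Ω E) (VectorMeasure Ω E)} [IsMarkovKernel κ]
    (hκ : ∀ (n : ℕ), ∀ y ∈ sortedConfigs Ω E M n,
      κ (configCustomers y) = configPredictive m G P y) :
    HasCondDistrib (customer τ w A (Fin.last M)) (firstCustomers τ w A) κ Pr := by
  have hX := h.measurable_firstCustomers
  have hY := h.measurable_customer (Fin.last M)
  have hpX : IsProbabilityMeasure (Pr.map (firstCustomers τ w A)) :=
    Measure.isProbabilityMeasure_map hX.aemeasurable
  have hpXY : IsProbabilityMeasure
      (Pr.map fun θ => (firstCustomers τ w A θ, customer τ w A (Fin.last M) θ)) :=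
    Measure.isProbabilityMeasure_map (hX.prodMk hY).aemeasurable
  refine ⟨(hX.prodMk hY).aemeasurable, ?_⟩
  let e : (Fin M → VectorMeasure Ω E) × VectorMeasure Ω E → (Fin M × Set Ω) ⊕ Set Ω → E :=
    fun x => Sum.elim (fun p => x.1 p.1 p.2) fun B => x.2 B
  -- The product σ-algebra is generated by evaluations of all components, so joint functionals of
  -- finitely many evaluations determine the law of the pair.
  have he : (inferInstance : MeasurableSpace ((Fin M → VectorMeasure Ω E) × VectorMeasure Ω E)) =
      MeasurableSpace.pi.comap e := by
    change MeasurableSpace.pi.comap Prod.fst ⊔ vectorMeasureMeasurableSpace.comap Prod.snd = _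
    simp only [MeasurableSpace.pi, MeasurableSpace.comap_iSup, MeasurableSpace.comap_comp,
      MeasurableSpace.comap_sup,
      iSup_sum, iSup_prod, vectorMeasureMeasurableSpace]
    rfl
  refine measure_ext_of_charFun e he fun I L => ?_
  -- A finite combination of evaluations separates into the part `T` on the first `M` customers and
  -- the part `U` on the last one.
  let T : (Fin M → VectorMeasure Ω E) →+ ℝ :=
    { toFun := fun z => ∑ j ∈ I, L j (Sum.elim (fun p => z p.1 p.2) (fun _ => 0) j)
      map_zero' := Finset.sum_eq_zero fun j _ => by rcases j with p | B <;> simp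
      map_add' := fun z z' => by
        rw [← Finset.sum_add_distrib]
        refine Finset.sum_congr rfl fun j _ => ?_
        rcases j with p | B <;> simp }
  let U : VectorMeasure Ω E →+ ℝ :=
    { toFun := fun z => ∑ j ∈ I, L j (Sum.elim (fun _ => 0) (fun B => z B) j)
      map_zero' := Finset.sum_eq_zero fun j _ => by rcases j with p | B <;> simp
      map_add' := fun z z' => by
        rw [← Finset.sum_add_distrib]
        refine Finset.sum_congr rfl fun j _ => ?_
        rcases j with p | B <;> simp }
  have hT : Measurable T := Finset.measurable_sum _ fun j _ => by
    refine (L j).continuous.measurable.comp ?_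
    rcases j with p | B
    · exact (measurable_vectorMeasure_apply p.2).comp (measurable_pi_apply p.1)
    · exact measurable_const
  have hU : Measurable U := Finset.measurable_sum _ fun j _ => by
    refine (L j).continuous.measurable.comp ?_
    rcases j with p | B
    · exact measurable_const
    · exact measurable_vectorMeasure_apply B
  have hTU : ∀ x, ∑ j ∈ I, L j (e x j) = T x.1 + U x.2 := fun x => by
    change _ = (∑ j ∈ I, _) + ∑ j ∈ I, _
    rw [← Finset.sum_add_distrib]
    refine Finset.sum_congr rfl fun j _ => ?_
    rcases j with p | B <;> simp [e]
  simp_rw [hTU]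
  have hf : Measurable fun x : (Fin M → VectorMeasure Ω E) × VectorMeasure Ω E =>
      Complex.exp ((T x.1 + U x.2 : ℝ) * Complex.I) := by fun_prop
  have hi : Integrable (fun x => Complex.exp ((T x.1 + U x.2 : ℝ) * Complex.I))
      ((Pr.map (firstCustomers τ w A)) ⊗ₘ κ) :=
    Integrable.of_bound hf.aestronglyMeasurable 1
      (ae_of_all _ fun x => (Complex.norm_exp_ofReal_mul_I _).le)
  rw [integral_map (hX.prodMk hY).aemeasurable hf.aestronglyMeasurable,
    Measure.integral_compProd hi, integral_map hX.aemeasurable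
      (hf.stronglyMeasurable.integral_kernel_prod_right' (κ := κ)).aestronglyMeasurable,
    h.integral_exp_pair hfin hν hP hm hκ T hT U hU]
  refine integral_congr_ae (ae_of_all _ fun θ => ?_)
  simp only [Complex.ofReal_add, add_mul, Complex.exp_add]
  exact (integral_const_mul _ _).symm

/-- A property of almost all features holds for all features that have been chosen. -/
theorem IsIBPModel.ae_forall_featureSet (h : IsIBPModel G ν τ w A Pr)
    (hfin : ∫⁻ x, piA G x.1 ∂ν < ∞) (hν : ∀ ω, ν (univ ×ˢ {ω}) = 0)
    {p : Ω × (Fin M → E) → Prop} (hp : ∀ᵐ y ∂(featureMeasure G ν M).fst, p y) :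
    ∀ᵐ θ ∂Pr, ∀ ω ∈ featureSet (firstCustomers τ w A θ),
      p (ω, scores (firstCustomers τ w A θ) ω) := by
  have hl : Measurable fun y : (ℝ × Ω) × (Fin (M + 1) → E) =>
    (y.1.2, fun i : Fin M => y.2 i.castSucc) := by fun_prop
  rw [← map_restrict_init_ne_zero_fst] at hp
  -- The marginal of `featureMeasure` is the image of the chosen marked points, so the property
  -- passes to almost every marked point with nonzero scores, and then to all actual points.
  have hp' := (ae_restrict_iff' measurableSet_init_ne_zero).1 (ae_of_ae_map hl.aemeasurable hp)
  filter_upwards [h.ae_forall_mem hp', h.ae_exists_sortedConfig hfin hν] with θ h1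
    ⟨K, k, hK, _, hkK, hy, hX⟩ ω hω
  have hi := injective_of_mem_sortedConfigs hy
  rw [hX] at hω ⊢
  rw [featureSet_configCustomers hi hy.2] at hω
  obtain ⟨l, rfl⟩ := hω
  have hmem := (hK (k l)).1 (hkK ▸ Finset.mem_image_of_mem k (Finset.mem_univ l))
  rw [scores_configCustomers hi l]
  exact h1 (k l) hmem.1 hmem.2

theorem IsIBPModel.ae_eq_predictiveLaw (h : IsIBPModel G ν τ w A Pr)
    (hfin : ∫⁻ x, piA G x.1 ∂ν < ∞) (hν : ∀ ω, ν (univ ×ˢ {ω}) = 0)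
    {m : Measure (VectorMeasure Ω E)} [IsProbabilityMeasure m]
    {κ : Kernel (Fin M → VectorMeasure Ω E) (VectorMeasure Ω E)}
    (hκ : ∀ (n : ℕ), ∀ y ∈ sortedConfigs Ω E M n,
      κ (configCustomers y) = configPredictive m G P y) :
    ∀ᵐ θ ∂Pr, ∃ S : Finset Ω, (S : Set Ω) = featureSet (firstCustomers τ w A θ) ∧
      κ (firstCustomers τ w A θ) = predictiveLaw m G P (firstCustomers τ w A θ) S := by
  classical
  filter_upwards [h.ae_exists_sortedConfig hfin hν] with θ ⟨K, k, _, _, _, hy, hX⟩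
  have hS : ((Finset.univ.image fun l => w (k l) θ : Finset Ω) : Set Ω) =
      featureSet (firstCustomers τ w A θ) := by
    rw [hX, featureSet_configCustomers (injective_of_mem_sortedConfigs hy) hy.2]
    simp
  refine ⟨_, hS, ?_⟩
  rw [hX] at hS ⊢
  rw [hκ _ _ hy, predictiveLaw_configCustomers hy hS]

end Main

end

end IBP

theorem proposition2p1 {Ω E Θ : Type*}
    [MeasurableSpace Ω] [StandardBorelSpace Ω]
    [NormedAddCommGroup E] [NormedSpace ℝ E] [FiniteDimensional ℝ E]
    [MeasurableSpace E] [BorelSpace E]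
    [MeasurableSpace Θ] (Pr : Measure Θ) [IsProbabilityMeasure Pr]
    (M : ℕ)
    -- the base measure of the features
    (B₀ : Measure Ω) [IsProbabilityMeasure B₀] [NullSingletonClass B₀]
    -- the Lévy density `ρ(s|ω)`
    (ρ : ℝ → Ω → ℝ≥0∞) (hρ_meas : Measurable (Function.uncurry ρ))
    (hρ : ∀ ω, ∫⁻ s in Ioi (0 : ℝ), ENNReal.ofReal (min s 1) * ρ s ω < ∞)
    -- the score distributions `G(· | s)`, with positive mass at zero
    (G : Kernel ℝ E) [IsMarkovKernel G]
    (hG : ∀ᵐ x ∂(IBP.intensity ρ B₀), G x.1 {0} ≠ 0)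
    -- each customer chooses finitely many features
    (hfin : ∫⁻ x, IBP.piA G x.1 ∂(IBP.intensity ρ B₀) < ∞)
    -- the model for `M + 1` customers
    (τ : ℕ → Θ → ℝ) (w : ℕ → Θ → Ω) (A : Fin (M + 1) → ℕ → Θ → E)
    (hmodel : IBP.IsIBPModel G (IBP.intensity ρ B₀) τ w A Pr) :
    -- the sums defining the `Zᵢ` are almost surely finite
    (∀ᵐ θ ∂Pr, ∀ i, {k | 0 < τ k θ ∧ A i k θ ≠ 0}.Finite) ∧
    -- the laws occurring in the conclusion exist
    (∃ m : Measure (VectorMeasure Ω E), IBP.IsIBPLaw G (IBP.intensity (IBP.rhoM G ρ M) B₀) m) ∧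
    (∃ P : Kernel (Ω × (Fin M → E)) ℝ, IBP.IsPosteriorJumpLaw G (IBP.intensity ρ B₀) P) ∧
    ∀ (m : Measure (VectorMeasure Ω E)) (P : Kernel (Ω × (Fin M → E)) ℝ),
      IBP.IsIBPLaw G (IBP.intensity (IBP.rhoM G ρ M) B₀) m → IBP.IsPosteriorJumpLaw G (IBP.intensity ρ B₀) P →
      -- the regular conditional law of `Z_{M+1}` given `Z₁, …, Z_M`
      (∃ κ : Kernel (Fin M → VectorMeasure Ω E) (VectorMeasure Ω E),
        IsMarkovKernel κ ∧
          HasCondDistrib (IBP.customer τ w A (Fin.last M)) (IBP.firstCustomers τ w A) κ Pr ∧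
        ∀ᵐ θ ∂Pr, ∃ S : Finset Ω,
          (S : Set Ω) = IBP.featureSet (IBP.firstCustomers τ w A θ) ∧
          κ (IBP.firstCustomers τ w A θ) =
            IBP.predictiveLaw m G P (IBP.firstCustomers τ w A θ) S) ∧
      -- when `G(da|s)` has a density on `{a ≠ 0}`, the jump law is given by the density formula
      (∀ (lam : Measure E) [SigmaFinite lam] (g : E → ℝ → ℝ≥0∞),
        Measurable (Function.uncurry g) →
        (∀ᵐ x ∂(IBP.intensity ρ B₀),
          (G x.1).restrict {0}ᶜ = (lam.restrict {0}ᶜ).withDensity (fun a => g a x.1)) →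
        ∀ᵐ θ ∂Pr, ∀ ω ∈ IBP.featureSet (IBP.firstCustomers τ w A θ),
          P (ω, IBP.scores (IBP.firstCustomers τ w A θ) ω) =
            IBP.jumpDensityLaw G ρ g ω (IBP.scores (IBP.firstCustomers τ w A θ) ω)) := by
  have hσ := IBP.sigmaFinite_intensity (B₀ := B₀) hρ_meas hρ
  have hν : ∀ ω, IBP.intensity ρ B₀ (univ ×ˢ {ω}) = 0 := IBP.intensity_prod_singleton
  have hσM : SigmaFinite ((IBP.intensity ρ B₀).withDensity fun x => (1 - IBP.piA G x.1) ^ M) :=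
    SigmaFinite.withDensity_of_ne_top (ae_of_all _ fun x =>
      ENNReal.pow_ne_top (ne_top_of_le_ne_top ENNReal.one_ne_top tsub_le_self))
  rw [IBP.intensity_rhoM G hρ_meas M]
  refine ⟨?_, hmodel.exists_isIBPLaw, IBP.exists_isPosteriorJumpLaw hfin, fun m P hm hP => ?_⟩
  · filter_upwards [hmodel.ae_finite_marks hfin] with θ hθ i
    exact hθ.subset fun k hk => ⟨hk.1, fun h0 => hk.2 (congrFun h0 i)⟩
  have hmp := hm.isProbabilityMeasure
  have hPM := hP.1
  have hPd := (IBP.isPosteriorJumpLaw_iff hfin P).1 hP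
  -- The kernel is built from the given `m` and `P`, so every version of the posterior jump law
  -- yields a version of the conditional law.
  obtain ⟨κ, hκM, hκ⟩ := IBP.exists_kernel_predictiveLaw m G P
  refine ⟨⟨κ, hκM, hmodel.hasCondDistrib hfin hν hPd hm hκ,
    hmodel.ae_eq_predictiveLaw hfin hν hκ⟩, fun lam _ g hg hd => ?_⟩
  exact hmodel.ae_forall_featureSet hfin hν (hP.ae_eq_jumpDensityLaw hρ_meas hg hfin hG hd)
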